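/- **Setting.** Let $(Y_t)_{t\ge 1}$ be i.i.d. random variables on a probability space $(\Omega,\mathcal F,\mathbb P)$ with values in a measurable space $\mathsf Y$. Let $\Theta\subseteq\mathbb R^d$ be a Borel set and let $f_\theta:\mathsf Y\to[0,\infty)$, $\theta\in\Theta$, be functions that are jointly measurable in $(\theta,y)$. Write $\tilde f_\theta=f_\theta$ if $\theta\in\Theta$ and $\tilde f_\theta=0$ otherwise, $\mathbb E[g]=\mathbb E[g(Y_1)]$, $B_\epsilon(x)$ for the open Euclidean ball, and $V_\epsilon=\Theta\setminus B_\epsilon(\theta_\star)$. Here $\log 0=-\infty$, and suprema inside an expectation are taken to be measurable. Assume that $\theta_\star\in\Theta$ is the unique maximiser over $\Theta$ of $\theta\mapsto\mathbb E[\log f_\theta]\in[-\infty,\infty)$, that $\mathbb E[\log f_{\theta_\star}]$ is finite, and that $\Theta$ is not too thin near $\theta_\star$: there are $\kappa,r_0>0$ such that for every $\theta\in\Theta\cap B_{r_0}(\theta_\star)$ and $r\in(0,r_0)$ the set $\Theta\cap B_r(\theta)$ contains a ball of radius $\kappa r$ (this holds if $\theta_\star$ is an interior point of $\Theta$, or if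 $\Theta$ is convex with non-empty interior). **The sequence.** Let $\nu>0$, let $(h_t)_{t\ge0}$ be a sequence in $[0,\infty)$ with $h_t\to0$, let $(t_p)_{p\ge0}$ be strictly increasing in $\{0,1,2,\dots\}$, and let $(\Sigma_t)_{t\ge0}$ be $d\times d$ positive definite matrices with $\sup_t(\|\Sigma_t\|\vee\|\Sigma_t^{-1}\|)<\infty$. Let $\mu_t=\delta_{0}$ if $h_t=0$; $\mu_t=\mathcal N_d(0,h_t^2\Sigma_t)$ if $h_t>0$ and $t\notin\{t_p\}_{p\ge 0}$; and $\mu_t=t_{d,\nu}(0,h_t^2\Sigma_t)$ (Student distribution with $\nu$ degrees of freedom) if $h_t>0$ and $t\in\{t_p\}_{p\ge 0}$. Let $\tilde\pi_0$ be a probability measure on $\Theta$ that is absolutely continuous with respect to Lebesgue measure and, for $t\ge1$, $$\tilde\pi_t(d\theta)=\frac{\tilde f_\theta(Y_t)\,(\mu_{t-1}*\tilde\pi_{t-1})(d\theta)}{\int_{\mathbb R^d} \tilde f_\theta(Y_t)\,(\mu_{t-1}*\tilde\pi_{t-1})(d\theta)},$$ where the denominators are assumed to be a.s. non-zero. **Assumptions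 on the model.** 1. There are $\delta>0$ and a measurable $m:\mathsf Y\to\mathbb R$ with $\mathbb E[m^2]<\infty$ such that a.s., for all $\theta_1,\theta_2\in B_\delta(\theta_\star)\cap\Theta$, $f_{\theta_1}(Y_1),f_{\theta_2}(Y_1)>0$ and $|\log(f_{\theta_1}(Y_1)/f_{\theta_2}(Y_1))|\le m(Y_1)\|\theta_1-\theta_2\|$. 2. There are $\delta>0$ and $C<\infty$ such that $\mathbb E[\log(f_{\theta_\star}/f_\theta)]\le C\|\theta-\theta_\star\|^2$ for all $\theta\in B_\delta(\theta_\star)\cap\Theta$. 3. For every compact $W\subseteq\Theta$ with $\theta_\star\in W$ and every $\epsilon>0$ there are measurable $\psi_t:\mathsf Y^t\to\{0,1\}$ with $\mathbb E[\psi_t(Y_{1:t})]\to0$ and $\sup_{\theta\in V_\epsilon\cap W}\mathbb E\big[(1-\psi_t(Y_{1:t}))\prod_{s=1}^t(f_\theta/f_{\theta_\star})(Y_s)\big]\to0$. 4. For some Borel set $A\subseteq\mathbb R^d$: (i) at least one of $\mathbb E[\sup_{\theta\notin A}\log\tilde f_\theta]<\mathbb E[\log f_{\theta_\star}]$, $\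 \sup_{\theta\notin A}\mathbb E[\tilde f_\theta/f_{\theta_\star}]<1$, $\ \log\sup_{\theta\notin A}\mathbb E[\tilde f_\theta]<\mathbb E[\log f_{\theta_\star}]$ holds; and (ii) there is a Borel set $\tilde A$ containing an open set that contains $A$, such that $\tilde A\cap\Theta$ is compact, $\theta\mapsto f_\theta(Y_1)$ is a.s. continuous on $\tilde A\cap\Theta$ and, for some $\tilde\delta>0$, $\mathbb E\big[\sup\{(\log(f_{\theta+v}/f_\theta))^2:\theta\in\tilde A\cap\Theta,\ \|v\|<\tilde\delta,\ \theta+v\in\Theta\}\big]<\infty$. 5. At least one of $\mathbb E[\sup_{\theta\in\Theta}\log f_\theta]<\infty$, $\ \sup_{\theta\in\Theta}\mathbb E[f_\theta/f_{\theta_\star}]<\infty$, $\ \sup_{\theta\in\Theta}\mathbb E[f_\theta]<\infty$ holds. **Theorem.** Suppose that * $h_{t_p}>0$ for all $p\ge0$; * $t_{p+1}-t_p\to\infty$ and $(t_p-t_{p-1})\sum_{s=t_{p-1}+1}^{t_p-1}h_s^2\to0$; * $\limsup_{p\to\infty}\frac{t_{p+1}-t_p}{t_p-t_{p-1}}<\infty$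 and $\frac{\log h_{t_{p-1}}}{t_p-t_{p-1}}\to0$; * there are $\beta,c\in(1,\infty)$ such that $\mathbb P\big(\tilde\pi_{t_p}(V_{c/h_{t_p}^{\beta}})\ge\beta^{-1}\big)\to0$ as $p\to\infty$. Then $\tilde\pi_t\Rightarrow\delta_{\theta_\star}$ in $\mathbb P$-probability, that is, the Prohorov distance between $\tilde\pi_t$ and $\delta_{\theta_\star}$ converges to $0$ in $\mathbb P$-probability as $t\to\infty$. -/

import Mathlib

open MeasureTheory ProbabilityTheory Filter Topology Set Metric
open scoped ENNReal NNReal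

namespace GPFSO

noncomputable section

/-- The Euclidean space `ℝ^d`. -/
abbrev Rd (d : ℕ) := EuclideanSpace ℝ (Fin d)

/-! ### Expectations of extended-real functions -/

/-- The expectation `𝔼[g(Y₁)] = 𝔼[g⁺] - 𝔼[g⁻]` of an extended-real function `g`, where `Y₁` has law
`ρ`. It is the usual (quasi-)integral with values in `[-∞, ∞)` when `𝔼[g⁺] < ∞`; when `𝔼[g⁺] = ∞`
(expectation infinite or undefined) its value is `∞`, so that `expect ρ g < a` and
`expect ρ g ≤ a` with `a` finite both say that the expectation exists and is bounded by `a`. -/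
def expect {S : Type*} [MeasurableSpace S] (ρ : Measure S) (g : S → EReal) : EReal :=
  open Classical in
  if ∫⁻ y, (g y).toENNReal ∂ρ = ⊤ then ⊤
  else ((∫⁻ y, (g y).toENNReal ∂ρ : ℝ≥0∞) : EReal) - ((∫⁻ y, (-g y).toENNReal ∂ρ : ℝ≥0∞) : EReal)

/-! ### The statistical model -/

section Model

variable {d : ℕ} {S : Type*}

/-- `V_ε = Θ ∖ B_ε(θ⋆)`. -/
def farSet (Θ : Set (Rd d)) (θs : Rd d) (ε : ℝ) : Set (Rd d) := Θ \ ball θs ε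

/-- `f_θ` extended by `0` outside `Θ`. -/
def extend (Θ : Set (Rd d)) (f : Rd d → S → ℝ≥0) (θ : Rd d) (y : S) : ℝ≥0∞ :=
  Θ.indicator (fun θ' => (f θ' y : ℝ≥0∞)) θ

/-- The ratio `f_θ / f_θ'`, as an extended non-negative number. -/
def ratio (f : Rd d → S → ℝ≥0) (θ θ' : Rd d) (y : S) : ℝ≥0∞ := (f θ y : ℝ≥0∞) / (f θ' y : ℝ≥0∞)

/-- `log f_θ`, with `log 0 = -∞`. -/
def logLik (f : Rd d → S → ℝ≥0) (θ : Rd d) (y : S) : EReal := ENNReal.log (f θ y : ℝ≥0∞)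

variable [MeasurableSpace S]

/-- `θ⋆` is the unique maximiser over `Θ` of `θ ↦ 𝔼[log f_θ(Y₁)]`, the maximum being finite. -/
structure IsTarget (ρ : Measure S) (Θ : Set (Rd d)) (f : Rd d → S → ℝ≥0) (θs : Rd d) :
    Prop where
  mem : θs ∈ Θ
  ne_bot : expect ρ (logLik f θs) ≠ ⊥
  ne_top : expect ρ (logLik f θs) ≠ ⊤
  lt : ∀ θ ∈ Θ, θ ≠ θs → expect ρ (logLik f θ) < expect ρ (logLik f θs)

/-- Near `θ⋆` the set `Θ` contains, inside every small ball centred at one of its points, a ball of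
comparable radius. It holds if `θ⋆` is an interior point of `Θ`, or if `Θ` is convex with non-empty
interior. -/
def InteriorBalls (Θ : Set (Rd d)) (θs : Rd d) : Prop :=
  ∃ κ > (0 : ℝ), ∃ r₀ > (0 : ℝ), ∀ θ ∈ Θ ∩ ball θs r₀, ∀ r : ℝ, 0 < r → r < r₀ →
    ∃ x : Rd d, ball x (κ * r) ⊆ Θ ∩ ball θ r

/-- Lipschitz log-likelihood around `θ⋆`, with a square-integrable Lipschitz constant. -/
def LocallyLipschitz (ρ : Measure S) (Θ : Set (Rd d)) (f : Rd d → S → ℝ≥0) (θs : Rd d) : Prop :=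
  ∃ δ > (0 : ℝ), ∃ m : S → ℝ, Measurable m ∧ Integrable (fun y => m y ^ 2) ρ ∧
    ∀ᵐ y ∂ρ, ∀ θ₁ ∈ ball θs δ ∩ Θ, ∀ θ₂ ∈ ball θs δ ∩ Θ,
      0 < f θ₁ y ∧ 0 < f θ₂ y ∧
        |Real.log ((f θ₁ y : ℝ) / (f θ₂ y : ℝ))| ≤ m y * ‖θ₁ - θ₂‖

/-- Quadratic upper bound on the Kullback-Leibler type divergence around `θ⋆`. -/
def QuadraticBound (ρ : Measure S) (Θ : Set (Rd d)) (f : Rd d → S → ℝ≥0) (θs : Rd d) : Prop :=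
  ∃ δ > (0 : ℝ), ∃ C : ℝ, ∀ θ ∈ ball θs δ ∩ Θ,
    expect ρ (fun y => ENNReal.log (ratio f θs θ y)) ≤ ((C * ‖θ - θs‖ ^ 2 : ℝ) : EReal)

/-- Existence, on every compact subset of `Θ` containing `θ⋆`, of consistent tests of `θ⋆` against
the complement of a ball; `Measure.pi (fun _ : Fin t => ρ)` is the law of `(Y_1, …, Y_t)`. -/
def ConsistentTests (ρ : Measure S) (Θ : Set (Rd d)) (f : Rd d → S → ℝ≥0) (θs : Rd d) : Prop :=
  ∀ W : Set (Rd d), W ⊆ Θ → IsCompact W → θs ∈ W → ∀ ε > (0 : ℝ),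
    ∃ ψ : (t : ℕ) → (Fin t → S) → ℝ≥0∞,
      (∀ t, Measurable (ψ t)) ∧ (∀ t y, ψ t y = 0 ∨ ψ t y = 1) ∧
      Tendsto (fun t => ∫⁻ y, ψ t y ∂(Measure.pi fun _ : Fin t => ρ)) atTop (𝓝 0) ∧
      Tendsto (fun t => ⨆ θ ∈ farSet Θ θs ε ∩ W,
        ∫⁻ y, (1 - ψ t y) * ∏ s, ratio f θ θs (y s) ∂(Measure.pi fun _ : Fin t => ρ))
        atTop (𝓝 0)

/-- The likelihood is smaller, in one of three senses, outside of `A` than at `θ⋆`. -/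
def SmallOutside (ρ : Measure S) (Θ : Set (Rd d)) (f : Rd d → S → ℝ≥0) (θs : Rd d)
    (A : Set (Rd d)) : Prop :=
  (AEMeasurable (fun y => ⨆ θ ∈ Aᶜ, ENNReal.log (extend Θ f θ y)) ρ ∧
    expect ρ (fun y => ⨆ θ ∈ Aᶜ, ENNReal.log (extend Θ f θ y)) < expect ρ (logLik f θs)) ∨
  (⨆ θ ∈ Aᶜ, ∫⁻ y, extend Θ f θ y / (f θs y : ℝ≥0∞) ∂ρ) < 1 ∨
  ENNReal.log (⨆ θ ∈ Aᶜ, ∫⁻ y, extend Θ f θ y ∂ρ) < expect ρ (logLik f θs)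

/-- `sup {log (f_{θ+v} / f_θ)}²` over `θ ∈ K` and `v ∈ B_δ(0)` with `θ + v ∈ Θ`. -/
def supSqLogRatio (Θ : Set (Rd d)) (f : Rd d → S → ℝ≥0) (K : Set (Rd d)) (δ : ℝ) (y : S) : ℝ≥0∞ :=
  ⨆ θ ∈ K, ⨆ v ∈ ball (0 : Rd d) δ, ⨆ _ : θ + v ∈ Θ,
    (EReal.abs (ENNReal.log (ratio f (θ + v) θ y))) ^ 2

/-- Control of the model at infinity, and regularity on a set containing a neighbourhood of `A`
whose trace on `Θ` is compact. -/
def Localizable (ρ : Measure S) (Θ : Set (Rd d)) (f : Rd d → S → ℝ≥0) (θs : Rd d) : Prop :=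
  ∃ A : Set (Rd d), MeasurableSet A ∧ SmallOutside ρ Θ f θs A ∧
    ∃ A' : Set (Rd d), MeasurableSet A' ∧ (∃ O : Set (Rd d), IsOpen O ∧ A ⊆ O ∧ O ⊆ A') ∧
      IsCompact (A' ∩ Θ) ∧ (∀ᵐ y ∂ρ, ContinuousOn (fun θ => f θ y) (A' ∩ Θ)) ∧
      ∃ δ > (0 : ℝ), AEMeasurable (supSqLogRatio Θ f (A' ∩ Θ) δ) ρ ∧
        ∫⁻ y, supSqLogRatio Θ f (A' ∩ Θ) δ y ∂ρ < ⊤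

/-- Global upper control of the likelihood, in one of three senses. -/
def UpperControl (ρ : Measure S) (Θ : Set (Rd d)) (f : Rd d → S → ℝ≥0) (θs : Rd d) : Prop :=
  (AEMeasurable (fun y => ⨆ θ ∈ Θ, logLik f θ y) ρ ∧
    expect ρ (fun y => ⨆ θ ∈ Θ, logLik f θ y) < ⊤) ∨
  (⨆ θ ∈ Θ, ∫⁻ y, ratio f θ θs y ∂ρ) < ⊤ ∨
  (⨆ θ ∈ Θ, ∫⁻ y, (f θ y : ℝ≥0∞) ∂ρ) < ⊤

end Model

/-! ### The sequence of distributions -/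

section Sequence

variable {d : ℕ}

/-- The `d`-dimensional Student distribution `t_{d,ν}(m, A)`. -/
def student (ν : ℝ) (m : Rd d) (A : Matrix (Fin d) (Fin d) ℝ) : Measure (Rd d) :=
  volume.withDensity fun x => ENNReal.ofReal
    (Real.Gamma ((ν + d) / 2) /
        (Real.Gamma (ν / 2) * (Real.pi * ν) ^ ((d : ℝ) / 2) * Real.sqrt A.det) *
      (1 + (x - m).ofLp ⬝ᵥ Matrix.mulVec A⁻¹ (x - m).ofLp / ν) ^ (-((ν + d) / 2)))

/-- The noise distribution `μ_s`: a Dirac mass at `0` if `h_s = 0`, a Student distribution if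
`h_s > 0` and `s` is one of the times `t_p`, and a Gaussian distribution otherwise. -/
def noise (ν : ℝ) (h : ℕ → ℝ) (τ : ℕ → ℕ) (Sig : ℕ → Matrix (Fin d) (Fin d) ℝ) (s : ℕ) :
    Measure (Rd d) :=
  open Classical in
  if h s = 0 then Measure.dirac 0
  else if s ∈ range τ then student ν 0 (h s ^ 2 • Sig s)
  else multivariateGaussian 0 (h s ^ 2 • Sig s)

/-- The normalising constant `∫_Θ f_θ(y) κ(dθ)`. -/
def normConst {S : Type*} (Θ : Set (Rd d)) (f : Rd d → S → ℝ≥0) (κ : Measure (Rd d)) (y : S) :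
    ℝ≥0∞ :=
  ∫⁻ θ, extend Θ f θ y ∂κ

/-- The Bayes update: the normalised measure proportional to `f_θ(y) κ|_Θ(dθ)`. -/
def bayes {S : Type*} (Θ : Set (Rd d)) (f : Rd d → S → ℝ≥0) (κ : Measure (Rd d)) (y : S) :
    Measure (Rd d) :=
  (normConst Θ f κ y)⁻¹ • κ.withDensity (fun θ => extend Θ f θ y)

/-- The sequence `π̃_t`, for the data `y 0 = y_1, y 1 = y_2, …` (the observation made at time `t + 1`
is `y t`) and the noise distributions `μ 0, μ 1, …`. -/
def post {S : Type*} (Θ : Set (Rd d)) (f : Rd d → S → ℝ≥0) (μ : ℕ → Measure (Rd d))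
    (π₀ : Measure (Rd d)) (y : ℕ → S) : ℕ → Measure (Rd d)
  | 0 => π₀
  | t + 1 => bayes Θ f ((μ t).conv (post Θ f μ π₀ y t)) (y t)

end Sequence

end

end GPFSO

/-!
The argument compares the mass which `π̃_t` gives to a neighbourhood of the target `θ⋆` with the mass
which it gives to the rest of the space, along one block `(t_p, t_{p+1}]` between two Student moves.

*Path representation.* Between two times, `π̃` is the law of the end point of a random walk
weighted by the product of the likelihood ratios `R(θ, y) = f_θ(y) / f_{θ⋆}(y)` along the walk
(`exists_lintegral_post_eq`). The hypotheses on `h` make the Gaussian moves of a block so small that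
the walk leaves a given ball around its starting point with a probability smaller than any
exponential of the length of the block (`eventually_walk_tail`). Hence the walk can be treated as
constant, at the scale of a fixed neighbourhood.

*Upper bound.* The region far away from `θ⋆` is covered by finitely many cells `U` carrying a
function `G` of the observation with `𝔼[R(θ, Y) e^{-G(Y)}] ≤ 1` on `U` and `𝔼[G(Y)] < 0`
(`exists_dominated_cover`). One cell is the complement of the set `A` in the assumption of control
at infinity; the others are small balls covering a compact set, for which `G` is obtained by
dominated convergence from `𝔼[log R(θ, Y)] < 0`. A path which remains in a cell has a product of
likelihood ratios at most `e^{∑ G(Y_s)}` times a variable of expectation at most one, and the law of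
large numbers makes this exponentially small. Some integrable `G`, with no sign condition, does the
same for the whole space (`exists_dominated_univ`), which is enough for the paths making a large
move, since these are superexponentially rare.

*Lower bound.* Paths started in a small ball contained in `Θ` and close to `θ⋆` have a product of
likelihood ratios at least `e^{-r ∑ m(Y_s)}`, by the Lipschitz assumption, with `r` as small as
needed (`le_weighted_univ`). Together these give `block_estimate`: the mass of the far region
decreases exponentially during a block, up to the ratio of the initial mass of the far region to
the initial mass of a fixed ball near the target.

*From one block to the next.* By tightness, the Student move sends a mass at least polynomial in
`h_{t_p}` to that ball, and a polynomial in `h_{t_p}` is negligible compared with the exponential of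
the length of the block. This gives exponential concentration at the end of every block
(`exists_tendsto_block_end`). At the beginning of the next block the mass is then concentrated near
`θ⋆`. The Student move sends a mass of order `h_{t_p} ^ ν` far away and a mass of the same order to
the ball near the target, so that the far region becomes negligible after a bounded number of
observations (`exists_eventually_block`). For the first few observations of the block, each step
preserves concentration up to a change of the constants (`exists_step`).
-/

namespace GPFSO

/-! ### Positive definite matrices with bounded condition -/

lemma dotProduct_mulVec_eq_inner {d : ℕ} (A : Matrix (Fin d) (Fin d) ℝ) (x y : Rd d) :
    x.ofLp ⬝ᵥ A.mulVec y.ofLp = inner ℝ x (Matrix.toEuclideanCLM (𝕜 := ℝ) A y) :=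
  (Matrix.inner_toEuclideanCLM A x y).symm

lemma dotProduct_mulVec_le {d : ℕ} {A : Matrix (Fin d) (Fin d) ℝ} {C : ℝ}
    (hA : ‖Matrix.toEuclideanCLM (𝕜 := ℝ) A‖ ≤ C) (x : Rd d) :
    x.ofLp ⬝ᵥ A.mulVec x.ofLp ≤ C * ‖x‖ ^ 2 := by
  rw [dotProduct_mulVec_eq_inner]
  calc inner ℝ x (Matrix.toEuclideanCLM (𝕜 := ℝ) A x)
      ≤ ‖x‖ * ‖Matrix.toEuclideanCLM (𝕜 := ℝ) A x‖ := real_inner_le_norm _ _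
    _ ≤ ‖x‖ * (C * ‖x‖) := by
        gcongr
        exact (ContinuousLinearMap.le_opNorm _ _).trans (by gcongr)
    _ = C * ‖x‖ ^ 2 := by ring

/-- Minimising `s ↦ ⟨A (A⁻¹ x - s x), A⁻¹ x - s x⟩ ≥ 0` bounds the inverse form from below. -/
lemma le_dotProduct_inv_mulVec {d : ℕ} {A : Matrix (Fin d) (Fin d) ℝ} (hA : A.PosDef) {C : ℝ}
    (hC : 0 < C) (hAC : ‖Matrix.toEuclideanCLM (𝕜 := ℝ) A‖ ≤ C) (x : Rd d) :
    ‖x‖ ^ 2 / C ≤ x.ofLp ⬝ᵥ A⁻¹.mulVec x.ofLp := by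
  have hdet : IsUnit A.det := hA.det_pos.ne'.isUnit
  set y : Fin d → ℝ := A⁻¹.mulVec x.ofLp with hy
  have hAy : A.mulVec y = x.ofLp := by
    rw [hy, Matrix.mulVec_mulVec, Matrix.mul_nonsing_inv _ hdet, Matrix.one_mulVec]
  have h0 := hA.posSemidef.dotProduct_mulVec_nonneg (y - C⁻¹ • x.ofLp)
  have hsymm : y ⬝ᵥ A.mulVec x.ofLp = x.ofLp ⬝ᵥ x.ofLp := by
    have hT : A.transpose = A := by
      have := hA.isHermitian
      simpa [Matrix.IsHermitian, Matrix.conjTranspose_eq_transpose_of_trivial] using this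
    rw [Matrix.dotProduct_mulVec, ← Matrix.mulVec_transpose, hT, hAy]
  have hxx : x.ofLp ⬝ᵥ x.ofLp = ‖x‖ ^ 2 := by
    rw [EuclideanSpace.real_norm_sq_eq]
    simp [dotProduct, sq]
  have hup := dotProduct_mulVec_le hAC x
  simp only [star_trivial, Matrix.mulVec_sub, Matrix.mulVec_smul, hAy, sub_dotProduct,
    dotProduct_sub, smul_dotProduct, dotProduct_smul, hsymm, hxx, smul_eq_mul] at h0
  have h1 : x.ofLp ⬝ᵥ y = y ⬝ᵥ x.ofLp := dotProduct_comm _ _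
  rw [h1]
  have h2 : C⁻¹ * (C⁻¹ * (x.ofLp ⬝ᵥ A.mulVec x.ofLp)) ≤ C⁻¹ * (C⁻¹ * (C * ‖x‖ ^ 2)) := by
    gcongr
  have h3 : C⁻¹ * (C⁻¹ * (C * ‖x‖ ^ 2)) = C⁻¹ * ‖x‖ ^ 2 := by field_simp
  rw [div_eq_inv_mul]
  linarith

lemma abs_det_le {d : ℕ} {A : Matrix (Fin d) (Fin d) ℝ} {C : ℝ}
    (hA : ‖Matrix.toEuclideanCLM (𝕜 := ℝ) A‖ ≤ C) : |A.det| ≤ d.factorial * C ^ d := by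
  have hC : 0 ≤ C := (norm_nonneg _).trans hA
  have hij : ∀ i j, |A i j| ≤ C := by
    intro i j
    have h1 : A i j = inner ℝ (EuclideanSpace.single i (1 : ℝ))
        (Matrix.toEuclideanCLM (𝕜 := ℝ) A (EuclideanSpace.single j (1 : ℝ))) := by
      rw [← dotProduct_mulVec_eq_inner]
      simp
    rw [h1]
    refine (abs_real_inner_le_norm _ _).trans ?_
    have h2 := (Matrix.toEuclideanCLM (𝕜 := ℝ) A).le_opNorm (EuclideanSpace.single j (1 : ℝ))
    simp only [PiLp.norm_single, norm_one, mul_one, one_mul] at h2 ⊢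
    exact h2.trans hA
  have := Matrix.det_le (A := A) (abv := AbsoluteValue.abs) (x := C) (by simpa using hij)
  simpa [nsmul_eq_mul] using this

/-! ### The Student distribution -/

/-- Two-sided bounds of the density of the Student noise at scale `h` by the same isotropic
profile. -/
lemma student_density_bounds {d : ℕ} {ν : ℝ} (hν : 0 < ν) {C : ℝ} (hC : 0 < C) :
    ∃ a > (0 : ℝ), ∃ b > (0 : ℝ), ∀ A : Matrix (Fin d) (Fin d) ℝ, A.PosDef →
      ‖Matrix.toEuclideanCLM (𝕜 := ℝ) A‖ ≤ C → ‖Matrix.toEuclideanCLM (𝕜 := ℝ) A⁻¹‖ ≤ C →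
      ∀ h : ℝ, 0 < h → ∀ x : Rd d,
        a * (h ^ d)⁻¹ * (1 + ‖x‖ ^ 2 / h ^ 2) ^ (-((ν + d) / 2)) ≤
          Real.Gamma ((ν + d) / 2) /
            (Real.Gamma (ν / 2) * (Real.pi * ν) ^ ((d : ℝ) / 2) * Real.sqrt (h ^ 2 • A).det) *
          (1 + (x - 0).ofLp ⬝ᵥ Matrix.mulVec (h ^ 2 • A)⁻¹ (x - 0).ofLp / ν) ^ (-((ν + d) / 2)) ∧
        Real.Gamma ((ν + d) / 2) /
            (Real.Gamma (ν / 2) * (Real.pi * ν) ^ ((d : ℝ) / 2) * Real.sqrt (h ^ 2 • A).det) *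
          (1 + (x - 0).ofLp ⬝ᵥ Matrix.mulVec (h ^ 2 • A)⁻¹ (x - 0).ofLp / ν) ^ (-((ν + d) / 2)) ≤
        b * (h ^ d)⁻¹ * (1 + ‖x‖ ^ 2 / h ^ 2) ^ (-((ν + d) / 2)) := by
  set e : ℝ := (ν + d) / 2 with he
  have he0 : 0 < e := by positivity
  set K : ℝ := Real.Gamma e / (Real.Gamma (ν / 2) * (Real.pi * ν) ^ ((d : ℝ) / 2)) with hK
  have hK0 : 0 < K := by
    have := Real.Gamma_pos_of_pos he0
    have := Real.Gamma_pos_of_pos (half_pos hν)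
    positivity
  set D : ℝ := d.factorial * C ^ d with hD
  have hD0 : 0 < D := by positivity
  set B : ℝ := max 1 (C / ν) with hB
  have hB0 : 0 < B := by positivity
  set b : ℝ := min 1 (1 / (C * ν)) with hb
  have hb0 : 0 < b := by positivity
  refine ⟨K / Real.sqrt D * B ^ (-e), by positivity, K * Real.sqrt D * b ^ (-e), by positivity,
    fun A hA hA1 hA2 h hh x => ?_⟩
  have hdet0 : 0 < A.det := hA.det_pos
  have hdetD : A.det ≤ D := (le_abs_self _).trans (abs_det_le hA1)
  have hdetD' : D⁻¹ ≤ A.det := by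
    have h1 := (le_abs_self _).trans (abs_det_le hA2)
    rw [Matrix.det_nonsing_inv, Ring.inverse_eq_inv'] at h1
    exact inv_le_of_inv_le₀ hdet0 h1
  have hsqrt : Real.sqrt (h ^ 2 • A).det = h ^ d * Real.sqrt A.det := by
    rw [Matrix.det_smul, Fintype.card_fin, Real.sqrt_mul (by positivity), ← pow_mul, mul_comm 2 d,
      pow_mul, Real.sqrt_sq (by positivity)]
  have hinv : (h ^ 2 • A)⁻¹ = (h ^ 2)⁻¹ • A⁻¹ := by
    have hu : IsUnit A.det := hdet0.ne'.isUnit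
    have := Matrix.inv_smul' (A := A) (Units.mk0 (h ^ 2) (by positivity)) hu
    simpa [Units.smul_def] using this
  have hquad : (x - 0).ofLp ⬝ᵥ Matrix.mulVec (h ^ 2 • A)⁻¹ (x - 0).ofLp =
      (h ^ 2)⁻¹ * (x.ofLp ⬝ᵥ A⁻¹.mulVec x.ofLp) := by
    rw [hinv, sub_zero, Matrix.smul_mulVec, dotProduct_smul, smul_eq_mul]
  have hq1 := dotProduct_mulVec_le hA2 x
  have hq2 := le_dotProduct_inv_mulVec hA hC hA1 x
  set q := x.ofLp ⬝ᵥ A⁻¹.mulVec x.ofLp with hq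
  rw [hquad, hsqrt]
  have hconst : Real.Gamma e / (Real.Gamma (ν / 2) * (Real.pi * ν) ^ ((d : ℝ) / 2) *
      (h ^ d * Real.sqrt A.det)) = K * (h ^ d)⁻¹ * (Real.sqrt A.det)⁻¹ := by
    rw [hK]; field_simp
  rw [hconst]
  set u : ℝ := ‖x‖ ^ 2 / h ^ 2 with hu
  have hu0 : 0 ≤ u := by positivity
  have hup : 1 + (h ^ 2)⁻¹ * q / ν ≤ B * (1 + u) := by
    have h1 : (h ^ 2)⁻¹ * q / ν ≤ (C / ν) * u := by
      calc (h ^ 2)⁻¹ * q / ν ≤ (h ^ 2)⁻¹ * (C * ‖x‖ ^ 2) / ν := by gcongr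
        _ = (C / ν) * u := by rw [hu]; field_simp
    have h2 : (C / ν) * u ≤ B * u := by gcongr; exact le_max_right _ _
    have h3 : 1 ≤ B := le_max_left _ _
    linarith
  have hlo : b * (1 + u) ≤ 1 + (h ^ 2)⁻¹ * q / ν := by
    have h1 : (1 / (C * ν)) * u ≤ (h ^ 2)⁻¹ * q / ν := by
      calc (1 / (C * ν)) * u = (h ^ 2)⁻¹ * (‖x‖ ^ 2 / C) / ν := by rw [hu]; field_simp
        _ ≤ (h ^ 2)⁻¹ * q / ν := by gcongr
    have h2 : b * u ≤ (1 / (C * ν)) * u := by gcongr; exact min_le_right _ _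
    have h3 : b ≤ 1 := min_le_left _ _
    linarith
  have hpos : 0 < b * (1 + u) := by positivity
  have hs1 : (Real.sqrt D)⁻¹ ≤ (Real.sqrt A.det)⁻¹ := by
    gcongr
  have hs2 : (Real.sqrt A.det)⁻¹ ≤ Real.sqrt D := by
    rw [← Real.sqrt_inv]
    exact Real.sqrt_le_sqrt (inv_le_of_inv_le₀ hD0 hdetD')
  constructor
  · calc K / Real.sqrt D * B ^ (-e) * (h ^ d)⁻¹ * (1 + u) ^ (-e)
        = K * (h ^ d)⁻¹ * (Real.sqrt D)⁻¹ * (B * (1 + u)) ^ (-e) := by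
          rw [Real.mul_rpow hB0.le (by positivity)]; ring
      _ ≤ _ := by
          gcongr ?_ * ?_
          · gcongr
          · exact Real.rpow_le_rpow_of_nonpos (hpos.trans_le hlo) hup (by linarith)
  · calc K * (h ^ d)⁻¹ * (Real.sqrt A.det)⁻¹ * (1 + (h ^ 2)⁻¹ * q / ν) ^ (-e)
        ≤ K * (h ^ d)⁻¹ * Real.sqrt D * (b * (1 + u)) ^ (-e) := by
          gcongr ?_ * ?_
          · exact Real.rpow_nonneg (hpos.le.trans hlo) _
          · gcongr
          · exact Real.rpow_le_rpow_of_nonpos hpos hlo (by linarith)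
      _ = _ := by rw [Real.mul_rpow hb0.le (by positivity)]; ring

lemma lintegral_one_add_norm_sq_rpow_lt_top (d : ℕ) {ν : ℝ} (hν : 0 < ν) :
    ∫⁻ z : Rd d, ENNReal.ofReal ((1 + ‖z‖ ^ 2) ^ (-((ν + d) / 2))) < ⊤ := by
  have h := integrable_rpow_neg_one_add_norm_sq (E := Rd d) (μ := volume) (r := ν + d)
    (by simp; exact hν)
  have := h.lintegral_lt_top
  simpa only [neg_div] using this

lemma lintegral_comp_inv_smul_Rd {d : ℕ} {h : ℝ} (hh : 0 < h) (g : Rd d → ℝ≥0∞)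
    (hg : Measurable g) :
    ∫⁻ x : Rd d, g (h⁻¹ • x) = ENNReal.ofReal (h ^ d) * ∫⁻ z, g z := by
  rw [← lintegral_map hg (measurable_const_smul h⁻¹),
    Measure.map_addHaar_smul volume (inv_ne_zero hh.ne')]
  simp [abs_of_pos hh]

lemma student_univ_le {d : ℕ} {ν : ℝ} (hν : 0 < ν) {C : ℝ} (hC : 0 < C) :
    ∃ c : ℝ≥0∞, c ≠ ⊤ ∧ ∀ A : Matrix (Fin d) (Fin d) ℝ, A.PosDef →
      ‖Matrix.toEuclideanCLM (𝕜 := ℝ) A‖ ≤ C → ‖Matrix.toEuclideanCLM (𝕜 := ℝ) A⁻¹‖ ≤ C →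
      ∀ h : ℝ, 0 < h → student ν (0 : Rd d) (h ^ 2 • A) univ ≤ c := by
  obtain ⟨a, ha, b, hb, H⟩ := student_density_bounds (d := d) hν hC
  refine ⟨ENNReal.ofReal b * ∫⁻ z : Rd d, ENNReal.ofReal ((1 + ‖z‖ ^ 2) ^ (-((ν + d) / 2))),
    ENNReal.mul_ne_top ENNReal.ofReal_ne_top (lintegral_one_add_norm_sq_rpow_lt_top d hν).ne,
    fun A hA hA1 hA2 h hh => ?_⟩
  rw [student, withDensity_apply _ MeasurableSet.univ, Measure.restrict_univ]
  calc _ ≤ ∫⁻ x : Rd d, ENNReal.ofReal (b * (h ^ d)⁻¹) *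
          ENNReal.ofReal ((1 + ‖h⁻¹ • x‖ ^ 2) ^ (-((ν + d) / 2))) := by
        refine lintegral_mono fun x => ?_
        rw [← ENNReal.ofReal_mul (by positivity)]
        refine ENNReal.ofReal_le_ofReal (((H A hA hA1 hA2 h hh x).2).trans (le_of_eq ?_))
        rw [norm_smul, mul_pow, norm_inv, Real.norm_of_nonneg hh.le, inv_pow, div_eq_inv_mul]
    _ = _ := by
        rw [lintegral_const_mul _ (by fun_prop), lintegral_comp_inv_smul_Rd hh (fun z =>
          ENNReal.ofReal ((1 + ‖z‖ ^ 2) ^ (-((ν + d) / 2)))) (by fun_prop), ← mul_assoc,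
          ← ENNReal.ofReal_mul (by positivity)]
        congr 2
        field_simp

/-- The Student noise at scale `h` charges the complement of a fixed ball by `O(h ^ ν)`. -/
lemma student_compl_ball_le {d : ℕ} {ν : ℝ} (hν : 0 < ν) {C : ℝ} (hC : 0 < C) {ε : ℝ}
    (hε : 0 < ε) :
    ∃ c > (0 : ℝ), ∀ A : Matrix (Fin d) (Fin d) ℝ, A.PosDef →
      ‖Matrix.toEuclideanCLM (𝕜 := ℝ) A‖ ≤ C → ‖Matrix.toEuclideanCLM (𝕜 := ℝ) A⁻¹‖ ≤ C →
      ∀ h : ℝ, 0 < h →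
        student ν (0 : Rd d) (h ^ 2 • A) (ball 0 ε)ᶜ ≤ ENNReal.ofReal (c * h ^ ν) := by
  obtain ⟨a, ha, b, hb, H⟩ := student_density_bounds (d := d) hν hC
  set e : ℝ := (ν + d) / 2 with he
  have he0 : 0 < e := by positivity
  set s : ℝ := ε ^ 2 / (1 + ε ^ 2) with hs
  have hs0 : 0 < s := by positivity
  set J := ∫⁻ z : Rd d, ENNReal.ofReal ((1 + ‖z‖ ^ 2) ^ (-e)) with hJ
  have hJt : J ≠ ⊤ := (lintegral_one_add_norm_sq_rpow_lt_top d hν).ne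
  refine ⟨b * s ^ (-e) * (J.toReal + 1), by positivity, fun A hA hA1 hA2 h hh => ?_⟩
  rw [student, withDensity_apply _ measurableSet_ball.compl]
  calc _ ≤ ∫⁻ x in (ball (0 : Rd d) ε)ᶜ, ENNReal.ofReal (b * s ^ (-e) * h ^ ν) *
          ENNReal.ofReal ((1 + ‖x‖ ^ 2) ^ (-e)) := by
        refine setLIntegral_mono' measurableSet_ball.compl fun x hx => ?_
        rw [← ENNReal.ofReal_mul (by positivity)]
        refine ENNReal.ofReal_le_ofReal (((H A hA hA1 hA2 h hh x).2).trans ?_)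
        have hx' : ε ≤ ‖x‖ := by simpa using hx
        have h1 : s * (1 + ‖x‖ ^ 2) ≤ ‖x‖ ^ 2 := by
          have : ε ^ 2 ≤ ‖x‖ ^ 2 := by gcongr
          rw [hs, div_mul_eq_mul_div, div_le_iff₀ (by positivity)]
          nlinarith
        have h2 : (1 + ‖x‖ ^ 2 / h ^ 2) ^ (-e) ≤ (s * (1 + ‖x‖ ^ 2) / h ^ 2) ^ (-e) := by
          refine Real.rpow_le_rpow_of_nonpos (by positivity) ?_ (by linarith)
          have : s * (1 + ‖x‖ ^ 2) / h ^ 2 ≤ ‖x‖ ^ 2 / h ^ 2 := by gcongr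
          linarith
        have h3 : (s * (1 + ‖x‖ ^ 2) / h ^ 2) ^ (-e) =
            s ^ (-e) * (1 + ‖x‖ ^ 2) ^ (-e) * (h ^ d * h ^ ν) := by
          rw [Real.div_rpow (by positivity) (by positivity), Real.mul_rpow hs0.le (by positivity),
            Real.rpow_neg (x := h ^ 2) (by positivity), div_inv_eq_mul, ← Real.rpow_natCast h 2,
            ← Real.rpow_mul hh.le, ← Real.rpow_natCast h d, ← Real.rpow_add hh]
          congr 2
          rw [he]; push_cast; ring
        calc b * (h ^ d)⁻¹ * (1 + ‖x‖ ^ 2 / h ^ 2) ^ (-e)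
            ≤ b * (h ^ d)⁻¹ * (s ^ (-e) * (1 + ‖x‖ ^ 2) ^ (-e) * (h ^ d * h ^ ν)) := by
              rw [← h3]; gcongr
          _ = b * s ^ (-e) * h ^ ν * (1 + ‖x‖ ^ 2) ^ (-e) := by field_simp
    _ ≤ ∫⁻ x : Rd d, ENNReal.ofReal (b * s ^ (-e) * h ^ ν) *
          ENNReal.ofReal ((1 + ‖x‖ ^ 2) ^ (-e)) := setLIntegral_le_lintegral _ _
    _ = ENNReal.ofReal (b * s ^ (-e) * h ^ ν) * J := by
        rw [lintegral_const_mul _ (by fun_prop)]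
    _ ≤ ENNReal.ofReal (b * s ^ (-e) * h ^ ν) * ENNReal.ofReal (J.toReal + 1) := by
        gcongr
        rw [← ENNReal.ofReal_toReal hJt]
        exact ENNReal.ofReal_le_ofReal (by simp)
    _ = _ := by
        rw [← ENNReal.ofReal_mul (by positivity)]
        congr 1; ring

/-- A ball within distance `M` of the origin receives at least its volume times the value of the
density profile at distance `M`. -/
lemma le_student_ball {d : ℕ} {ν : ℝ} (hν : 0 < ν) {C : ℝ} (hC : 0 < C) :
    ∃ a > (0 : ℝ), ∀ A : Matrix (Fin d) (Fin d) ℝ, A.PosDef →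
      ‖Matrix.toEuclideanCLM (𝕜 := ℝ) A‖ ≤ C → ‖Matrix.toEuclideanCLM (𝕜 := ℝ) A⁻¹‖ ≤ C →
      ∀ h : ℝ, 0 < h → ∀ (x : Rd d) (r M : ℝ), 0 < r → ball x r ⊆ closedBall 0 M →
        ENNReal.ofReal (a * (h ^ d)⁻¹ * r ^ d * (1 + M ^ 2 / h ^ 2) ^ (-((ν + d) / 2))) ≤
          student ν (0 : Rd d) (h ^ 2 • A) (ball x r) := by
  obtain ⟨a, ha, b, hb, H⟩ := student_density_bounds (d := d) hν hC
  set e : ℝ := (ν + d) / 2 with he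
  have he0 : 0 < e := by positivity
  set v := (volume (ball (0 : Rd d) 1)).toReal with hv
  have hvt : volume (ball (0 : Rd d) 1) ≠ ⊤ := measure_ball_lt_top.ne
  have hv0 : 0 < v := ENNReal.toReal_pos (measure_ball_pos _ _ one_pos).ne' hvt
  refine ⟨a * v, by positivity, fun A hA hA1 hA2 h hh x r M hr hM => ?_⟩
  have hvol : volume (ball x r) = ENNReal.ofReal (r ^ d * v) := by
    rw [Measure.addHaar_ball_of_pos volume x hr, ENNReal.ofReal_mul (by positivity), hv,
      ENNReal.ofReal_toReal hvt]
    simp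
  rw [student, withDensity_apply _ measurableSet_ball]
  calc _ = ∫⁻ _ in ball x r, ENNReal.ofReal (a * (h ^ d)⁻¹ * (1 + M ^ 2 / h ^ 2) ^ (-e)) := by
        rw [setLIntegral_const, hvol, ← ENNReal.ofReal_mul (by positivity)]
        congr 1; ring
    _ ≤ _ := by
        refine setLIntegral_mono' measurableSet_ball fun y hy => ENNReal.ofReal_le_ofReal
          (le_trans ?_ (H A hA hA1 hA2 h hh y).1)
        have hy' : ‖y‖ ≤ M := by simpa using hM hy
        gcongr ?_ * ?_
        refine Real.rpow_le_rpow_of_nonpos (by positivity) ?_ (by linarith)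
        gcongr

/-- Jumps of the Student noise at scale `h ≤ 1` into a fixed ball, seen from a distance of order
`h ^ (-β)`, have at least polynomially small probability in `h`. -/
lemma le_student_ball_far {d : ℕ} {ν : ℝ} (hν : 0 < ν) {C : ℝ} (hC : 0 < C) {β M r : ℝ}
    (hβ : 0 ≤ β) (hr : 0 < r) :
    ∃ c > (0 : ℝ), ∀ A : Matrix (Fin d) (Fin d) ℝ, A.PosDef →
      ‖Matrix.toEuclideanCLM (𝕜 := ℝ) A‖ ≤ C → ‖Matrix.toEuclideanCLM (𝕜 := ℝ) A⁻¹‖ ≤ C →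
      ∀ h : ℝ, 0 < h → h ≤ 1 → ∀ x : Rd d, ball x r ⊆ closedBall 0 (M * h ^ (-β)) →
        ENNReal.ofReal (c * h ^ (ν + β * (ν + d))) ≤
          student ν (0 : Rd d) (h ^ 2 • A) (ball x r) := by
  obtain ⟨a, ha, H⟩ := le_student_ball (d := d) hν hC
  set e : ℝ := (ν + d) / 2 with he
  have he0 : 0 < e := by positivity
  refine ⟨a * r ^ d * (1 + M ^ 2) ^ (-e), by positivity, fun A hA hA1 hA2 h hh hh1 x hx =>
    (ENNReal.ofReal_le_ofReal ?_).trans (H A hA hA1 hA2 h hh x r _ hr hx)⟩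
  have h1 : 1 + (M * h ^ (-β)) ^ 2 / h ^ 2 ≤ (1 + M ^ 2) * h ^ (-2 * (β + 1)) := by
    have e1 : (h ^ (-β)) ^ 2 / h ^ 2 = h ^ (-2 * (β + 1)) := by
      rw [← Real.rpow_natCast (h ^ (-β)) 2, ← Real.rpow_mul hh.le, ← Real.rpow_natCast h 2,
        ← Real.rpow_sub hh]
      congr 1; push_cast; ring
    have e2 : 1 ≤ h ^ (-2 * (β + 1)) :=
      Real.one_le_rpow_of_pos_of_le_one_of_nonpos hh hh1 (by nlinarith)
    rw [mul_pow, mul_div_assoc, e1]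
    nlinarith [sq_nonneg M]
  have h2 : (1 + M ^ 2) ^ (-e) * h ^ ((β + 1) * (ν + d)) ≤
      (1 + (M * h ^ (-β)) ^ 2 / h ^ 2) ^ (-e) := by
    have := Real.rpow_le_rpow_of_nonpos (z := -e) (by positivity) h1 (by linarith)
    rw [Real.mul_rpow (by positivity) (by positivity), ← Real.rpow_mul hh.le] at this
    convert this using 3
    rw [he]; ring
  calc a * r ^ d * (1 + M ^ 2) ^ (-e) * h ^ (ν + β * (ν + d))
      = a * (h ^ d)⁻¹ * r ^ d * ((1 + M ^ 2) ^ (-e) * h ^ ((β + 1) * (ν + d))) := by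
        have : h ^ ((β + 1) * (ν + d)) = h ^ (ν + β * (ν + d)) * h ^ d := by
          rw [← Real.rpow_natCast h d, ← Real.rpow_add hh]
          congr 1; ring
        rw [this]; field_simp
    _ ≤ _ := by gcongr

/-- From a distance at most `h`, a ball of radius comparable to `h` is reached by the Student noise
at scale `h` with probability bounded below. -/
lemma le_student_ball_near {d : ℕ} {ν : ℝ} (hν : 0 < ν) {C : ℝ} (hC : 0 < C) {r : ℝ}
    (hr : 0 < r) :
    ∃ c > (0 : ℝ), ∀ A : Matrix (Fin d) (Fin d) ℝ, A.PosDef →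
      ‖Matrix.toEuclideanCLM (𝕜 := ℝ) A‖ ≤ C → ‖Matrix.toEuclideanCLM (𝕜 := ℝ) A⁻¹‖ ≤ C →
      ∀ h : ℝ, 0 < h → ∀ x : Rd d, ‖x‖ ≤ h →
        ENNReal.ofReal c ≤ student ν (0 : Rd d) (h ^ 2 • A) (ball x (r * h)) := by
  obtain ⟨a, ha, H⟩ := le_student_ball (d := d) hν hC
  refine ⟨a * r ^ d * (1 + (1 + r) ^ 2) ^ (-((ν + d) / 2)), by positivity,
    fun A hA hA1 hA2 h hh x hx => (le_of_eq ?_).trans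
      (H A hA hA1 hA2 h hh x (r * h) ((1 + r) * h) (by positivity) ?_)⟩
  · have : ((1 + r) * h) ^ 2 / h ^ 2 = (1 + r) ^ 2 := by field_simp
    rw [this, mul_pow]
    congr 1
    field_simp
  · intro y hy
    rw [mem_closedBall_zero_iff]
    rw [mem_ball_iff_norm] at hy
    calc ‖y‖ = ‖(y - x) + x‖ := by simp
      _ ≤ ‖y - x‖ + ‖x‖ := norm_add_le _ _
      _ ≤ (1 + r) * h := by linarith

/-! ### The Gaussian noise -/

open scoped MatrixOrder in
lemma norm_sq_sqrt_apply {d : ℕ} {A : Matrix (Fin d) (Fin d) ℝ} (hA : A.PosSemidef) (z : Rd d) :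
    ‖Matrix.toEuclideanCLM (𝕜 := ℝ) (CFC.sqrt A) z‖ ^ 2 = z.ofLp ⬝ᵥ A.mulVec z.ofLp := by
  have hsa : IsSelfAdjoint (Matrix.toEuclideanCLM (𝕜 := ℝ) (CFC.sqrt A)) :=
    (CFC.sqrt_nonneg A).isSelfAdjoint.map _
  have hmul : Matrix.toEuclideanCLM (𝕜 := ℝ) (CFC.sqrt A) *
      Matrix.toEuclideanCLM (𝕜 := ℝ) (CFC.sqrt A) = Matrix.toEuclideanCLM (𝕜 := ℝ) A := by
    rw [← map_mul, CFC.sqrt_mul_sqrt_self _ hA.nonneg]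
  rw [← Matrix.inner_toEuclideanCLM, ← hmul, mul_apply_eq_comp,
    ← ContinuousLinearMap.adjoint_inner_left, hsa.adjoint_eq, real_inner_self_eq_norm_sq]

instance isOpenPosMeasure_stdGaussian {d : ℕ} :
    (stdGaussian (Rd d)).IsOpenPosMeasure := by
  have h1 : (gaussianReal 0 1).IsOpenPosMeasure :=
    (gaussianReal_absolutelyContinuous' 0 one_ne_zero).isOpenPosMeasure
  rw [← map_pi_eq_stdGaussian]
  exact (PiLp.continuous_toLp 2 _).isOpenPosMeasure_map (WithLp.toLp_surjective 2)

lemma exists_le_stdGaussian_ball (d : ℕ) (M : ℝ) {r : ℝ} (hr : 0 < r) :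
    ∃ c > (0 : ℝ), ∀ z : Rd d, ‖z‖ ≤ M → ENNReal.ofReal c ≤ stdGaussian (Rd d) (ball z r) := by
  obtain ⟨t, -, htf, ht⟩ := (isCompact_closedBall (0 : Rd d) M).finite_cover_balls (half_pos hr)
  have hpos : ∀ z : Rd d, 0 < stdGaussian (Rd d) (ball z (r / 2)) := fun z =>
    measure_ball_pos _ _ (half_pos hr)
  obtain ⟨c, hc0, hc⟩ : ∃ c > (0 : ℝ), ∀ z ∈ t, c ≤ (stdGaussian (Rd d)).real (ball z (r / 2)) := by
    rcases t.eq_empty_or_nonempty with rfl | hne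
    · exact ⟨1, one_pos, by simp⟩
    · obtain ⟨z0, hz0, hmin⟩ := htf.exists_minimalFor
        (fun z => (stdGaussian (Rd d)).real (ball z (r / 2))) t hne
      refine ⟨_, ENNReal.toReal_pos (hpos z0).ne' (measure_ne_top _ _), fun z hz => ?_⟩
      rcases le_total ((stdGaussian (Rd d)).real (ball z0 (r / 2)))
        ((stdGaussian (Rd d)).real (ball z (r / 2))) with h | h
      · exact h
      · exact hmin hz h
  refine ⟨c, hc0, fun z hz => ?_⟩
  have hz' : z ∈ ⋃ x ∈ t, ball x (r / 2) := ht (by simpa using hz)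
  simp only [mem_iUnion] at hz'
  obtain ⟨x, hx, hzx⟩ := hz'
  have hsub : ball x (r / 2) ⊆ ball z r := by
    refine ball_subset_ball' ?_
    rw [dist_comm]
    linarith [mem_ball.1 hzx]
  calc ENNReal.ofReal c ≤ ENNReal.ofReal ((stdGaussian (Rd d)).real (ball x (r / 2))) :=
        ENNReal.ofReal_le_ofReal (hc x hx)
    _ = stdGaussian (Rd d) (ball x (r / 2)) := by simp
    _ ≤ _ := measure_mono hsub

lemma posDef_sq_smul {d : ℕ} {A : Matrix (Fin d) (Fin d) ℝ} (hA : A.PosDef) {h : ℝ} (hh : 0 < h) :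
    (h ^ 2 • A).PosDef := hA.smul (by positivity)

open scoped MatrixOrder in
/-- From a distance at most `h`, a ball of radius comparable to `h` is reached by the Gaussian noise
at scale `h` with probability bounded below. -/
lemma le_gaussian_ball_near (d : ℕ) {C : ℝ} (hC : 0 < C) {r : ℝ} (hr : 0 < r) :
    ∃ c > (0 : ℝ), ∀ A : Matrix (Fin d) (Fin d) ℝ, A.PosDef →
      ‖Matrix.toEuclideanCLM (𝕜 := ℝ) A‖ ≤ C → ‖Matrix.toEuclideanCLM (𝕜 := ℝ) A⁻¹‖ ≤ C →
      ∀ h : ℝ, 0 < h → ∀ x : Rd d, ‖x‖ ≤ h →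
        ENNReal.ofReal c ≤ multivariateGaussian (0 : Rd d) (h ^ 2 • A) (ball x (r * h)) := by
  have hsC : 0 < Real.sqrt C := Real.sqrt_pos.2 hC
  obtain ⟨c, hc0, hc⟩ := exists_le_stdGaussian_ball d (Real.sqrt C) (r := r / Real.sqrt C)
    (by positivity)
  refine ⟨c, hc0, fun A hA hA1 hA2 h hh x hx => ?_⟩
  set T := Matrix.toEuclideanCLM (𝕜 := ℝ) (CFC.sqrt (h ^ 2 • A)) with hT
  have hTz : ∀ z : Rd d, ‖T z‖ ^ 2 = h ^ 2 * (z.ofLp ⬝ᵥ A.mulVec z.ofLp) := fun z => by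
    rw [hT, norm_sq_sqrt_apply (posDef_sq_smul hA hh).posSemidef, Matrix.smul_mulVec,
      dotProduct_smul, smul_eq_mul]
  have hup : ∀ z, ‖T z‖ ≤ Real.sqrt C * h * ‖z‖ := fun z => by
    refine le_of_sq_le_sq ?_ (by positivity)
    rw [hTz, mul_pow, mul_pow, Real.sq_sqrt hC.le]
    have := dotProduct_mulVec_le hA1 z
    calc _ ≤ h ^ 2 * (C * ‖z‖ ^ 2) := by gcongr
      _ = _ := by ring
  have hlo : ∀ z, h * ‖z‖ ≤ Real.sqrt C * ‖T z‖ := fun z => by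
    refine le_of_sq_le_sq ?_ (by positivity)
    rw [mul_pow, mul_pow, hTz, Real.sq_sqrt hC.le]
    have h1 := le_dotProduct_inv_mulVec hA.inv hC hA2 z
    rw [Matrix.nonsing_inv_nonsing_inv _ hA.det_pos.ne'.isUnit, div_le_iff₀ hC] at h1
    calc _ ≤ h ^ 2 * (z.ofLp ⬝ᵥ A.mulVec z.ofLp * C) := by gcongr
      _ = _ := by ring
  have hinj : Function.Injective (T : Rd d →ₗ[ℝ] Rd d) := by
    rw [← LinearMap.ker_eq_bot, LinearMap.ker_eq_bot']
    intro z hz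
    have h1 := hlo z
    have h2 : T z = 0 := hz
    rw [h2, norm_zero, mul_zero] at h1
    have : ‖z‖ ≤ 0 := by
      by_contra hcon
      push Not at hcon
      nlinarith [mul_pos hh hcon]
    exact norm_le_zero_iff.1 this
  obtain ⟨z, hz⟩ := LinearMap.injective_iff_surjective.1 hinj x
  have hz' : T z = x := hz
  have hzn : ‖z‖ ≤ Real.sqrt C := by
    have h1 := hlo z
    rw [hz'] at h1
    have h2 : h * ‖z‖ ≤ h * Real.sqrt C := h1.trans (by rw [mul_comm h]; gcongr)
    exact le_of_mul_le_mul_left h2 hh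
  rw [multivariateGaussian, Measure.map_apply (by fun_prop) measurableSet_ball]
  refine (hc z hzn).trans (measure_mono fun y hy => ?_)
  rw [mem_ball_iff_norm] at hy
  have key : ‖T y - x‖ < r * h := by
   have : T y - x = T (y - z) := by rw [map_sub, hz']
   rw [this]
   calc ‖T (y - z)‖ ≤ Real.sqrt C * h * ‖y - z‖ := hup _
     _ < Real.sqrt C * h * (r / Real.sqrt C) := by gcongr
     _ = r * h := by field_simp
  simpa [dist_eq_norm] using key

/-! ### Partial sums of independent Gaussian noises -/

lemma HasSubgaussianMGF.mono {Ω : Type*} [MeasurableSpace Ω] {μ : Measure Ω} {X : Ω → ℝ}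
    {c c' : ℝ≥0} (h : HasSubgaussianMGF X c μ) (hc : c ≤ c') : HasSubgaussianMGF X c' μ :=
  ⟨h.integrable_exp_mul, fun t => (h.mgf_le t).trans (by gcongr)⟩

lemma diag_le {d : ℕ} {A : Matrix (Fin d) (Fin d) ℝ} {C : ℝ}
    (hA : ‖Matrix.toEuclideanCLM (𝕜 := ℝ) A‖ ≤ C) (i : Fin d) : A i i ≤ C := by
  have := dotProduct_mulVec_le hA (EuclideanSpace.single i (1 : ℝ))
  simpa using this

/-- The position at time `j` of the walk with increments `ξ`. -/
def walk {d : ℕ} (ξ : ℕ → Rd d) (j : ℕ) : Rd d := ∑ i ∈ Finset.range j, ξ i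

lemma measurable_walk {d : ℕ} (j : ℕ) : Measurable fun ξ : ℕ → Rd d => walk ξ j := by
  unfold walk
  exact Finset.measurable_sum _ fun i _ => measurable_pi_apply i

lemma norm_le_sum_abs {d : ℕ} (x : Rd d) : ‖x‖ ≤ ∑ i, |x i| := by
  have h : x = ∑ i, x i • EuclideanSpace.basisFun (Fin d) ℝ i := by
    ext j
    simp [Finset.sum_apply, Pi.single_apply]
  calc ‖x‖ = ‖∑ i, x i • EuclideanSpace.basisFun (Fin d) ℝ i‖ := by rw [← h]
    _ ≤ ∑ i, ‖x i • EuclideanSpace.basisFun (Fin d) ℝ i‖ := norm_sum_le _ _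
    _ = ∑ i, |x i| := by simp [norm_smul]

/-- The Gaussian tail of the walk whose increments are independent centred Gaussian vectors at
scales `η i`, by a union bound over the times and the coordinates. The positions at times less than
`k` involve the first `k - 1` increments only. -/
lemma walk_tail {d : ℕ} {C : ℝ} (hC : 0 < C) (η : ℕ → ℝ)
    (A : ℕ → Matrix (Fin d) (Fin d) ℝ) (hA : ∀ i, (A i).PosDef)
    (hA1 : ∀ i, ‖Matrix.toEuclideanCLM (𝕜 := ℝ) (A i)‖ ≤ C) (k : ℕ) {V : ℝ} (hV : 0 < V)
    (hηV : ∑ i ∈ Finset.range (k - 1), η i ^ 2 ≤ V) {r : ℝ} (hr : 0 < r) :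
    Measure.infinitePi (fun i => multivariateGaussian (0 : Rd d) (η i ^ 2 • A i))
        {ξ | ∃ j < k, r ≤ ‖walk ξ j‖} ≤
      ENNReal.ofReal (k * (d * (2 * Real.exp (-(r / (d + 1)) ^ 2 / (2 * (C * V)))))) := by
  set Q := Measure.infinitePi (fun i => multivariateGaussian (0 : Rd d) (η i ^ 2 • A i)) with hQ
  have hps : ∀ i, (η i ^ 2 • A i).PosSemidef := fun i =>
    (hA i).posSemidef.smul (by positivity)
  set CV : ℝ≥0 := (C * V).toNNReal with hCV
  have hCV' : (CV : ℝ) = C * V := Real.coe_toNNReal _ (by positivity)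
  have hlaw : ∀ (l : Fin d) (i : ℕ), HasSubgaussianMGF (fun ξ : ℕ → Rd d => ξ i l)
      (C * η i ^ 2).toNNReal Q := by
    intro l i
    have h1 : MeasurePreserving (fun ξ : ℕ → Rd d => ξ i l) Q
        (gaussianReal 0 ((η i ^ 2 • A i) l l).toNNReal) := by
      have := (measurePreserving_eval_multivariateGaussian (μ := (0 : Rd d)) (hps i) (i := l)).comp
        (measurePreserving_eval_infinitePi
          (fun i => multivariateGaussian (0 : Rd d) (η i ^ 2 • A i)) i)
      simpa [Function.comp_def] using this
    have h2 : HasSubgaussianMGF (fun ξ : ℕ → Rd d => ξ i l) ((η i ^ 2 • A i) l l).toNNReal Q := by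
      refine ⟨fun t => ?_, fun t => ?_⟩
      · have := (h1.integrable_comp (g := fun x => Real.exp (t * x))
          (by fun_prop)).2 (integrable_exp_mul_gaussianReal t)
        simpa [Function.comp_def] using this
      · rw [mgf_gaussianReal h1.map_eq]
        simp
    refine HasSubgaussianMGF.mono h2 ?_
    refine Real.toNNReal_le_toNNReal ?_
    rw [Matrix.smul_apply, smul_eq_mul, mul_comm]
    have := diag_le (hA1 i) l
    gcongr
  have hind : ∀ l : Fin d, iIndepFun (fun i (ξ : ℕ → Rd d) => ξ i l) Q := fun l =>
    iIndepFun_infinitePi (X := fun _ (x : Rd d) => x l) (fun _ => by fun_prop)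
  have hsum : ∀ (l : Fin d) (j : ℕ), j < k →
      HasSubgaussianMGF (fun ξ : ℕ → Rd d => walk ξ j l) CV Q := by
    intro l j hj
    have h1 := HasSubgaussianMGF.sum_of_iIndepFun (hind l) (s := Finset.range j)
      (fun i _ => hlaw l i)
    have h2 : (fun ξ : ℕ → Rd d => walk ξ j l) = fun ξ => ∑ i ∈ Finset.range j, ξ i l := by
      ext ξ; simp [walk]
    rw [h2]
    refine HasSubgaussianMGF.mono h1 ?_
    rw [← NNReal.coe_le_coe, NNReal.coe_sum, hCV']
    simp_rw [fun i => Real.coe_toNNReal (C * η i ^ 2) (by positivity)]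
    rw [← Finset.mul_sum]
    gcongr
    refine le_trans (Finset.sum_le_sum_of_subset_of_nonneg ?_ fun i _ _ => by positivity) hηV
    exact Finset.range_subset_range.2 (by omega)
  set b := Real.exp (-(r / (d + 1)) ^ 2 / (2 * (C * V))) with hb
  have htail : ∀ (l : Fin d) (j : ℕ), j < k →
      Q {ξ | r / (d + 1) ≤ |walk ξ j l|} ≤ ENNReal.ofReal (2 * b) := by
    intro l j hj
    have hr' : 0 ≤ r / (d + 1) := by positivity
    have h1 := (hsum l j hj).measure_ge_le hr'
    have h2 := (hsum l j hj).neg.measure_ge_le hr'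
    rw [hCV', ← hb] at h1 h2
    simp only [Pi.neg_apply] at h2
    have hsub : {ξ : ℕ → Rd d | r / (d + 1) ≤ |walk ξ j l|} ⊆
        {ξ | r / (d + 1) ≤ walk ξ j l} ∪ {ξ | r / (d + 1) ≤ -(walk ξ j l)} := by
      intro ξ hξ
      simpa [le_abs] using hξ
    calc _ ≤ Q {ξ | r / (d + 1) ≤ walk ξ j l} + Q {ξ | r / (d + 1) ≤ -(walk ξ j l)} :=
          (measure_mono hsub).trans (measure_union_le _ _)
      _ ≤ ENNReal.ofReal b + ENNReal.ofReal b := by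
          gcongr
          · rw [← ofReal_measureReal]
            exact ENNReal.ofReal_le_ofReal h1
          · rw [← ofReal_measureReal]
            exact ENNReal.ofReal_le_ofReal h2
      _ = _ := by rw [← ENNReal.ofReal_add (by positivity) (by positivity)]; congr 1; ring
  have hsub : {ξ : ℕ → Rd d | ∃ j < k, r ≤ ‖walk ξ j‖} ⊆
      ⋃ j ∈ Finset.range k, ⋃ l ∈ (Finset.univ : Finset (Fin d)),
        {ξ | r / (d + 1) ≤ |walk ξ j l|} := by
    rintro ξ ⟨j, hj, hrj⟩
    simp only [mem_iUnion, Finset.mem_range, Finset.mem_univ, mem_ofPred_eq, exists_prop, true_and]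
    refine ⟨j, hj, ?_⟩
    by_contra hcon
    push Not at hcon
    have h1 : ‖walk ξ j‖ ≤ ∑ _l : Fin d, r / (d + 1) :=
      (norm_le_sum_abs _).trans (Finset.sum_le_sum fun l _ => (hcon l).le)
    rw [Finset.sum_const, Finset.card_univ, Fintype.card_fin, nsmul_eq_mul] at h1
    have h2 : (d : ℝ) * (r / (d + 1)) < r := by
      rw [mul_div_assoc', div_lt_iff₀ (by positivity)]
      nlinarith
    linarith
  calc _ ≤ _ := measure_mono hsub
    _ ≤ ∑ j ∈ Finset.range k, ∑ l : Fin d, Q {ξ | r / (d + 1) ≤ |walk ξ j l|} := by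
        refine (measure_biUnion_finset_le _ _).trans (Finset.sum_le_sum fun j _ => ?_)
        exact measure_biUnion_finset_le _ _
    _ ≤ ∑ _j ∈ Finset.range k, ∑ _l : Fin d, ENNReal.ofReal (2 * b) := by
        refine Finset.sum_le_sum fun j hj => Finset.sum_le_sum fun l _ => ?_
        exact htail l j (Finset.mem_range.1 hj)
    _ = _ := by
        simp only [Finset.sum_const, Finset.card_univ, Fintype.card_fin, nsmul_eq_mul,
          Finset.card_range]
        rw [ENNReal.ofReal_mul (by positivity), ENNReal.ofReal_mul (by positivity)]
        simp

/-! ### The noise distributions -/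

lemma gaussian_compl_ball_le {d : ℕ} {C : ℝ} (hC : 0 < C) {A : Matrix (Fin d) (Fin d) ℝ}
    (hA : A.PosDef) (hA1 : ‖Matrix.toEuclideanCLM (𝕜 := ℝ) A‖ ≤ C) {h : ℝ} (hh : 0 < h) {ε : ℝ}
    (hε : 0 < ε) :
    multivariateGaussian (0 : Rd d) (h ^ 2 • A) (ball 0 ε)ᶜ ≤
      ENNReal.ofReal (2 * (d * (2 * Real.exp (-(ε / (d + 1)) ^ 2 / (2 * (C * h ^ 2)))))) := by
  have hw := walk_tail hC (fun _ => h) (fun _ => A) (fun _ => hA) (fun _ => hA1) 2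
    (V := h ^ 2) (by positivity) (by simp) hε
  have hmp := measurePreserving_eval_infinitePi
    (fun _ : ℕ => multivariateGaussian (0 : Rd d) (h ^ 2 • A)) 0
  rw [← hmp.measure_preimage measurableSet_ball.compl.nullMeasurableSet]
  refine (measure_mono ?_).trans (hw.trans (le_of_eq (by norm_num)))
  intro ξ hξ
  simp only [mem_ofPred_eq]
  exact ⟨1, by norm_num, by simpa [walk] using hξ⟩

lemma noise_of_notMem {d : ℕ} {ν : ℝ} {h : ℕ → ℝ} {τ : ℕ → ℕ}
    {Sig : ℕ → Matrix (Fin d) (Fin d) ℝ} {s : ℕ} (hs : s ∉ range τ) :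
    noise ν h τ Sig s = multivariateGaussian 0 (h s ^ 2 • Sig s) := by
  unfold noise
  rcases eq_or_ne (h s) 0 with h0 | h0
  -- the Gaussian distribution with zero covariance is the Dirac mass
  · rw [if_pos h0, h0]
    simp [multivariateGaussian]
  · rw [if_neg h0, if_neg hs]

lemma noise_of_mem {d : ℕ} {ν : ℝ} {h : ℕ → ℝ} {τ : ℕ → ℕ}
    {Sig : ℕ → Matrix (Fin d) (Fin d) ℝ} {s : ℕ} (h0 : 0 < h s) (hs : s ∈ range τ) :
    noise ν h τ Sig s = student ν 0 (h s ^ 2 • Sig s) := by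
  unfold noise
  rw [if_neg h0.ne', if_pos hs]

lemma noise_of_eq_zero {d : ℕ} {ν : ℝ} {h : ℕ → ℝ} {τ : ℕ → ℕ}
    {Sig : ℕ → Matrix (Fin d) (Fin d) ℝ} {s : ℕ} (h0 : h s = 0) :
    noise ν h τ Sig s = Measure.dirac 0 := by
  unfold noise
  rw [if_pos h0]

section

variable {d : ℕ} {ν : ℝ} (hν : 0 < ν) {h : ℕ → ℝ} (hh : ∀ t, 0 ≤ h t) (τ : ℕ → ℕ)
  {Sig : ℕ → Matrix (Fin d) (Fin d) ℝ} (hSig : ∀ t, (Sig t).PosDef) {C : ℝ} (hC : 0 < C)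
  (hSigb : ∀ t, ‖Matrix.toEuclideanCLM (𝕜 := ℝ) (Sig t)‖ ≤ C ∧
      ‖Matrix.toEuclideanCLM (𝕜 := ℝ) (Sig t)⁻¹‖ ≤ C)
include hν hSig hC hSigb

lemma student_noise_compl_ball_le {ε : ℝ} (hε : 0 < ε) :
    ∃ c > (0 : ℝ), ∀ s ∈ range τ, 0 < h s →
      noise ν h τ Sig s (ball 0 ε)ᶜ ≤ ENNReal.ofReal (c * h s ^ ν) := by
  obtain ⟨c, hc, H⟩ := student_compl_ball_le (d := d) hν hC hε
  refine ⟨c, hc, fun s hs h0 => ?_⟩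
  rw [noise_of_mem h0 hs]
  exact H _ (hSig s) (hSigb s).1 (hSigb s).2 _ h0

lemma le_student_noise_ball_far {β M r : ℝ} (hβ : 0 ≤ β) (hr : 0 < r) :
    ∃ c > (0 : ℝ), ∀ s ∈ range τ, 0 < h s → h s ≤ 1 →
      ∀ x : Rd d, ball x r ⊆ closedBall 0 (M * h s ^ (-β)) →
        ENNReal.ofReal (c * h s ^ (ν + β * (ν + d))) ≤ noise ν h τ Sig s (ball x r) := by
  obtain ⟨c, hc, H⟩ := le_student_ball_far (d := d) (M := M) hν hC hβ hr
  refine ⟨c, hc, fun s hs h0 h1 x hx => ?_⟩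
  rw [noise_of_mem h0 hs]
  exact H _ (hSig s) (hSigb s).1 (hSigb s).2 _ h0 h1 x hx

lemma le_noise_ball_near {r : ℝ} (hr : 0 < r) :
    ∃ c > (0 : ℝ), ∀ s, 0 < h s → ∀ x : Rd d, ‖x‖ ≤ h s →
      ENNReal.ofReal c ≤ noise ν h τ Sig s (ball x (r * h s)) := by
  obtain ⟨c, hc, H⟩ := le_student_ball_near (d := d) hν hC hr
  obtain ⟨c', hc', H'⟩ := le_gaussian_ball_near d hC hr
  refine ⟨min c c', lt_min hc hc', fun s h0 x hx => ?_⟩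
  by_cases hs : s ∈ range τ
  · rw [noise_of_mem h0 hs]
    exact (ENNReal.ofReal_le_ofReal (min_le_left _ _)).trans
      (H _ (hSig s) (hSigb s).1 (hSigb s).2 _ h0 x hx)
  · rw [noise_of_notMem hs]
    exact (ENNReal.ofReal_le_ofReal (min_le_right _ _)).trans
      (H' _ (hSig s) (hSigb s).1 (hSigb s).2 _ h0 x hx)

include hh

lemma noise_univ_le : ∃ c : ℝ, 1 ≤ c ∧ ∀ s, noise ν h τ Sig s univ ≤ ENNReal.ofReal c := by
  obtain ⟨c, hc, H⟩ := student_univ_le (d := d) hν hC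
  refine ⟨c.toReal + 1, by simp, fun s => ?_⟩
  have h1 : (1 : ℝ≥0∞) ≤ ENNReal.ofReal (c.toReal + 1) := by
    rw [ENNReal.one_le_ofReal]; simp
  by_cases hs : s ∈ range τ
  · rcases (hh s).eq_or_lt with h0 | h0
    · rw [noise_of_eq_zero h0.symm]; simp
    · rw [noise_of_mem h0 hs]
      refine (H _ (hSig s) (hSigb s).1 (hSigb s).2 _ h0).trans ?_
      conv_lhs => rw [← ENNReal.ofReal_toReal hc]
      exact ENNReal.ofReal_le_ofReal (by simp)
  · rw [noise_of_notMem hs]; simp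

lemma tendsto_noise_compl_ball (hh0 : Tendsto h atTop (𝓝 0)) {ε : ℝ} (hε : 0 < ε) :
    Tendsto (fun s => noise ν h τ Sig s (ball 0 ε)ᶜ) atTop (𝓝 0) := by
  obtain ⟨c, hc, H⟩ := student_noise_compl_ball_le (h := h) hν τ hSig hC hSigb hε
  set a : ℝ := (ε / (d + 1)) ^ 2 / (2 * C) with ha
  have ha0 : 0 < a := by positivity
  -- the exponential of `-a / h ^ 2` is at most `h ^ 2 / a`
  have hbound : ∀ s, noise ν h τ Sig s (ball 0 ε)ᶜ ≤
      ENNReal.ofReal (c * h s ^ ν + 4 * d * (h s ^ 2 / a)) := by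
    intro s
    have hpos : 0 ≤ h s ^ ν := Real.rpow_nonneg (hh s) _
    rcases (hh s).eq_or_lt with h0 | h0
    · rw [noise_of_eq_zero h0.symm, Measure.dirac_apply' _ measurableSet_ball.compl]
      simp [hε]
    by_cases hs : s ∈ range τ
    · refine (H s hs h0).trans (ENNReal.ofReal_le_ofReal ?_)
      have : 0 ≤ 4 * d * (h s ^ 2 / a) := by positivity
      linarith
    · rw [noise_of_notMem hs]
      refine (gaussian_compl_ball_le hC (hSig s) (hSigb s).1 h0 hε).trans
        (ENNReal.ofReal_le_ofReal ?_)
      have he : Real.exp (-(ε / (d + 1)) ^ 2 / (2 * (C * h s ^ 2))) ≤ h s ^ 2 / a := by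
        have e1 : -(ε / (d + 1)) ^ 2 / (2 * (C * h s ^ 2)) = -(a / h s ^ 2) := by
          rw [ha]; field_simp
        rw [e1, Real.exp_neg]
        have e2 : a / h s ^ 2 ≤ Real.exp (a / h s ^ 2) := by
          linarith [Real.add_one_le_exp (a / h s ^ 2)]
        calc (Real.exp (a / h s ^ 2))⁻¹ ≤ (a / h s ^ 2)⁻¹ := by gcongr
          _ = h s ^ 2 / a := by rw [inv_div]
      have : 0 ≤ c * h s ^ ν := by positivity
      calc (2 : ℝ) * (d * (2 * Real.exp (-(ε / (d + 1)) ^ 2 / (2 * (C * h s ^ 2)))))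
          ≤ 2 * (d * (2 * (h s ^ 2 / a))) := by gcongr
        _ ≤ _ := by linarith
  refine tendsto_of_tendsto_of_tendsto_of_le_of_le tendsto_const_nhds ?_ (fun _ => zero_le)
    hbound
  rw [← ENNReal.ofReal_zero]
  refine ENNReal.tendsto_ofReal ?_
  have h1 : Tendsto (fun s => h s ^ ν) atTop (𝓝 0) := by
    have := hh0.rpow_const (p := ν) (Or.inr hν.le)
    rwa [Real.zero_rpow hν.ne'] at this
  have h2 : Tendsto (fun s => h s ^ 2) atTop (𝓝 0) := by simpa using hh0.pow 2
  have := (h1.const_mul c).add ((h2.div_const a).const_mul (4 * (d : ℝ)))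
  simpa using this

end

/-! ### Expectations of extended-real functions -/

/-- A function whose expectation is below `b` has an integrable real majorant with the same
property, obtained by truncation from below. -/
lemma exists_integrable_ge {S : Type*} [MeasurableSpace S] {ρ : Measure S}
    [IsProbabilityMeasure ρ] {g : S → EReal} (hg : AEMeasurable g ρ) {b : ℝ}
    (h : expect ρ g < b) :
    ∃ G : S → ℝ, Measurable G ∧ Integrable G ρ ∧ (∀ᵐ y ∂ρ, g y ≤ G y) ∧ ∫ y, G y ∂ρ < b := by
  set g' := hg.mk g with hg'
  have hgm : Measurable g' := hg.measurable_mk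
  have hgg : g =ᵐ[ρ] g' := hg.ae_eq_mk
  have hpm : Measurable fun y => (g' y).toENNReal := hgm.ereal_toENNReal
  have hnm : Measurable fun y => (-g' y).toENNReal := hgm.neg.ereal_toENNReal
  have hp' : ∫⁻ y, (g y).toENNReal ∂ρ = ∫⁻ y, (g' y).toENNReal ∂ρ :=
    lintegral_congr_ae (hgg.mono fun y hy => by simp only [hy])
  have hn' : ∫⁻ y, (-g y).toENNReal ∂ρ = ∫⁻ y, (-g' y).toENNReal ∂ρ :=
    lintegral_congr_ae (hgg.mono fun y hy => by simp only [hy])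
  unfold expect at h
  rw [hp', hn'] at h
  set p := ∫⁻ y, (g' y).toENNReal ∂ρ with hp
  set n := ∫⁻ y, (-g' y).toENNReal ∂ρ with hn
  split_ifs at h with hpt
  · simp at h
  -- the truncations of the negative part
  have hmono : n = ⨆ M : ℕ, ∫⁻ y, min (-g' y).toENNReal (M : ℝ≥0∞) ∂ρ := by
    rw [← lintegral_iSup (fun M => hnm.min measurable_const)]
    · refine lintegral_congr fun y => ?_
      apply le_antisymm
      · rcases eq_or_ne (-g' y).toENNReal ⊤ with ht | ht
        · simp only [ht, top_le_iff, min_eq_right le_top]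
          exact ENNReal.iSup_natCast
        · obtain ⟨M, hM⟩ := ENNReal.exists_nat_gt ht
          exact le_iSup_of_le M (by rw [min_eq_left hM.le])
      · exact iSup_le fun M => min_le_left _ _
    · intro M N hMN y
      exact min_le_min le_rfl (by exact_mod_cast hMN)
  obtain ⟨M, hM⟩ : ∃ M : ℕ,
      p.toReal - (∫⁻ y, min (-g' y).toENNReal (M : ℝ≥0∞) ∂ρ).toReal < b := by
    have hMt : ∀ M : ℕ, ∫⁻ y, min (-g' y).toENNReal (M : ℝ≥0∞) ∂ρ ≠ ⊤ := fun M => by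
      refine ne_top_of_le_ne_top (ENNReal.natCast_ne_top M) ?_
      calc _ ≤ ∫⁻ _, (M : ℝ≥0∞) ∂ρ := lintegral_mono fun y => min_le_right _ _
        _ = M := by simp
    by_cases hb : p.toReal < b
    · exact ⟨0, by simpa using hb⟩
    push Not at hb
    have h1 : ENNReal.ofReal (p.toReal - b) < n := by
      rcases eq_or_ne n ⊤ with hnt | hnt
      · rw [hnt]; exact ENNReal.ofReal_lt_top
      · rw [ENNReal.ofReal_lt_iff_lt_toReal (by linarith) hnt]
        rw [← ENNReal.ofReal_toReal hpt, ← ENNReal.ofReal_toReal hnt,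
          EReal.coe_ennreal_ofReal, EReal.coe_ennreal_ofReal,
          max_eq_left ENNReal.toReal_nonneg, max_eq_left ENNReal.toReal_nonneg,
          ← EReal.coe_sub, EReal.coe_lt_coe_iff] at h
        linarith
    rw [hmono, lt_iSup_iff] at h1
    obtain ⟨M, hM⟩ := h1
    refine ⟨M, ?_⟩
    rw [ENNReal.ofReal_lt_iff_lt_toReal (by linarith) (hMt M)] at hM
    linarith
  have hPint : Integrable (fun y => ((g' y).toENNReal).toReal) ρ :=
    integrable_toReal_of_lintegral_ne_top hpm.aemeasurable hpt
  have hNint : Integrable (fun y => (min (-g' y).toENNReal (M : ℝ≥0∞)).toReal) ρ := by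
    refine integrable_toReal_of_lintegral_ne_top (hnm.min measurable_const).aemeasurable ?_
    refine ne_top_of_le_ne_top (ENNReal.natCast_ne_top M) ?_
    calc _ ≤ ∫⁻ _, (M : ℝ≥0∞) ∂ρ := lintegral_mono fun y => min_le_right _ _
      _ = M := by simp
  have hpae : ∀ᵐ y ∂ρ, (g' y).toENNReal < ⊤ := ae_lt_top hpm hpt
  refine ⟨fun y => ((g' y).toENNReal).toReal - (min (-g' y).toENNReal (M : ℝ≥0∞)).toReal,
    by fun_prop, hPint.sub hNint, ?_, ?_⟩
  · filter_upwards [hgg, hpae] with y hy hpy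
    rw [hy]
    rcases le_total 0 (g' y) with h0 | h0
    · have h1 : (-g' y).toENNReal = 0 := EReal.toENNReal_of_nonpos (by simpa using h0)
      rw [h1]
      have h2 : g' y = (((g' y).toENNReal : ℝ≥0∞) : EReal) := (EReal.coe_toENNReal h0).symm
      conv_lhs => rw [h2, ← ENNReal.ofReal_toReal hpy.ne]
      rw [EReal.coe_ennreal_ofReal, max_eq_left ENNReal.toReal_nonneg]
      simp
    · have h1 : (g' y).toENNReal = 0 := EReal.toENNReal_of_nonpos h0
      rw [h1]
      have h2 : -g' y = (((-g' y).toENNReal : ℝ≥0∞) : EReal) :=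
        (EReal.coe_toENNReal (by simpa using h0)).symm
      have h3 : ((min (-g' y).toENNReal (M : ℝ≥0∞) : ℝ≥0∞) : EReal) ≤ -g' y := by
        conv_rhs => rw [h2]
        exact_mod_cast min_le_left _ _
      have h4 : min (-g' y).toENNReal (M : ℝ≥0∞) ≠ ⊤ :=
        ne_top_of_le_ne_top (ENNReal.natCast_ne_top M) (min_le_right _ _)
      rw [← ENNReal.ofReal_toReal h4, EReal.coe_ennreal_ofReal,
        max_eq_left ENNReal.toReal_nonneg] at h3
      simp only [ENNReal.toReal_zero, zero_sub, EReal.coe_neg]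
      exact EReal.le_neg_of_le_neg h3
  · rw [integral_sub hPint hNint, integral_toReal hpm.aemeasurable hpae,
      integral_toReal (hnm.min measurable_const).aemeasurable
        (ae_of_all _ fun y => lt_of_le_of_lt (min_le_right _ _) (ENNReal.natCast_lt_top M))]
    exact hM

/-! ### Dominated parameter sets -/

section Model

variable {d : ℕ} {S : Type*} [MeasurableSpace S]

/-- The likelihood ratio `f_θ / f_θ⋆`, with `f_θ` extended by `0` outside `Θ`. -/
noncomputable def relLik (Θ : Set (Rd d)) (f : Rd d → S → ℝ≥0) (θs θ : Rd d) (y : S) : ℝ≥0∞ :=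
  extend Θ f θ y / (f θs y : ℝ≥0∞)

/-- `G` dominates the log-likelihood ratio on `U` in exponential mean:
`𝔼[(f_θ / f_θ⋆) e^{-G}] ≤ 1` for every `θ ∈ U`. The likelihood ratio along any deterministic path
in `U` is then at most of the order of the exponential of the sum of the values of `G`. -/
structure Dominated (ρ : Measure S) (Θ : Set (Rd d)) (f : Rd d → S → ℝ≥0) (θs : Rd d)
    (U : Set (Rd d)) (G : S → ℝ) : Prop where
  measurable : Measurable G
  integrable : Integrable G ρ
  lintegral_le : ∀ θ ∈ U, ∫⁻ y, relLik Θ f θs θ y * ENNReal.ofReal (Real.exp (-G y)) ∂ρ ≤ 1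

variable {ρ : Measure S} [IsProbabilityMeasure ρ] {Θ : Set (Rd d)} {f : Rd d → S → ℝ≥0}
  {θs : Rd d}

omit [IsProbabilityMeasure ρ] [MeasurableSpace S] in
lemma extend_of_mem {θ : Rd d} (h : θ ∈ Θ) (y : S) : extend Θ f θ y = f θ y := by
  simp [extend, h]

omit [IsProbabilityMeasure ρ] [MeasurableSpace S] in
lemma extend_of_notMem {θ : Rd d} (h : θ ∉ Θ) (y : S) : extend Θ f θ y = 0 := by
  simp [extend, h]

lemma measurable_extend (hΘ : MeasurableSet Θ) (hf : Measurable fun q : Θ × S => f q.1 q.2) :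
    Measurable fun q : Rd d × S => extend Θ f q.1 q.2 := by
  have hs : MeasurableSet {q : Rd d × S | q.1 ∈ Θ} := measurable_fst hΘ
  refine measurable_of_restrict_of_restrict_compl hs ?_ ?_
  · have h1 : Measurable fun q : {q : Rd d × S | q.1 ∈ Θ} =>
        ((⟨q.1.1, q.2⟩, q.1.2) : Θ × S) :=
      (Measurable.subtype_mk (measurable_fst.comp measurable_subtype_coe)).prodMk
        (measurable_snd.comp measurable_subtype_coe)
    have h2 := (hf.comp h1).coe_nnreal_ennreal
    convert h2 using 1
    ext q
    exact extend_of_mem q.2 _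
  · convert measurable_const (a := (0 : ℝ≥0∞)) using 1
    ext q
    exact extend_of_notMem q.2 _

lemma measurable_of_mem (hf : Measurable fun q : Θ × S => f q.1 q.2) {θ : Rd d} (h : θ ∈ Θ) :
    Measurable (f θ) :=
  hf.comp (measurable_prodMk_left (x := (⟨θ, h⟩ : Θ)))

lemma measurable_relLik (hΘ : MeasurableSet Θ) (hf : Measurable fun q : Θ × S => f q.1 q.2)
    (hs : θs ∈ Θ) : Measurable fun q : Rd d × S => relLik Θ f θs q.1 q.2 :=
  (measurable_extend hΘ hf).div ((measurable_of_mem hf hs).coe_nnreal_ennreal.comp measurable_snd)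

omit [IsProbabilityMeasure ρ] in
/-- Positivity and log-integrability of the likelihood at the target value. -/
lemma target_pos_integrable (hf : Measurable fun q : Θ × S => f q.1 q.2)
    (h : IsTarget ρ Θ f θs) :
    (∀ᵐ y ∂ρ, f θs y ≠ 0) ∧ Integrable (fun y => Real.log (f θs y)) ρ ∧
      expect ρ (logLik f θs) = ((∫ y, Real.log (f θs y) ∂ρ : ℝ) : EReal) := by
  have hm : Measurable (f θs) := measurable_of_mem hf h.mem
  have hlm : Measurable (logLik f θs) :=
    ENNReal.measurable_log.comp hm.coe_nnreal_ennreal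
  have hb := h.ne_bot
  have ht := h.ne_top
  unfold expect at hb ht ⊢
  set p := ∫⁻ y, (logLik f θs y).toENNReal ∂ρ with hp
  set n := ∫⁻ y, (-logLik f θs y).toENNReal ∂ρ with hn
  by_cases hpt : p = ⊤
  · simp [hpt] at ht
  rw [if_neg hpt] at hb ht ⊢
  have hnt : n ≠ ⊤ := by
    intro hnt
    apply hb
    rw [hnt, EReal.coe_ennreal_top, EReal.sub_top]
  have hnae : ∀ᵐ y ∂ρ, (-logLik f θs y).toENNReal < ⊤ := ae_lt_top hlm.neg.ereal_toENNReal hnt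
  have hpos : ∀ᵐ y ∂ρ, f θs y ≠ 0 := by
    filter_upwards [hnae] with y hy h0
    simp [logLik, h0] at hy
  have hlog : ∀ y, f θs y ≠ 0 → logLik f θs y = ((Real.log (f θs y) : ℝ) : EReal) := by
    intro y hy
    rw [logLik, ENNReal.log_pos_real (by simpa using hy) ENNReal.coe_ne_top]
    simp
  have hp2 : p = ∫⁻ y, ENNReal.ofReal (Real.log (f θs y)) ∂ρ :=
    lintegral_congr_ae (hpos.mono fun y hy => by
      simp only [hlog y hy]; exact EReal.toENNReal_of_ne_top (EReal.coe_ne_top _))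
  have hn2 : n = ∫⁻ y, ENNReal.ofReal (-Real.log (f θs y)) ∂ρ :=
    lintegral_congr_ae (hpos.mono fun y hy => by
      simp only [hlog y hy, ← EReal.coe_neg]
      exact EReal.toENNReal_of_ne_top (EReal.coe_ne_top _))
  have hmeas : Measurable fun y => Real.log (f θs y) :=
    Real.measurable_log.comp hm.coe_nnreal_real
  have hint : Integrable (fun y => Real.log (f θs y)) ρ := by
    refine ⟨hmeas.aestronglyMeasurable, ?_⟩
    rw [hasFiniteIntegral_iff_enorm]
    have : ∀ y, ‖Real.log (f θs y)‖ₑ ≤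
        ENNReal.ofReal (Real.log (f θs y)) + ENNReal.ofReal (-Real.log (f θs y)) := by
      intro y
      rw [← ofReal_norm, Real.norm_eq_abs]
      rcases le_total 0 (Real.log (f θs y)) with h0 | h0
      · rw [abs_of_nonneg h0]; exact le_self_add
      · rw [abs_of_nonpos h0]; exact le_add_self
    calc _ ≤ _ := lintegral_mono this
      _ = p + n := by rw [lintegral_add_left hmeas.ennreal_ofReal, hp2, hn2]
      _ < ⊤ := ENNReal.add_lt_top.2 ⟨lt_top_iff_ne_top.2 hpt, lt_top_iff_ne_top.2 hnt⟩
  refine ⟨hpos, hint, ?_⟩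
  rw [integral_eq_lintegral_pos_part_sub_lintegral_neg_part hint, ← hp2, ← hn2, EReal.coe_sub]
  conv_lhs => rw [← ENNReal.ofReal_toReal hpt, ← ENNReal.ofReal_toReal hnt]
  rw [EReal.coe_ennreal_ofReal, EReal.coe_ennreal_ofReal,
    max_eq_left ENNReal.toReal_nonneg, max_eq_left ENNReal.toReal_nonneg]

/-- Points outside of `Θ` are dominated by any function, their likelihood being zero. -/
lemma Dominated.union_compl {U : Set (Rd d)} {G : S → ℝ} (h : Dominated ρ Θ f θs U G) :
    Dominated ρ Θ f θs (U ∪ Θᶜ) G := by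
  refine ⟨h.measurable, h.integrable, fun θ hθ => ?_⟩
  rcases hθ with hθ | hθ
  · exact h.lintegral_le θ hθ
  · simp [relLik, extend_of_notMem hθ]

lemma dominated_of_log_le (hf : Measurable fun q : Θ × S => f q.1 q.2)
    (ht : IsTarget ρ Θ f θs) {U : Set (Rd d)} {G : S → ℝ} (hG : Measurable G)
    (hGi : Integrable G ρ)
    (hU : ∀ θ ∈ U, ∀ᵐ y ∂ρ, ENNReal.log (extend Θ f θ y) ≤ G y) :
    Dominated ρ Θ f θs U (fun y => G y - Real.log (f θs y)) := by
  obtain ⟨hpos, hint, -⟩ := target_pos_integrable hf ht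
  have hm : Measurable (f θs) := measurable_of_mem hf ht.mem
  refine ⟨hG.sub (Real.measurable_log.comp hm.coe_nnreal_real), hGi.sub hint, fun θ hθ => ?_⟩
  calc _ ≤ ∫⁻ _, 1 ∂ρ := by
        refine lintegral_mono_ae ?_
        filter_upwards [hpos, hU θ hθ] with y hy hlog
        have h1 : extend Θ f θ y ≤ ENNReal.ofReal (Real.exp (G y)) := by
          have := EReal.exp_monotone hlog
          rwa [ENNReal.exp_log, EReal.exp_coe] at this
        have hy' : (0 : ℝ) < f θs y := by positivity
        have h2 : (f θs y : ℝ≥0∞) = ENNReal.ofReal (f θs y) := by simp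
        rw [relLik, neg_sub, Real.exp_sub, Real.exp_log hy', h2]
        calc extend Θ f θ y / ENNReal.ofReal (f θs y) *
              ENNReal.ofReal (f θs y / Real.exp (G y))
            ≤ ENNReal.ofReal (Real.exp (G y)) / ENNReal.ofReal (f θs y) *
              ENNReal.ofReal (f θs y / Real.exp (G y)) := by gcongr
          _ = 1 := by
              rw [← ENNReal.ofReal_div_of_pos hy', ← ENNReal.ofReal_mul (by positivity)]
              rw [div_mul_div_comm, mul_comm, div_self (by positivity), ENNReal.ofReal_one]
    _ = 1 := by simp

omit [IsProbabilityMeasure ρ] in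
lemma dominated_of_lintegral_relLik_le [IsFiniteMeasure ρ] {U : Set (Rd d)} {c : ℝ}
    (hU : ∀ θ ∈ U, ∫⁻ y, relLik Θ f θs θ y ∂ρ ≤ ENNReal.ofReal (Real.exp c)) :
    Dominated ρ Θ f θs U (fun _ => c) := by
  refine ⟨measurable_const, integrable_const c, fun θ hθ => ?_⟩
  rw [lintegral_mul_const' _ _ ENNReal.ofReal_ne_top]
  calc _ ≤ ENNReal.ofReal (Real.exp c) * ENNReal.ofReal (Real.exp (-c)) := by
        gcongr; exact hU θ hθ
    _ = 1 := by
        rw [← ENNReal.ofReal_mul (by positivity), ← Real.exp_add]; simp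

lemma dominated_of_lintegral_le (hf : Measurable fun q : Θ × S => f q.1 q.2)
    (ht : IsTarget ρ Θ f θs) {U : Set (Rd d)} {c : ℝ}
    (hU : ∀ θ ∈ U, ∫⁻ y, extend Θ f θ y ∂ρ ≤ ENNReal.ofReal (Real.exp c)) :
    Dominated ρ Θ f θs U (fun y => c - Real.log (f θs y)) := by
  obtain ⟨hpos, hint, -⟩ := target_pos_integrable hf ht
  have hm : Measurable (f θs) := measurable_of_mem hf ht.mem
  refine ⟨measurable_const.sub (Real.measurable_log.comp hm.coe_nnreal_real),
    (integrable_const c).sub hint, fun θ hθ => ?_⟩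
  calc _ = ∫⁻ y, extend Θ f θ y * ENNReal.ofReal (Real.exp (-c)) ∂ρ := by
        refine lintegral_congr_ae ?_
        filter_upwards [hpos] with y hy
        have hy' : (0 : ℝ) < f θs y := by positivity
        have h2 : (f θs y : ℝ≥0∞) = ENNReal.ofReal (f θs y) := by simp
        have h3 : ENNReal.ofReal (f θs y) ≠ 0 := by simpa using hy
        rw [relLik, neg_sub, sub_eq_add_neg, Real.exp_add, Real.exp_log hy',
          ENNReal.ofReal_mul hy'.le, ← mul_assoc, h2,
          ENNReal.div_mul_cancel h3 ENNReal.ofReal_ne_top]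
    _ ≤ ENNReal.ofReal (Real.exp c) * ENNReal.ofReal (Real.exp (-c)) := by
        rw [lintegral_mul_const' _ _ ENNReal.ofReal_ne_top]
        gcongr; exact hU θ hθ
    _ = 1 := by
        rw [← ENNReal.ofReal_mul (by positivity), ← Real.exp_add]; simp

/-- Each of the three forms of global control dominates the whole parameter space. -/
lemma exists_dominated_univ (hf : Measurable fun q : Θ × S => f q.1 q.2)
    (ht : IsTarget ρ Θ f θs) (h5 : UpperControl ρ Θ f θs) :
    ∃ G, Dominated ρ Θ f θs univ G := by
  rcases h5 with ⟨hm, hlt⟩ | hlt | hlt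
  · obtain ⟨b, hb, -⟩ := EReal.lt_iff_exists_real_btwn.1 hlt
    obtain ⟨G, hG, hGi, hGle, -⟩ := exists_integrable_ge hm hb
    refine ⟨_, dominated_of_log_le hf ht hG hGi fun θ _ => ?_⟩
    filter_upwards [hGle] with y hy
    by_cases hθ : θ ∈ Θ
    · rw [extend_of_mem hθ]
      exact (le_iSup₂_of_le (f := fun θ (_ : θ ∈ Θ) => logLik f θ y) θ hθ le_rfl).trans hy
    · simp [extend_of_notMem hθ]
  -- `B + 1` instead of `B`, so that the logarithm is that of a positive number
  · set B := ⨆ θ ∈ Θ, ∫⁻ y, ratio f θ θs y ∂ρ with hB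
    refine ⟨_, dominated_of_lintegral_relLik_le (c := Real.log (B.toReal + 1)) fun θ _ => ?_⟩
    rw [Real.exp_log (by positivity)]
    by_cases hθ : θ ∈ Θ
    · have h1 : ∫⁻ y, relLik Θ f θs θ y ∂ρ ≤ B := by
        simp only [relLik, extend_of_mem hθ]
        exact le_iSup₂_of_le (f := fun θ (_ : θ ∈ Θ) => ∫⁻ y, ratio f θ θs y ∂ρ) θ hθ le_rfl
      refine h1.trans ?_
      conv_lhs => rw [← ENNReal.ofReal_toReal hlt.ne]
      exact ENNReal.ofReal_le_ofReal (by simp)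
    · simp [relLik, extend_of_notMem hθ]
  · set B := ⨆ θ ∈ Θ, ∫⁻ y, (f θ y : ℝ≥0∞) ∂ρ with hB
    refine ⟨_, dominated_of_lintegral_le hf ht (c := Real.log (B.toReal + 1)) fun θ _ => ?_⟩
    rw [Real.exp_log (by positivity)]
    by_cases hθ : θ ∈ Θ
    · have h1 : ∫⁻ y, extend Θ f θ y ∂ρ ≤ B := by
        simp only [extend_of_mem hθ]
        exact le_iSup₂_of_le (f := fun θ (_ : θ ∈ Θ) => ∫⁻ y, (f θ y : ℝ≥0∞) ∂ρ) θ hθ le_rfl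
      refine h1.trans ?_
      conv_lhs => rw [← ENNReal.ofReal_toReal hlt.ne]
      exact ENNReal.ofReal_le_ofReal (by simp)
    · simp [extend_of_notMem hθ]

/-- Outside the localising set, each of the three forms of control gives a dominating function of
negative mean. -/
lemma exists_dominated_compl (hf : Measurable fun q : Θ × S => f q.1 q.2)
    (ht : IsTarget ρ Θ f θs) {A : Set (Rd d)} (h4 : SmallOutside ρ Θ f θs A) :
    ∃ G, Dominated ρ Θ f θs Aᶜ G ∧ ∫ y, G y ∂ρ < 0 := by
  obtain ⟨hpos, hint, hexp⟩ := target_pos_integrable hf ht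
  rcases h4 with ⟨hm, hlt⟩ | hlt | hlt
  · rw [hexp] at hlt
    obtain ⟨G, hG, hGi, hGle, hGb⟩ := exists_integrable_ge hm hlt
    refine ⟨_, dominated_of_log_le hf ht hG hGi fun θ hθ => ?_, ?_⟩
    · filter_upwards [hGle] with y hy
      exact (le_iSup₂_of_le (f := fun θ (_ : θ ∈ Aᶜ) => ENNReal.log (extend Θ f θ y)) θ hθ
        le_rfl).trans hy
    · rw [integral_sub hGi hint]; linarith
  · set B := ⨆ θ ∈ Aᶜ, ∫⁻ y, extend Θ f θ y / (f θs y : ℝ≥0∞) ∂ρ with hB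
    have hBt : B ≠ ⊤ := (hlt.trans ENNReal.one_lt_top).ne
    have hB1 : B.toReal < 1 := by
      have := (ENNReal.toReal_lt_toReal hBt ENNReal.one_ne_top).2 hlt
      simpa using this
    have hq0 : 0 < (B.toReal + 1) / 2 := by positivity
    refine ⟨_, dominated_of_lintegral_relLik_le (c := Real.log ((B.toReal + 1) / 2))
      fun θ hθ => ?_, ?_⟩
    · rw [Real.exp_log hq0]
      have h1 : ∫⁻ y, relLik Θ f θs θ y ∂ρ ≤ B :=
        le_iSup₂_of_le (f := fun θ (_ : θ ∈ Aᶜ) =>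
          ∫⁻ y, extend Θ f θ y / (f θs y : ℝ≥0∞) ∂ρ) θ hθ le_rfl
      refine h1.trans ?_
      conv_lhs => rw [← ENNReal.ofReal_toReal hBt]
      exact ENNReal.ofReal_le_ofReal (by linarith)
    · simp only [integral_const, probReal_univ, one_smul]
      exact Real.log_neg hq0 (by linarith)
  · rw [hexp] at hlt
    obtain ⟨c, hc1, hc2⟩ := EReal.lt_iff_exists_real_btwn.1 hlt
    rw [EReal.coe_lt_coe_iff] at hc2
    refine ⟨_, dominated_of_lintegral_le hf ht (c := c) fun θ hθ => ?_, ?_⟩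
    · have h1 := le_iSup₂_of_le (f := fun θ (_ : θ ∈ Aᶜ) =>
          ∫⁻ y, extend Θ f θ y ∂ρ) θ hθ le_rfl
      have h2 := EReal.exp_monotone hc1.le
      rw [ENNReal.exp_log, EReal.exp_coe] at h2
      exact h1.trans h2
    · rw [integral_sub (integrable_const c) hint]
      simp only [integral_const, probReal_univ, one_smul]
      linarith

end Model

/-! ### Covering the far region by dominated sets -/

section Cover

variable {d : ℕ} {S : Type*} [MeasurableSpace S] {ρ : Measure S} {Θ : Set (Rd d)}
  {f : Rd d → S → ℝ≥0} {θs : Rd d}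

omit [MeasurableSpace S] in
/-- The finiteness of the supremum of the log-ratios forces the likelihood to be positive on `K`: if
`f_θ` vanishes then so does `f_θ / f_θ = 0 / 0`, whose logarithm is infinite. -/
lemma of_supSqLogRatio_lt_top {K : Set (Rd d)} (hK : K ⊆ Θ) {δ : ℝ} (hδ : 0 < δ) {y : S}
    (hy : supSqLogRatio Θ f K δ y < ⊤) :
    (∀ θ ∈ K, f θ y ≠ 0) ∧ ∀ z ∈ K, ∀ θ ∈ K, θ ∈ ball z δ →
      ENNReal.ofReal (Real.log (f θ y / f z y)) ≤ 1 + supSqLogRatio Θ f K δ y := by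
  have hle : ∀ z ∈ K, ∀ θ ∈ K, θ ∈ ball z δ →
      (EReal.abs (ENNReal.log (ratio f θ z y))) ^ 2 ≤ supSqLogRatio Θ f K δ y := by
    intro z hz θ hθ hzθ
    unfold supSqLogRatio
    have h1 : θ - z ∈ ball (0 : Rd d) δ := by simpa [dist_eq_norm] using hzθ
    have h2 : z + (θ - z) = θ := by abel
    refine le_iSup₂_of_le z hz (le_iSup₂_of_le (θ - z) h1 (le_iSup_of_le ?_ ?_))
    · rw [h2]; exact hK hθ
    · rw [h2]
  have hne : ∀ θ ∈ K, f θ y ≠ 0 := by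
    intro θ hθ h0
    have h1 := hle θ hθ θ hθ (mem_ball_self hδ)
    have h2 : ratio f θ θ y = 0 := by simp [ratio, h0]
    rw [h2, ENNReal.log_zero, EReal.abs_bot] at h1
    simp only [ne_eq, OfNat.ofNat_ne_zero, not_false_eq_true, ENNReal.top_pow, top_le_iff] at h1
    exact hy.ne h1
  refine ⟨hne, fun z hz θ hθ hzθ => ?_⟩
  have hz0 : (0 : ℝ) < f z y := by have := hne z hz; positivity
  have hθ0 : (0 : ℝ) < f θ y := by have := hne θ hθ; positivity
  have hrat : ratio f θ z y = ENNReal.ofReal (f θ y / f z y) := by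
    rw [ratio, ENNReal.ofReal_div_of_pos hz0]; simp
  have hlog : ENNReal.log (ratio f θ z y) = ((Real.log (f θ y / f z y) : ℝ) : EReal) := by
    rw [hrat, ENNReal.log_ofReal_of_pos (by positivity)]
  have h1 := hle z hz θ hθ hzθ
  rw [hlog, EReal.abs_def] at h1
  set a := ENNReal.ofReal |Real.log (f θ y / f z y)| with ha
  have h2 : a ≤ 1 + a ^ 2 := by
    rcases le_total a 1 with h | h
    · exact h.trans le_self_add
    · calc a = a ^ 1 := (pow_one a).symm
        _ ≤ a ^ 2 := pow_le_pow_right₀ h (by norm_num)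
        _ ≤ 1 + a ^ 2 := le_add_self
  calc _ ≤ a := ENNReal.ofReal_le_ofReal (le_abs_self _)
    _ ≤ 1 + a ^ 2 := h2
    _ ≤ _ := by gcongr

/-- Local uniform control of the likelihood: by continuity on `K` and dominated convergence, the
supremum over a small ball of the log-ratio to the centre is small in mean. -/
lemma exists_local_majorant [IsProbabilityMeasure ρ]
    (hf : Measurable fun q : Θ × S => f q.1 q.2) {K : Set (Rd d)} (hK : K ⊆ Θ)
    (hcont : ∀ᵐ y ∂ρ, ContinuousOn (fun θ => f θ y) K) {δ : ℝ} (hδ : 0 < δ)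
    (hsm : AEMeasurable (supSqLogRatio Θ f K δ) ρ)
    (hsup : ∫⁻ y, supSqLogRatio Θ f K δ y ∂ρ < ⊤) {z : Rd d} (hz : z ∈ K) {η : ℝ}
    (hη : 0 < η) :
    ∃ r > (0 : ℝ), ∃ g : S → ℝ, Measurable g ∧ Integrable g ρ ∧ (∀ y, 0 ≤ g y) ∧
      ∫ y, g y ∂ρ < η ∧ ∀ᵐ y ∂ρ, ∀ θ ∈ K ∩ ball z r, (f θ y : ℝ) ≤ f z y * Real.exp (g y) := by
  obtain ⟨D, hDK, hDc, hDd⟩ :=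
    (TopologicalSpace.IsSeparable.of_separableSpace K).exists_countable_dense_subset
  set r : ℕ → ℝ := fun n => δ / (n + 1) with hr
  have hr0 : ∀ n, 0 < r n := fun n => by positivity
  have hrδ : ∀ n, r n ≤ δ := fun n => div_le_self hδ.le (by simp)
  have hrt : Tendsto r atTop (𝓝 0) := by
    have := (tendsto_one_div_add_atTop_nhds_zero_nat (𝕜 := ℝ)).const_mul δ
    simpa [hr, div_eq_mul_inv] using this
  -- a supremum over a countable dense subset of the ball, for measurability
  set W : ℕ → S → ℝ≥0∞ := fun n y =>
    ⨆ θ ∈ D ∩ ball z (r n), ENNReal.ofReal (Real.log (f θ y / f z y)) with hW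
  have hWm : ∀ n, Measurable (W n) := fun n => by
    refine Measurable.biSup _ (hDc.mono inter_subset_left) fun θ hθ => ?_
    exact (Real.measurable_log.comp ((measurable_of_mem hf (hK (hDK hθ.1))).coe_nnreal_real.div
      (measurable_of_mem hf (hK hz)).coe_nnreal_real)).ennreal_ofReal
  have hfin : ∀ᵐ y ∂ρ, supSqLogRatio Θ f K δ y < ⊤ := ae_lt_top' hsm hsup.ne
  have hWb : ∀ n, W n ≤ᵐ[ρ] fun y => 1 + supSqLogRatio Θ f K δ y := fun n => by
    filter_upwards [hfin] with y hy
    refine iSup₂_le fun θ hθ => ?_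
    exact (of_supSqLogRatio_lt_top hK hδ hy).2 z hz θ (hDK hθ.1)
      (ball_subset_ball (hrδ n) hθ.2)
  have hb : ∫⁻ y, (1 + supSqLogRatio Θ f K δ y) ∂ρ ≠ ⊤ := by
    rw [lintegral_add_left measurable_const]
    simpa using hsup.ne
  have hlim : ∀ᵐ y ∂ρ, Tendsto (fun n => W n y) atTop (𝓝 0) := by
    filter_upwards [hfin, hcont] with y hy hc
    have hne := (of_supSqLogRatio_lt_top hK hδ hy).1
    have hz0 : (f z y : ℝ) ≠ 0 := by simpa using hne z hz
    have hcw : ContinuousWithinAt (fun θ => ENNReal.ofReal (Real.log (f θ y / f z y))) K z := by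
      refine ENNReal.continuous_ofReal.continuousAt.comp_continuousWithinAt ?_
      refine ContinuousWithinAt.log ?_ (by simp [hz0])
      exact ((NNReal.continuous_coe.continuousAt.comp_continuousWithinAt (hc z hz))).div_const _
    rw [ENNReal.tendsto_nhds_zero]
    intro ε hε
    have h0 : ENNReal.ofReal (Real.log (f z y / f z y)) < ε := by
      rw [div_self hz0]; simpa using hε
    have hev := hcw.eventually (gt_mem_nhds h0)
    rw [eventually_nhdsWithin_iff, Metric.eventually_nhds_iff] at hev
    obtain ⟨s, hs0, hs⟩ := hev
    filter_upwards [hrt.eventually (gt_mem_nhds hs0)] with n hn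
    refine iSup₂_le fun θ hθ => (hs ?_ (hDK hθ.1)).le
    exact (mem_ball.1 hθ.2).trans hn
  have htend := tendsto_lintegral_of_dominated_convergence _ hWm hWb hb hlim
  rw [lintegral_zero] at htend
  have hη' : (0 : ℝ≥0∞) < ENNReal.ofReal η := by simpa using hη
  obtain ⟨n, hn⟩ := (htend.eventually (gt_mem_nhds hη')).exists
  have hnt : ∫⁻ y, W n y ∂ρ ≠ ⊤ := (hn.trans ENNReal.ofReal_lt_top).ne
  refine ⟨r n, hr0 n, fun y => (W n y).toReal, (hWm n).ennreal_toReal,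
    integrable_toReal_of_lintegral_ne_top (hWm n).aemeasurable hnt,
    fun y => ENNReal.toReal_nonneg, ?_, ?_⟩
  · rw [integral_toReal (hWm n).aemeasurable (ae_lt_top (hWm n) hnt)]
    exact (ENNReal.lt_ofReal_iff_toReal_lt hnt).1 hn
  · filter_upwards [hfin, hcont, ae_lt_top (hWm n) hnt] with y hy hc hWy θ hθ
    have hne := (of_supSqLogRatio_lt_top hK hδ hy).1
    have hcl : θ ∈ closure (D ∩ ball z (r n)) := by
      have := isOpen_ball.inter_closure (t := D) ⟨hθ.2, hDd hθ.1⟩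
      rwa [inter_comm] at this
    have hnb : (𝓝[D ∩ ball z (r n)] θ).NeBot := mem_closure_iff_nhdsWithin_neBot.1 hcl
    have ht : Tendsto (fun θ' => (f θ' y : ℝ)) (𝓝[D ∩ ball z (r n)] θ) (𝓝 (f θ y : ℝ)) :=
      (NNReal.continuous_coe.continuousAt.comp_continuousWithinAt
        ((hc θ hθ.1).mono (inter_subset_left.trans hDK))).tendsto
    refine le_of_tendsto ht ?_
    filter_upwards [self_mem_nhdsWithin] with θ' hθ'
    have hz0 : (0 : ℝ) < f z y := by have := hne z hz; positivity
    have hθ0 : (0 : ℝ) < f θ' y := by have := hne θ' (hDK hθ'.1); positivity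
    have h1 : ENNReal.ofReal (Real.log (f θ' y / f z y)) ≤ W n y :=
      le_iSup₂_of_le (f := fun θ (_ : θ ∈ D ∩ ball z (r n)) =>
        ENNReal.ofReal (Real.log (f θ y / f z y))) θ' hθ' le_rfl
    have h2 := (ENNReal.ofReal_le_iff_le_toReal hWy.ne).1 h1
    have h3 := Real.exp_le_exp.2 h2
    rw [Real.exp_log (by positivity), div_le_iff₀ hz0] at h3
    linarith

/-- A point of the regularity region different from the target has a neighbourhood which is
dominated by a function of negative mean. A point in the interior region is treated through its own
likelihood; a boundary point lies outside the localising set `A`, and there the dominating function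
of `Aᶜ` is used. -/
lemma exists_dominated_nhds [IsProbabilityMeasure ρ] (hΘ : MeasurableSet Θ)
    (hf : Measurable fun q : Θ × S => f q.1 q.2) (ht : IsTarget ρ Θ f θs)
    {A A' O : Set (Rd d)} (hA : MeasurableSet A) (hA' : MeasurableSet A') (hO : IsOpen O)
    (hAO : A ⊆ O) (hOA' : O ⊆ A')
    (hcont : ∀ᵐ y ∂ρ, ContinuousOn (fun θ => f θ y) (A' ∩ Θ)) {δ : ℝ} (hδ : 0 < δ)
    (hsm : AEMeasurable (supSqLogRatio Θ f (A' ∩ Θ) δ) ρ)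
    (hsup : ∫⁻ y, supSqLogRatio Θ f (A' ∩ Θ) δ y ∂ρ < ⊤) {G : S → ℝ}
    (hG : Dominated ρ Θ f θs Aᶜ G) (hG0 : ∫ y, G y ∂ρ < 0) {z : Rd d} (hz : z ∈ A' ∩ Θ)
    (hzs : z ≠ θs) :
    ∃ r > (0 : ℝ), ∃ (U : Set (Rd d)) (G' : S → ℝ), MeasurableSet U ∧
      Dominated ρ Θ f θs U G' ∧ ∫ y, G' y ∂ρ < 0 ∧ ball z r ∩ Θ ⊆ U := by
  obtain ⟨hpos, hint, hexp⟩ := target_pos_integrable hf ht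
  have hKΘ : A' ∩ Θ ⊆ Θ := inter_subset_right
  by_cases hzA : z ∈ A
  -- near a point of `A`, all of `Θ` belongs to the region of regularity
  · have hlt := ht.lt z hz.2 hzs
    rw [hexp] at hlt
    obtain ⟨G₀, hG₀, hG₀i, hG₀le, hG₀b⟩ := exists_integrable_ge
      (ENNReal.measurable_log.comp (measurable_of_mem hf hz.2).coe_nnreal_ennreal).aemeasurable hlt
    obtain ⟨r, hr, g, hg, hgi, hg0, hgη, hgle⟩ := exists_local_majorant hf hKΘ hcont hδ hsm hsup hz
      (sub_pos.2 hG₀b)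
    obtain ⟨s, hs, hsO⟩ := Metric.isOpen_iff.1 hO z (hAO hzA)
    refine ⟨min r s, lt_min hr hs, (A' ∩ Θ) ∩ ball z r, _, (hA'.inter hΘ).inter measurableSet_ball,
      dominated_of_log_le hf ht (hG₀.add hg) (hG₀i.add hgi) fun θ hθ => ?_, ?_, ?_⟩
    · filter_upwards [hG₀le, hgle] with y hy1 hy2
      have h1 := hy2 θ hθ
      have h2 := EReal.exp_monotone hy1
      change EReal.exp (ENNReal.log (f z y : ℝ≥0∞)) ≤ _ at h2
      rw [ENNReal.exp_log, EReal.exp_coe] at h2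
      have h3 : (f z y : ℝ) ≤ Real.exp (G₀ y) := by
        have h4 : ENNReal.ofReal (f z y : ℝ) ≤ ENNReal.ofReal (Real.exp (G₀ y)) := by simpa using h2
        exact (ENNReal.ofReal_le_ofReal_iff (Real.exp_pos _).le).1 h4
      have h4 : (f θ y : ℝ) ≤ Real.exp (G₀ y + g y) := by
        rw [Real.exp_add]
        exact h1.trans (by gcongr)
      have h5 : extend Θ f θ y ≤ ENNReal.ofReal (Real.exp (G₀ y + g y)) := by
        rw [extend_of_mem hθ.1.2]
        have := ENNReal.ofReal_le_ofReal h4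
        simpa using this
      have h6 := ENNReal.log_monotone h5
      rwa [ENNReal.log_ofReal_of_pos (Real.exp_pos _), Real.log_exp] at h6
    · have : ∫ y, ((G₀ + g) y - Real.log (f θs y)) ∂ρ =
          ∫ y, G₀ y ∂ρ + ∫ y, g y ∂ρ - ∫ y, Real.log (f θs y) ∂ρ := by
        rw [integral_sub (hG₀i.add hgi) hint]
        congr 1
        exact integral_add hG₀i hgi
      rw [this]; linarith
    · rintro θ ⟨h1, h2⟩
      exact ⟨⟨hOA' (hsO (ball_subset_ball (min_le_right _ _) h1)), h2⟩,
        ball_subset_ball (min_le_left _ _) h1⟩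
  · obtain ⟨r, hr, g, hg, hgi, hg0, hgη, hgle⟩ := exists_local_majorant hf hKΘ hcont hδ hsm hsup hz
      (neg_pos.2 hG0)
    refine ⟨r, hr, Aᶜ ∪ ((A' ∩ Θ) ∩ ball z r), fun y => G y + g y,
      hA.compl.union ((hA'.inter hΘ).inter measurableSet_ball),
      ⟨hG.measurable.add hg, hG.integrable.add hgi, fun θ hθ => ?_⟩, ?_, ?_⟩
    · rcases hθ with hθ | hθ
      · refine le_trans (lintegral_mono fun y => ?_) (hG.lintegral_le θ hθ)
        gcongr
        linarith [hg0 y]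
      · refine le_trans (lintegral_mono_ae ?_) (hG.lintegral_le z hzA)
        filter_upwards [hgle] with y hy
        have h1 : (f θ y : ℝ≥0∞) ≤ f z y * ENNReal.ofReal (Real.exp (g y)) := by
          have := ENNReal.ofReal_le_ofReal (hy θ hθ)
          rw [ENNReal.ofReal_mul (by positivity)] at this
          simpa using this
        rw [relLik, relLik, extend_of_mem hθ.1.2, extend_of_mem hz.2]
        calc (f θ y : ℝ≥0∞) / f θs y * ENNReal.ofReal (Real.exp (-(G y + g y)))
            ≤ (f z y * ENNReal.ofReal (Real.exp (g y))) / f θs y *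
              ENNReal.ofReal (Real.exp (-(G y + g y))) := by gcongr
          _ = f z y / f θs y * (ENNReal.ofReal (Real.exp (g y)) *
              ENNReal.ofReal (Real.exp (-(G y + g y)))) := by
              simp only [div_eq_mul_inv]; ring
          _ = f z y / f θs y * ENNReal.ofReal (Real.exp (-G y)) := by
              rw [← ENNReal.ofReal_mul (by positivity), ← Real.exp_add]
              congr 3; ring
    · rw [integral_add hG.integrable hgi]; linarith
    · rintro θ ⟨h1, h2⟩
      by_cases hθA : θ ∈ A
      · exact Or.inr ⟨⟨hOA' (hAO hθA), h2⟩, h1⟩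
      · exact Or.inl hθA

/-- Finitely many dominated cells, with dominating functions of negative mean, contain every set of
small diameter that stays away from the target. -/
lemma exists_dominated_cover [IsProbabilityMeasure ρ] (hΘ : MeasurableSet Θ)
    (hf : Measurable fun q : Θ × S => f q.1 q.2) (ht : IsTarget ρ Θ f θs)
    (h4 : Localizable ρ Θ f θs) {ε : ℝ} (hε : 0 < ε) :
    ∃ (ι : Type) (_ : Fintype ι) (U : ι → Set (Rd d)) (G : ι → S → ℝ),
      (∀ i, MeasurableSet (U i)) ∧ (∀ i, Dominated ρ Θ f θs (U i) (G i)) ∧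
      (∀ i, ∫ y, G i y ∂ρ < 0) ∧ ∃ r > (0 : ℝ), ∀ T : Set (Rd d), T ⊆ (ball θs ε)ᶜ →
        (∀ x ∈ T, ∀ y ∈ T, dist x y < r) → ∃ i, T ⊆ U i := by
  obtain ⟨A, hA, hsmall, A', hA', ⟨O, hO, hAO, hOA'⟩, hcomp, hcont, δ, hδ, hsm, hsup⟩ := h4
  obtain ⟨G, hG, hG0⟩ := exists_dominated_compl hf ht hsmall
  set K := (A' ∩ Θ) \ ball θs ε with hK
  have hKc : IsCompact K := hcomp.diff isOpen_ball
  have hloc : ∀ z : K, ∃ r > (0 : ℝ), ∃ (U : Set (Rd d)) (G' : S → ℝ), MeasurableSet U ∧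
      Dominated ρ Θ f θs U G' ∧ ∫ y, G' y ∂ρ < 0 ∧ ball z.1 r ∩ Θ ⊆ U := fun z => by
    refine exists_dominated_nhds hΘ hf ht hA hA' hO hAO hOA' hcont hδ hsm hsup hG hG0 z.2.1 ?_
    intro h
    exact z.2.2 (by rw [h]; exact mem_ball_self hε)
  choose r hr U G' hU hD hneg hsub using hloc
  obtain ⟨t, ht'⟩ := hKc.elim_finite_subcover (fun z : K => ball z.1 (r z))
    (fun z => isOpen_ball) fun x hx => mem_iUnion.2 ⟨⟨x, hx⟩, mem_ball_self (hr _)⟩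
  obtain ⟨s, hs, hleb⟩ := lebesgue_number_lemma_of_metric (c := fun z : t => ball z.1.1 (r z.1))
    hKc (fun z => isOpen_ball) (by
      intro x hx
      obtain ⟨z, hz, hxz⟩ := mem_iUnion₂.1 (ht' hx)
      exact mem_iUnion.2 ⟨⟨z, hz⟩, hxz⟩)
  -- the cells are `Aᶜ` and the neighbourhoods of finitely many points of the compact region `K`,
  -- all enlarged by `Θᶜ`; a set of diameter less than the Lebesgue number which meets `A' ∩ Θ` lies
  -- in one of the neighbourhoods, and otherwise it lies in `Aᶜ`
  classical
  refine ⟨Option (Fin t.card), inferInstance,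
    fun i => (i.elim Aᶜ fun j => U (t.equivFin.symm j).1) ∪ Θᶜ,
    fun i => i.elim G fun j => G' (t.equivFin.symm j).1, ?_, ?_, ?_, s, hs, ?_⟩
  · rintro (_ | j)
    · exact hA.compl.union hΘ.compl
    · exact (hU _).union hΘ.compl
  · rintro (_ | j)
    · exact hG.union_compl
    · exact (hD _).union_compl
  · rintro (_ | j)
    · exact hG0
    · exact hneg _
  · intro T hT hdiam
    by_cases hTK : ∃ x ∈ T, x ∈ A' ∩ Θ
    · obtain ⟨x, hxT, hxK⟩ := hTK
      obtain ⟨z, hz⟩ := hleb x ⟨hxK, hT hxT⟩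
      refine ⟨some (t.equivFin z), fun θ hθ => ?_⟩
      simp only [Option.elim_some, Equiv.symm_apply_apply]
      by_cases hθΘ : θ ∈ Θ
      · exact Or.inl (hsub z.1 ⟨hz (hdiam θ hθ x hxT), hθΘ⟩)
      · exact Or.inr hθΘ
    · refine ⟨none, fun θ hθ => ?_⟩
      by_cases hθΘ : θ ∈ Θ
      · exact Or.inl fun hθA => hTK ⟨θ, hθ, hOA' (hAO hθA), hθΘ⟩
      · exact Or.inr hθΘ

end Cover

/-! ### Independence of disjoint windows -/

lemma indepFun_truncate {Ω E : Type*} [MeasurableSpace Ω] [MeasurableSpace E] {P : Measure Ω}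
    {X : ℕ → Ω → E} (hX : iIndepFun X P) (hXm : ∀ i, Measurable (X i)) {s t : Finset ℕ}
    (hst : Disjoint s t) (e : E) :
    IndepFun (fun ω i => if i ∈ s then X i ω else e) (fun ω i => if i ∈ t then X i ω else e) P := by
  have h := hX.indepFun_finset s t hst hXm
  have hg : ∀ u : Finset ℕ,
      Measurable fun (x : u → E) (i : ℕ) => if hi : i ∈ u then x ⟨i, hi⟩ else e := fun u => by
    refine measurable_pi_lambda _ fun i => ?_
    by_cases hi : i ∈ u
    · simp only [hi, dif_pos]; exact measurable_pi_apply _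
    · simp only [hi, dif_neg, not_false_eq_true]; exact measurable_const
  have h2 := h.comp (hg s) (hg t)
  convert h2 using 1
  · ext ω i; by_cases hi : i ∈ s <;> simp [hi]
  · ext ω i; by_cases hi : i ∈ t <;> simp [hi]

lemma measurable_truncate {Ω E : Type*} [MeasurableSpace Ω] [MeasurableSpace E]
    {X : ℕ → Ω → E} (hXm : ∀ i, Measurable (X i)) (s : Finset ℕ) (e : E) :
    Measurable fun ω (i : ℕ) => if i ∈ s then X i ω else e := by
  refine measurable_pi_lambda _ fun i => ?_
  by_cases hi : i ∈ s
  · simpa only [hi, if_true] using hXm i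
  · simp only [hi, if_false]; exact measurable_const

lemma lintegral_of_indepFun {Ω α β : Type*} [MeasurableSpace Ω] [MeasurableSpace α]
    [MeasurableSpace β] {P : Measure Ω} [IsProbabilityMeasure P] {X : Ω → α} {W : Ω → β}
    (hXW : IndepFun X W P) (hX : Measurable X) (hW : Measurable W) {F : α × β → ℝ≥0∞}
    (hF : Measurable F) :
    ∫⁻ ω, F (X ω, W ω) ∂P = ∫⁻ ω, ∫⁻ ω', F (X ω, W ω') ∂P ∂P := by
  have := Measure.isProbabilityMeasure_map (μ := P) hW.aemeasurable
  have h := (indepFun_iff_map_prod_eq_prod_map_map hX.aemeasurable hW.aemeasurable).1 hXW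
  rw [← lintegral_map hF (hX.prodMk hW), h, lintegral_prod _ hF.aemeasurable,
    lintegral_map (by fun_prop) hX]
  refine lintegral_congr fun ω => ?_
  exact lintegral_map (by fun_prop) hW

/-- Integrating out the `k`-th coordinate of a function which depends only on the first `k`
coordinates and the `k`-th one. -/
lemma lintegral_infinitePi_last {E : Type*} [MeasurableSpace E] [Zero E] (g : ℕ → Measure E)
    [∀ i, IsProbabilityMeasure (g i)] (k : ℕ) {Φ : (ℕ → E) × E → ℝ≥0∞} (hΦ : Measurable Φ)
    (hdep : ∀ ξ ξ' u, (∀ i < k, ξ i = ξ' i) → Φ (ξ, u) = Φ (ξ', u)) :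
    ∫⁻ ξ, ∫⁻ u, Φ (ξ, u) ∂g k ∂(Measure.infinitePi g) =
      ∫⁻ ξ, Φ (ξ, ξ k) ∂(Measure.infinitePi g) := by
  set Q := Measure.infinitePi g with hQ
  have hind : iIndepFun (fun i (ξ : ℕ → E) => ξ i) Q :=
    iIndepFun_infinitePi (X := fun _ (x : E) => x) (fun _ => measurable_id)
  have hmeas : ∀ i, Measurable fun ξ : ℕ → E => ξ i := fun i => measurable_pi_apply i
  set X : (ℕ → E) → ℕ → E := fun ξ i => if i ∈ Finset.range k then ξ i else 0 with hX
  have hXm : Measurable X := measurable_truncate hmeas (Finset.range k) 0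
  have h1 : IndepFun X (fun ξ => ξ k) Q := by
    have := (indepFun_truncate hind hmeas (s := Finset.range k) (t := {k}) (by simp) 0).comp
      measurable_id (measurable_pi_apply k)
    simpa [Function.comp_def, hX] using this
  have hcongr : ∀ ξ u, Φ (ξ, u) = Φ (X ξ, u) := fun ξ u =>
    hdep _ _ _ fun i hi => by simp [hX, hi]
  calc _ = ∫⁻ ξ, ∫⁻ ξ', Φ (X ξ, ξ' k) ∂Q ∂Q := by
        refine lintegral_congr fun ξ => ?_
        rw [← Measure.infinitePi_map_eval g k, lintegral_map (by fun_prop) (by fun_prop)]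
        exact lintegral_congr fun ξ' => hcongr _ _
    _ = ∫⁻ ξ, Φ (X ξ, ξ k) ∂Q := (lintegral_of_indepFun h1 hXm (hmeas k) hΦ).symm
    _ = _ := lintegral_congr fun ξ => (hcongr _ _).symm

/-! ### The sequence of distributions as a function of the data -/

section Post

variable {d : ℕ} {S : Type*} {Θ : Set (Rd d)} {f : Rd d → S → ℝ≥0} {μ : ℕ → Measure (Rd d)}
  {π₀ : Measure (Rd d)}

lemma bayes_univ_le_one (κ : Measure (Rd d)) (y : S) : bayes Θ f κ y univ ≤ 1 := by
  rw [bayes, Measure.smul_apply, withDensity_apply _ MeasurableSet.univ, Measure.restrict_univ,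
    smul_eq_mul]
  exact ENNReal.inv_mul_le_one _

lemma post_univ_le_one [IsProbabilityMeasure π₀] (y : ℕ → S) (t : ℕ) :
    post Θ f μ π₀ y t univ ≤ 1 := by
  cases t with
  | zero => simp [post]
  | succ t => exact bayes_univ_le_one _ _

instance isFiniteMeasure_post [IsProbabilityMeasure π₀] (y : ℕ → S) (t : ℕ) :
    IsFiniteMeasure (post Θ f μ π₀ y t) :=
  ⟨(post_univ_le_one y t).trans_lt ENNReal.one_lt_top⟩

lemma post_congr {y y' : ℕ → S} {t : ℕ} (h : ∀ n < t, y n = y' n) :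
    post Θ f μ π₀ y t = post Θ f μ π₀ y' t := by
  induction t with
  | zero => rfl
  | succ t ih =>
    simp only [post]
    rw [ih fun n hn => h n (by omega), h t (by omega)]

variable [MeasurableSpace S]

lemma measurable_post (hΘ : MeasurableSet Θ) (hf : Measurable fun q : Θ × S => f q.1 q.2)
    [∀ t, IsFiniteMeasure (μ t)] [IsProbabilityMeasure π₀] (t : ℕ) :
    Measurable fun y : ℕ → S => post Θ f μ π₀ y t := by
  induction t with
  | zero => exact measurable_const
  | succ t ih =>
    let κ : Kernel (ℕ → S) (Rd d) := ⟨fun y => post Θ f μ π₀ y t, ih⟩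
    have hκ : IsFiniteKernel κ := ⟨⟨1, ENNReal.one_lt_top, fun y => post_univ_le_one y t⟩⟩
    let κ' : Kernel (ℕ → S) (Rd d) := ((Kernel.const _ (μ t)).prod κ).map fun x => x.1 + x.2
    have hκ' : ∀ y, κ' y = (μ t).conv (post Θ f μ π₀ y t) := fun y => by
      rw [Kernel.map_apply _ (by fun_prop), Kernel.prod_apply, Kernel.const_apply]
      rfl
    have hext : Measurable fun q : (ℕ → S) × Rd d => extend Θ f q.2 (q.1 t) :=
      (measurable_extend hΘ hf).comp
        (measurable_snd.prodMk ((measurable_pi_apply t).comp measurable_fst))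
    refine Measure.measurable_of_measurable_coe _ fun s hs => ?_
    have heq : ∀ y : ℕ → S, post Θ f μ π₀ y (t + 1) s =
        (∫⁻ θ, extend Θ f θ (y t) ∂κ' y)⁻¹ *
          ∫⁻ θ, s.indicator (fun _ => 1) θ * extend Θ f θ (y t) ∂κ' y := by
      intro y
      simp only [post, bayes, normConst]
      rw [Measure.smul_apply, withDensity_apply _ hs, smul_eq_mul, hκ', ← lintegral_indicator hs]
      congr 2
      ext θ
      by_cases hθ : θ ∈ s <;> simp [hθ]
    simp_rw [heq]
    refine Measurable.mul (Measurable.inv ?_) ?_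
    · exact Measurable.lintegral_kernel_prod_right' (κ := κ') hext
    · refine Measurable.lintegral_kernel_prod_right' (κ := κ')
        (f := fun q => s.indicator (fun _ => 1) q.2 * extend Θ f q.2 (q.1 t)) ?_
      exact (((measurable_const.indicator hs)).comp measurable_snd).mul hext

variable (Θ f μ π₀) in
/-- The prediction `μ_t * π̃_t`, as a function of the data. -/
noncomputable def predict (t : ℕ) (y : ℕ → S) : Measure (Rd d) :=
  (μ t).conv (post Θ f μ π₀ y t)

lemma measurable_predict (hΘ : MeasurableSet Θ) (hf : Measurable fun q : Θ × S => f q.1 q.2)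
    [∀ t, IsFiniteMeasure (μ t)] [IsProbabilityMeasure π₀] (t : ℕ) :
    Measurable (predict Θ f μ π₀ t) := by
  let κ : Kernel (ℕ → S) (Rd d) := ⟨fun y => post Θ f μ π₀ y t, measurable_post hΘ hf t⟩
  have hκ : IsFiniteKernel κ := ⟨⟨1, ENNReal.one_lt_top, fun y => post_univ_le_one y t⟩⟩
  let κ' : Kernel (ℕ → S) (Rd d) := ((Kernel.const _ (μ t)).prod κ).map fun x => x.1 + x.2
  have hκ' : ∀ y, κ' y = predict Θ f μ π₀ t y := fun y => by
    rw [Kernel.map_apply _ (by fun_prop), Kernel.prod_apply, Kernel.const_apply]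
    rfl
  have := κ'.measurable
  convert this using 1
  ext1 y
  exact (hκ' y).symm

omit [MeasurableSpace S] in
lemma predict_univ_le [IsProbabilityMeasure π₀] [∀ t, IsFiniteMeasure (μ t)] (t : ℕ)
    (y : ℕ → S) : predict Θ f μ π₀ t y univ ≤ μ t univ := by
  rw [predict, Measure.conv, Measure.map_apply (by fun_prop) MeasurableSet.univ, preimage_univ,
    ← univ_prod_univ, Measure.prod_prod]
  calc _ ≤ μ t univ * 1 := by gcongr; exact post_univ_le_one y t
    _ = _ := mul_one _

instance isFiniteMeasure_predict [IsProbabilityMeasure π₀] [∀ t, IsFiniteMeasure (μ t)] (t : ℕ)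
    (y : ℕ → S) : IsFiniteMeasure (predict Θ f μ π₀ t y) :=
  ⟨(predict_univ_le t y).trans_lt (measure_lt_top _ _)⟩

lemma lintegral_bayes (hΘ : MeasurableSet Θ) (hf : Measurable fun q : Θ × S => f q.1 q.2)
    (κ : Measure (Rd d)) (y : S) {F : Rd d → ℝ≥0∞} (hF : Measurable F) :
    ∫⁻ θ, F θ ∂(bayes Θ f κ y) = (normConst Θ f κ y)⁻¹ * ∫⁻ θ, extend Θ f θ y * F θ ∂κ := by
  have hm : Measurable fun θ => extend Θ f θ y :=
    (measurable_extend hΘ hf).comp measurable_prodMk_right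
  rw [bayes, lintegral_smul_measure, lintegral_withDensity_eq_lintegral_mul _ hm hF]
  rfl

lemma measurable_relLik_left {θs : Rd d} (hΘ : MeasurableSet Θ)
    (hf : Measurable fun q : Θ × S => f q.1 q.2) (hs : θs ∈ Θ) (y : S) :
    Measurable fun θ => relLik Θ f θs θ y :=
  (measurable_relLik hΘ hf hs).comp measurable_prodMk_right

/-- Path representation: up to a constant, `π̃_{t₀+k+1}` is the law of the end point of a walk
started from the prediction at time `t₀`, weighted by the likelihood ratios along the walk. -/
lemma exists_lintegral_post_eq {θs : Rd d} (hΘ : MeasurableSet Θ)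
    (hf : Measurable fun q : Θ × S => f q.1 q.2) (hs : θs ∈ Θ)
    [∀ t, IsFiniteMeasure (μ t)] [IsProbabilityMeasure π₀] (g : ℕ → Measure (Rd d))
    [∀ i, IsProbabilityMeasure (g i)] {y : ℕ → S} (hy : ∀ n, f θs (y n) ≠ 0) (t₀ k : ℕ)
    (hg : ∀ i < k, μ (t₀ + 1 + i) = g i) :
    ∃ c : ℝ≥0∞, ∀ F : Rd d → ℝ≥0∞, Measurable F →
      ∫⁻ θ, F θ ∂(post Θ f μ π₀ y (t₀ + (k + 1))) =
        c * ∫⁻ θ, ∫⁻ ξ, F (θ + walk ξ k) *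
          ∏ j ∈ Finset.range (k + 1), relLik Θ f θs (θ + walk ξ j) (y (t₀ + j))
            ∂(Measure.infinitePi g) ∂(predict Θ f μ π₀ t₀ y) := by
  have hR : ∀ n, Measurable fun θ => relLik Θ f θs θ (y n) := fun n =>
    measurable_relLik_left hΘ hf hs (y n)
  have hE : ∀ n, Measurable fun θ => extend Θ f θ (y n) := fun n =>
    (measurable_extend hΘ hf).comp measurable_prodMk_right
  have hER : ∀ n θ, extend Θ f θ (y n) = f θs (y n) * relLik Θ f θs θ (y n) := fun n θ => by
    rw [relLik, mul_comm, ENNReal.div_mul_cancel (by simpa using hy n) ENNReal.coe_ne_top]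
  have hwm : ∀ j, Measurable fun p : Rd d × (ℕ → Rd d) => p.1 + walk p.2 j := fun j =>
    measurable_fst.add ((measurable_walk j).comp measurable_snd)
  induction k with
  | zero =>
    refine ⟨(normConst Θ f (predict Θ f μ π₀ t₀ y) (y t₀))⁻¹ * f θs (y t₀), fun F hF => ?_⟩
    change ∫⁻ θ, F θ ∂(bayes Θ f (predict Θ f μ π₀ t₀ y) (y t₀)) = _
    rw [lintegral_bayes hΘ hf _ _ hF, mul_assoc, ← lintegral_const_mul' _ _ ENNReal.coe_ne_top]
    congr 1
    refine lintegral_congr fun θ => ?_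
    simp only [walk, Finset.range_zero, Finset.sum_empty, add_zero, zero_add, Finset.range_one,
      Finset.prod_singleton, lintegral_const, measure_univ, mul_one]
    rw [hER]; ring
  | succ k ih =>
    obtain ⟨c, hc⟩ := ih fun i hi => hg i (by omega)
    set Z := normConst Θ f (predict Θ f μ π₀ (t₀ + (k + 1)) y) (y (t₀ + (k + 1)))
    refine ⟨Z⁻¹ * f θs (y (t₀ + (k + 1))) * c, fun F hF => ?_⟩
    change ∫⁻ θ, F θ ∂(bayes Θ f (predict Θ f μ π₀ (t₀ + (k + 1)) y) (y (t₀ + (k + 1)))) = _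
    rw [lintegral_bayes hΘ hf _ _ hF]
    set R := fun θ => relLik Θ f θs θ (y (t₀ + (k + 1))) with hRdef
    have hRm : Measurable R := hR _
    have h1 : ∫⁻ θ, extend Θ f θ (y (t₀ + (k + 1))) * F θ
          ∂(predict Θ f μ π₀ (t₀ + (k + 1)) y) =
        f θs (y (t₀ + (k + 1))) * ∫⁻ θ, R θ * F θ ∂(predict Θ f μ π₀ (t₀ + (k + 1)) y) := by
      rw [← lintegral_const_mul' _ _ ENNReal.coe_ne_top]
      refine lintegral_congr fun θ => ?_
      rw [hER]; ring
    have hgk : μ (t₀ + (k + 1)) = g k := by rw [← hg k (by omega)]; congr 1; ring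
    have h2 : ∫⁻ θ, R θ * F θ ∂(predict Θ f μ π₀ (t₀ + (k + 1)) y) =
        ∫⁻ θ, (∫⁻ u, R (u + θ) * F (u + θ) ∂g k) ∂(post Θ f μ π₀ y (t₀ + (k + 1))) := by
      rw [predict, Measure.lintegral_conv (by fun_prop), hgk, lintegral_lintegral_swap]
      fun_prop
    have hin : Measurable fun θ => ∫⁻ u, R (u + θ) * F (u + θ) ∂g k :=
      Measurable.lintegral_prod_right' (f := fun p : Rd d × Rd d => R (p.2 + p.1) * F (p.2 + p.1))
        (by fun_prop)
    rw [h1, h2, hc _ hin, mul_assoc, mul_assoc]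
    congr 3
    refine lintegral_congr fun θ => ?_
    have hwθ : ∀ j, Measurable fun ξ : ℕ → Rd d => θ + walk ξ j := fun j =>
      (measurable_walk j).const_add θ
    set Φ : (ℕ → Rd d) × Rd d → ℝ≥0∞ := fun p =>
      (R (p.2 + (θ + walk p.1 k)) * F (p.2 + (θ + walk p.1 k))) *
        ∏ j ∈ Finset.range (k + 1), relLik Θ f θs (θ + walk p.1 j) (y (t₀ + j)) with hΦ
    have hΦm : Measurable Φ := by
      have e1 : Measurable fun p : (ℕ → Rd d) × Rd d => p.2 + (θ + walk p.1 k) :=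
        measurable_snd.add ((hwθ k).comp measurable_fst)
      refine Measurable.mul ((hRm.comp e1).mul (hF.comp e1)) ?_
      exact Finset.measurable_prod _ fun j _ => (hR _).comp ((hwθ j).comp measurable_fst)
    have hdep : ∀ ξ ξ' u, (∀ i < k, ξ i = ξ' i) → Φ (ξ, u) = Φ (ξ', u) := by
      intro ξ ξ' u hξ
      have hw : ∀ j ≤ k, walk ξ j = walk ξ' j := fun j hj =>
        Finset.sum_congr rfl fun i hi => hξ i (by have := Finset.mem_range.1 hi; omega)
      simp only [hΦ]
      rw [hw k le_rfl]
      congr 1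
      refine Finset.prod_congr rfl fun j hj => ?_
      rw [hw j (by have := Finset.mem_range.1 hj; omega)]
    calc _ = ∫⁻ ξ, ∫⁻ u, Φ (ξ, u) ∂g k ∂(Measure.infinitePi g) := by
          refine lintegral_congr fun ξ => ?_
          rw [← lintegral_mul_const _ (by fun_prop)]
      _ = ∫⁻ ξ, Φ (ξ, ξ k) ∂(Measure.infinitePi g) := lintegral_infinitePi_last g k hΦm hdep
      _ = _ := by
          refine lintegral_congr fun ξ => ?_
          have hw : ξ k + (θ + walk ξ k) = θ + walk ξ (k + 1) := by
            rw [walk, walk, Finset.sum_range_succ]; abel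
          simp only [hΦ, hw]
          rw [Finset.prod_range_succ _ (k + 1)]
          ring

end Post

/-! ### Weighted path measures -/

section Paths

variable {d : ℕ}

/-- The space of a starting point and a sequence of increments. -/
abbrev PathSpace (d : ℕ) := Rd d × (ℕ → Rd d)

/-- The position at time `j` of the path. -/
def pos (p : PathSpace d) (j : ℕ) : Rd d := p.1 + walk p.2 j

lemma measurable_pos (j : ℕ) : Measurable fun p : PathSpace d => pos p j :=
  measurable_fst.add ((measurable_walk j).comp measurable_snd)

lemma pos_zero (p : PathSpace d) : pos p 0 = p.1 := by simp [pos, walk]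

variable {S : Type*} {Θ : Set (Rd d)} {f : Rd d → S → ℝ≥0} {θs : Rd d}

/-- The law `M` of the path, reweighted by the likelihood ratios at the first `n` positions for the
data `y t₀, …, y (t₀ + n - 1)`, each multiplied by the weight `w` of the datum. -/
noncomputable def weighted (Θ : Set (Rd d)) (f : Rd d → S → ℝ≥0) (θs : Rd d) (w : S → ℝ≥0∞)
    (M : Measure (PathSpace d)) (y : ℕ → S) (t₀ n : ℕ) : Measure (PathSpace d) :=
  M.withDensity fun p => ∏ j ∈ Finset.range n,
    (relLik Θ f θs (pos p j) (y (t₀ + j)) * w (y (t₀ + j)))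

lemma weighted_one_eq [MeasurableSpace S] (hΘ : MeasurableSet Θ)
    (hf : Measurable fun q : Θ × S => f q.1 q.2) (hs : θs ∈ Θ) (G : S → ℝ)
    (M : Measure (PathSpace d)) (y : ℕ → S) (t₀ n : ℕ) :
    weighted Θ f θs (fun _ => 1) M y t₀ n =
      ENNReal.ofReal (Real.exp (∑ j ∈ Finset.range n, G (y (t₀ + j)))) •
        weighted Θ f θs (fun s => ENNReal.ofReal (Real.exp (-G s))) M y t₀ n := by
  unfold weighted
  have hm : Measurable fun p : PathSpace d => ∏ j ∈ Finset.range n,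
      (relLik Θ f θs (pos p j) (y (t₀ + j)) * ENNReal.ofReal (Real.exp (-G (y (t₀ + j))))) :=
    Finset.measurable_prod _ fun j _ =>
      ((measurable_relLik_left hΘ hf hs _).comp (measurable_pos j)).mul measurable_const
  rw [← withDensity_smul _ hm]
  congr 1
  ext p
  rw [Pi.smul_apply, smul_eq_mul, Real.exp_sum,
    ENNReal.ofReal_prod_of_nonneg fun _ _ => (Real.exp_pos _).le, ← Finset.prod_mul_distrib]
  refine Finset.prod_congr rfl fun j _ => ?_
  rw [mul_left_comm, ← ENNReal.ofReal_mul (Real.exp_pos _).le, ← Real.exp_add]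
  simp

variable {μ : ℕ → Measure (Rd d)} {π₀ : Measure (Rd d)}

variable (Θ f μ π₀) in
/-- The law of the path started from the prediction at time `t₀`, with independent increments of
laws `g 0, g 1, …`. -/
noncomputable def pathLaw (g : ℕ → Measure (Rd d)) (t₀ : ℕ) (y : ℕ → S) :
    Measure (PathSpace d) :=
  (predict Θ f μ π₀ t₀ y).prod (Measure.infinitePi g)

variable [MeasurableSpace S]

/-- The mass of a set under `π̃_{t₀+k+1}`, in terms of the weighted path measure. -/
lemma post_mul_weighted_univ_le (hΘ : MeasurableSet Θ)
    (hf : Measurable fun q : Θ × S => f q.1 q.2) (hs : θs ∈ Θ)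
    [∀ t, IsFiniteMeasure (μ t)] [IsProbabilityMeasure π₀] (g : ℕ → Measure (Rd d))
    [∀ i, IsProbabilityMeasure (g i)] {y : ℕ → S} (hy : ∀ n, f θs (y n) ≠ 0) (t₀ k : ℕ)
    (hg : ∀ i < k, μ (t₀ + 1 + i) = g i) {B : Set (Rd d)} (hB : MeasurableSet B) :
    post Θ f μ π₀ y (t₀ + (k + 1)) B *
        weighted Θ f θs (fun _ => 1) (pathLaw Θ f μ π₀ g t₀ y) y t₀ (k + 1) univ ≤
      weighted Θ f θs (fun _ => 1) (pathLaw Θ f μ π₀ g t₀ y) y t₀ (k + 1)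
        {p | pos p k ∈ B} := by
  obtain ⟨c, hc⟩ := exists_lintegral_post_eq (π₀ := π₀) hΘ hf hs g hy t₀ k hg
  have key : ∀ B : Set (Rd d), MeasurableSet B → post Θ f μ π₀ y (t₀ + (k + 1)) B =
      c * weighted Θ f θs (fun _ => 1) (pathLaw Θ f μ π₀ g t₀ y) y t₀ (k + 1)
        {p | pos p k ∈ B} := by
    intro B hB
    have hpB : MeasurableSet {p : PathSpace d | pos p k ∈ B} := measurable_pos k hB
    have hprod : Measurable fun p : PathSpace d => ∏ j ∈ Finset.range (k + 1),
        relLik Θ f θs (pos p j) (y (t₀ + j)) :=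
      Finset.measurable_prod _ fun j _ =>
        (measurable_relLik_left hΘ hf hs _).comp (measurable_pos j)
    rw [← lintegral_indicator_one hB, hc _ (measurable_one.indicator hB), weighted,
      withDensity_apply _ hpB, pathLaw, ← lintegral_indicator hpB, lintegral_prod]
    · congr 1
      refine lintegral_congr fun θ => lintegral_congr fun ξ => ?_
      by_cases h : θ + walk ξ k ∈ B
      · rw [indicator_of_mem h, indicator_of_mem (show (θ, ξ) ∈ {p : PathSpace d | pos p k ∈ B}
          from h)]
        simp [pos]
      · rw [indicator_of_notMem h, indicator_of_notMem
          (show (θ, ξ) ∉ {p : PathSpace d | pos p k ∈ B} from h)]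
        simp
    · refine Measurable.aemeasurable (Measurable.indicator ?_ hpB)
      simpa using hprod
  have hu := key univ MeasurableSet.univ
  have h1 := post_univ_le_one (Θ := Θ) (f := f) (μ := μ) (π₀ := π₀) y (t₀ + (k + 1))
  have hset : {p : PathSpace d | pos p k ∈ (univ : Set (Rd d))} = univ := by ext; simp
  rw [hu, hset] at h1
  rw [key B hB, mul_comm c, mul_assoc]
  calc _ ≤ _ := mul_le_mul_right h1 _
    _ = _ := mul_one _

/-- Along a deterministic path in a dominated set, the expected weighted likelihood ratio
factorises into terms at most one. -/
lemma lintegral_prod_relLik_le {Ω : Type*} [MeasurableSpace Ω] {P : Measure Ω}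
    {Y : ℕ → Ω → S} (hYm : ∀ n, Measurable (Y n)) (hYi : iIndepFun Y P)
    {ρ : Measure S} (hYd : ∀ n, P.map (Y n) = ρ) (hΘ : MeasurableSet Θ)
    (hf : Measurable fun q : Θ × S => f q.1 q.2) (hs : θs ∈ Θ) {U : Set (Rd d)} {G : S → ℝ}
    (hG : Dominated ρ Θ f θs U G) (t₀ n : ℕ) (x : ℕ → Rd d) (hx : ∀ j < n, x j ∈ U) :
    ∫⁻ ω, ∏ j ∈ Finset.range n, (relLik Θ f θs (x j) (Y (t₀ + j) ω) *
      ENNReal.ofReal (Real.exp (-G (Y (t₀ + j) ω)))) ∂P ≤ 1 := by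
  have hm : ∀ j, Measurable fun s =>
      relLik Θ f θs (x j) s * ENNReal.ofReal (Real.exp (-G s)) := fun j =>
    ((measurable_relLik hΘ hf hs).comp measurable_prodMk_left).mul
      (Real.measurable_exp.comp hG.measurable.neg).ennreal_ofReal
  have hind : iIndepFun (fun j ω => relLik Θ f θs (x j) (Y (t₀ + j) ω) *
      ENNReal.ofReal (Real.exp (-G (Y (t₀ + j) ω)))) P :=
    (hYi.precomp (g := fun j => t₀ + j) (add_right_injective t₀)).comp
      (fun j s => relLik Θ f θs (x j) s * ENNReal.ofReal (Real.exp (-G s))) hm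
  rw [lintegral_prod_eq_prod_lintegral_of_indepFun (Finset.range n) _ hind
    fun j => (hm j).comp (hYm _)]
  refine Finset.prod_le_one' fun j hj => ?_
  have h1 := hG.lintegral_le _ (hx j (Finset.mem_range.1 hj))
  rwa [← hYd (t₀ + j), lintegral_map (hm j) (hYm _)] at h1

/-- The expectation of the weighted path measure of a set of paths that remain in a dominated set
is at most its mass under the unweighted law. The factor `v` is any function of `π̃_{t₀}`. -/
lemma lintegral_weighted_le {Ω : Type*} [MeasurableSpace Ω] {P : Measure Ω}
    [IsProbabilityMeasure P] {Y : ℕ → Ω → S} (hYm : ∀ n, Measurable (Y n)) (hYi : iIndepFun Y P)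
    {ρ : Measure S} (hYd : ∀ n, P.map (Y n) = ρ) (hΘ : MeasurableSet Θ)
    (hf : Measurable fun q : Θ × S => f q.1 q.2) (hs : θs ∈ Θ)
    [∀ t, IsFiniteMeasure (μ t)] [IsProbabilityMeasure π₀] (g : ℕ → Measure (Rd d))
    [∀ i, IsProbabilityMeasure (g i)] {U : Set (Rd d)} {G : S → ℝ}
    (hG : Dominated ρ Θ f θs U G) (t₀ n : ℕ) {D : Set (PathSpace d)} (hD : MeasurableSet D)
    (hDU : ∀ p ∈ D, ∀ j < n, pos p j ∈ U) {v : Measure (Rd d) → ℝ≥0∞} (hv : Measurable v) :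
    Measurable (fun ω => v (post Θ f μ π₀ (fun i => Y i ω) t₀) *
        weighted Θ f θs (fun s => ENNReal.ofReal (Real.exp (-G s)))
          (pathLaw Θ f μ π₀ g t₀ fun i => Y i ω) (fun i => Y i ω) t₀ n D) ∧
    ∫⁻ ω, v (post Θ f μ π₀ (fun i => Y i ω) t₀) *
        weighted Θ f θs (fun s => ENNReal.ofReal (Real.exp (-G s)))
          (pathLaw Θ f μ π₀ g t₀ fun i => Y i ω) (fun i => Y i ω) t₀ n D ∂P ≤
      ∫⁻ ω, v (post Θ f μ π₀ (fun i => Y i ω) t₀) *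
        pathLaw Θ f μ π₀ g t₀ (fun i => Y i ω) D ∂P := by
  obtain ⟨ω₀⟩ : Nonempty Ω := nonempty_of_isProbabilityMeasure P
  set e : S := Y 0 ω₀ with he
  -- `X` carries the observations before time `t₀`, which determine the law of the path, and `W` those
  -- of the window, which enter the weights; they are independent
  set X : Ω → ℕ → S := fun ω i => if i ∈ Finset.range t₀ then Y i ω else e with hX
  set W : Ω → ℕ → S := fun ω i => if i ∈ Finset.Ico t₀ (t₀ + n) then Y i ω else e with hW
  have hXW : IndepFun X W P := indepFun_truncate hYi hYm (by
    rw [Finset.disjoint_left]; intro i hi; simp at hi ⊢; omega) e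
  have hXm : Measurable X := measurable_truncate hYm _ e
  have hWm : Measurable W := measurable_truncate hYm _ e
  have hpost : ∀ ω, post Θ f μ π₀ (fun i => Y i ω) t₀ = post Θ f μ π₀ (X ω) t₀ := fun ω =>
    post_congr fun i hi => by simp [hX, hi]
  have hpath : ∀ ω, pathLaw Θ f μ π₀ g t₀ (fun i => Y i ω) = pathLaw Θ f μ π₀ g t₀ (X ω) :=
    fun ω => by rw [pathLaw, predict, hpost, pathLaw, predict]
  have hWt : ∀ ω, ∀ j < n, W ω (t₀ + j) = Y (t₀ + j) ω := fun ω j hj => by simp [hW, hj]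
  set φ : Rd d → S → ℝ≥0∞ := fun θ s =>
    relLik Θ f θs θ s * ENNReal.ofReal (Real.exp (-G s)) with hφ
  have hφm : Measurable fun q : Rd d × S => φ q.1 q.2 :=
    (measurable_relLik hΘ hf hs).mul
      ((Real.measurable_exp.comp (hG.measurable.comp measurable_snd).neg).ennreal_ofReal)
  let κ : Kernel (ℕ → S) (Rd d) := ⟨predict Θ f μ π₀ t₀, measurable_predict hΘ hf t₀⟩
  have hκ : IsFiniteKernel κ := ⟨⟨μ t₀ univ, measure_lt_top _ _, fun y => predict_univ_le t₀ y⟩⟩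
  let K : Kernel (ℕ → S) (PathSpace d) := κ.prod (Kernel.const _ (Measure.infinitePi g))
  have hK : ∀ y, K y = pathLaw Θ f μ π₀ g t₀ y := fun y => by
    rw [Kernel.prod_apply, Kernel.const_apply]; rfl
  set Ψ : PathSpace d × (ℕ → S) → ℝ≥0∞ := fun q =>
    D.indicator (fun _ => 1) q.1 * ∏ j ∈ Finset.range n, φ (pos q.1 j) (q.2 (t₀ + j)) with hΨ
  have hΨm : Measurable Ψ := by
    refine Measurable.mul ((measurable_const.indicator hD).comp measurable_fst) ?_
    refine Finset.measurable_prod _ fun j _ => ?_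
    exact hφm.comp (((measurable_pos j).comp measurable_fst).prodMk
      ((measurable_pi_apply (t₀ + j)).comp measurable_snd))
  have hw : ∀ (M : Measure (PathSpace d)) (y : ℕ → S),
      weighted Θ f θs (fun s => ENNReal.ofReal (Real.exp (-G s))) M y t₀ n D =
        ∫⁻ p, Ψ (p, y) ∂M := fun M y => by
    rw [weighted, withDensity_apply _ hD, ← lintegral_indicator hD]
    refine lintegral_congr fun p => ?_
    by_cases hp : p ∈ D <;> simp [hp, hΨ, hφ]
  have hvm : Measurable fun x : ℕ → S => v (post Θ f μ π₀ x t₀) :=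
    hv.comp (measurable_post hΘ hf t₀)
  set F : (ℕ → S) × (ℕ → S) → ℝ≥0∞ := fun q =>
    v (post Θ f μ π₀ q.1 t₀) * ∫⁻ p, Ψ (p, q.2) ∂(K q.1) with hF
  have hFm : Measurable F := by
    refine Measurable.mul (hvm.comp measurable_fst) ?_
    exact Measurable.lintegral_kernel_prod_right' (κ := K.comap Prod.fst measurable_fst)
      (f := fun q : ((ℕ → S) × (ℕ → S)) × PathSpace d => Ψ (q.2, q.1.2))
      (hΨm.comp (measurable_snd.prodMk (measurable_snd.comp measurable_fst)))
  have hpt : ∀ p, ∫⁻ ω', Ψ (p, W ω') ∂P ≤ D.indicator 1 p := by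
    intro p
    by_cases hp : p ∈ D
    · have h2 : ∀ ω', Ψ (p, W ω') = ∏ j ∈ Finset.range n,
          (relLik Θ f θs (pos p j) (Y (t₀ + j) ω') *
            ENNReal.ofReal (Real.exp (-G (Y (t₀ + j) ω')))) := by
        intro ω'
        simp only [hΨ, indicator_of_mem hp, one_mul]
        refine Finset.prod_congr rfl fun j hj => ?_
        rw [hWt ω' j (Finset.mem_range.1 hj)]
      rw [indicator_of_mem hp]
      calc _ = _ := lintegral_congr h2
        _ ≤ 1 := lintegral_prod_relLik_le hYm hYi hYd hΘ hf hs hG t₀ n (pos p) (hDU p hp)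
    · have h2 : ∀ ω', Ψ (p, W ω') = 0 := fun ω' => by simp [hΨ, hp]
      rw [lintegral_congr h2]
      simp
  have hM : ∀ M : Measure (PathSpace d), SFinite M →
      Measurable (fun ω' => ∫⁻ p, Ψ (p, W ω') ∂M) ∧ ∫⁻ ω', ∫⁻ p, Ψ (p, W ω') ∂M ∂P ≤ M D := by
    intro M _
    have hm : Measurable fun q : Ω × PathSpace d => Ψ (q.2, W q.1) :=
      hΨm.comp (measurable_snd.prodMk (hWm.comp measurable_fst))
    refine ⟨hm.lintegral_prod_right', ?_⟩
    rw [lintegral_lintegral_swap hm.aemeasurable]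
    exact (lintegral_mono hpt).trans (le_of_eq (lintegral_indicator_one hD))
  have hFeq : ∀ ω, v (post Θ f μ π₀ (fun i => Y i ω) t₀) *
        weighted Θ f θs (fun s => ENNReal.ofReal (Real.exp (-G s)))
          (pathLaw Θ f μ π₀ g t₀ fun i => Y i ω) (fun i => Y i ω) t₀ n D = F (X ω, W ω) := by
    intro ω
    rw [hw, hpost, hpath]
    simp only [hF, hK]
    congr 1
    refine lintegral_congr fun p => ?_
    simp only [hΨ]
    congr 1
    refine Finset.prod_congr rfl fun j hj => ?_
    rw [hWt ω j (Finset.mem_range.1 hj)]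
  refine ⟨by rw [funext hFeq]; exact hFm.comp (hXm.prodMk hWm), ?_⟩
  rw [lintegral_congr hFeq, lintegral_of_indepFun hXW hXm hWm hFm]
  refine lintegral_mono fun ω => ?_
  obtain ⟨h1, h2⟩ := hM (K (X ω)) inferInstance
  simp only [hF]
  rw [lintegral_const_mul _ h1, hpost ω, hpath ω, ← hK]
  gcongr

end Paths

/-! ### Averages of the data -/

/-- A weak law of large numbers, uniform with respect to the first index of the window. -/
lemma exists_forall_window_sum_le {Ω S : Type*} [MeasurableSpace Ω] [MeasurableSpace S]
    {P : Measure Ω} [IsProbabilityMeasure P] {Y : ℕ → Ω → S} (hYm : ∀ n, Measurable (Y n))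
    (hYi : iIndepFun Y P) {ρ : Measure S} [IsProbabilityMeasure ρ] (hYd : ∀ n, P.map (Y n) = ρ)
    {G : S → ℝ} (hGm : Measurable G) (hGi : Integrable G ρ) {a : ℝ} (ha : ∫ y, G y ∂ρ < a)
    {η : ℝ≥0∞} (hη : 0 < η) :
    ∃ k₀ : ℕ, ∀ k ≥ k₀, ∀ t₀ : ℕ,
      P {ω | a * k < ∑ j ∈ Finset.range k, G (Y (t₀ + j) ω)} ≤ η := by
  -- the strong law on the product space gives one bound for all windows, whose law is the same
  set Q := Measure.infinitePi (fun _ : ℕ => ρ) with hQ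
  set X : ℕ → (ℕ → S) → ℝ := fun j x => G (x j) with hX
  have hmp : ∀ j, MeasurePreserving (fun x : ℕ → S => x j) Q ρ := fun j =>
    measurePreserving_eval_infinitePi (fun _ : ℕ => ρ) j
  have hint : ∀ j, Integrable (X j) Q := fun j => (hmp j).integrable_comp_of_integrable hGi
  have hind : iIndepFun X Q := iIndepFun_infinitePi (X := fun _ => G) (fun _ => hGm)
  have hid : ∀ j, IdentDistrib (X j) (X 0) Q Q := fun j =>
    ⟨(hGm.comp (measurable_pi_apply j)).aemeasurable,
      (hGm.comp (measurable_pi_apply 0)).aemeasurable, by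
      have h1 : ∀ j, Q.map (X j) = ρ.map G := fun j => by
        rw [← (hmp j).map_eq, Measure.map_map hGm (measurable_pi_apply j)]; rfl
      rw [h1, h1]⟩
  have hmean : ∫ x, X 0 x ∂Q = ∫ y, G y ∂ρ := by
    rw [← (hmp 0).map_eq, integral_map (measurable_pi_apply 0).aemeasurable hGm.aestronglyMeasurable]
  have hsl := strong_law_ae_real X (hint 0) (fun i j hij => hind.indepFun hij) hid
  rw [hmean] at hsl
  have hXm : ∀ j, Measurable (X j) := fun j => hGm.comp (measurable_pi_apply j)
  have htm := tendstoInMeasure_of_tendsto_ae (fun n => by fun_prop) hsl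
  have hev := (ENNReal.tendsto_nhds_zero.1 (htm (ENNReal.ofReal (a - ∫ y, G y ∂ρ))
    (by simpa using ha))) η hη
  obtain ⟨k₀, hk₀⟩ := eventually_atTop.1 hev
  refine ⟨k₀, fun k hk t₀ => ?_⟩
  have hlaw : P.map (fun ω j => Y (t₀ + j) ω) = Q := by
    rw [(hYi.precomp (g := fun j => t₀ + j) (add_right_injective t₀)).map_fun_eq_infinitePi_map
      fun j => hYm _]
    simp only [hYd, hQ]
  have hset : MeasurableSet {x : ℕ → S | a * k < ∑ j ∈ Finset.range k, X j x} :=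
    measurableSet_lt measurable_const (Finset.measurable_sum _ fun j _ => hXm j)
  calc P {ω | a * k < ∑ j ∈ Finset.range k, G (Y (t₀ + j) ω)}
      = Q {x | a * k < ∑ j ∈ Finset.range k, X j x} := by
        rw [← hlaw, Measure.map_apply (measurable_pi_lambda _ fun j => hYm _) hset]
        rfl
    _ ≤ _ := measure_mono ?_
    _ ≤ η := hk₀ k hk
  intro x hx
  simp only [mem_ofPred_eq] at hx ⊢
  rcases Nat.eq_zero_or_pos k with rfl | hk0
  · simp at hx
  have hk1 : (0 : ℝ) < k := by exact_mod_cast hk0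
  rw [edist_dist, Real.dist_eq]
  refine ENNReal.ofReal_le_ofReal (le_trans ?_ (le_abs_self _))
  have := (lt_div_iff₀ hk1).2 hx
  linarith

section Bounds

variable {d : ℕ} {S : Type*} {Θ : Set (Rd d)} {f : Rd d → S → ℝ≥0} {θs : Rd d}
  {μ : ℕ → Measure (Rd d)} {π₀ : Measure (Rd d)}

/-! ### The prediction step -/

lemma predict_apply [IsProbabilityMeasure π₀] (t : ℕ) [IsFiniteMeasure (μ t)] (y : ℕ → S)
    {B : Set (Rd d)} (hB : MeasurableSet B) :
    predict Θ f μ π₀ t y B = ∫⁻ θ, μ t {u | u + θ ∈ B} ∂(post Θ f μ π₀ y t) := by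
  rw [predict, Measure.conv, Measure.map_apply (by fun_prop) hB,
    Measure.prod_apply_symm ((by fun_prop : Measurable fun x : Rd d × Rd d => x.1 + x.2) hB)]
  rfl

/-- To be far away after the prediction step, either the point or the noise is. -/
lemma predict_compl_ball_le [IsProbabilityMeasure π₀] (t : ℕ) [IsFiniteMeasure (μ t)]
    (y : ℕ → S) (ε : ℝ) :
    predict Θ f μ π₀ t y (ball θs (2 * ε))ᶜ ≤
      μ t univ * post Θ f μ π₀ y t (ball θs ε)ᶜ + μ t (ball 0 ε)ᶜ := by
  have hm : MeasurableSet (ball θs ε)ᶜ := measurableSet_ball.compl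
  rw [predict_apply t y measurableSet_ball.compl]
  calc _ ≤ ∫⁻ θ, (μ t univ * (ball θs ε)ᶜ.indicator 1 θ + μ t (ball 0 ε)ᶜ)
        ∂(post Θ f μ π₀ y t) := by
        refine lintegral_mono fun θ => ?_
        by_cases hθ : θ ∈ (ball θs ε)ᶜ
        · rw [indicator_of_mem hθ]
          simp only [Pi.one_apply, mul_one]
          exact (measure_mono (subset_univ _)).trans le_self_add
        · rw [indicator_of_notMem hθ, mul_zero, zero_add]
          refine measure_mono fun u hu hu' => hu ?_
          rw [notMem_compl_iff, mem_ball_iff_norm] at hθ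
          rw [mem_ball_zero_iff] at hu'
          rw [mem_ball_iff_norm]
          calc ‖u + θ - θs‖ = ‖u + (θ - θs)‖ := by congr 1; abel
            _ ≤ ‖u‖ + ‖θ - θs‖ := norm_add_le _ _
            _ < 2 * ε := by linarith
    _ = μ t univ * post Θ f μ π₀ y t (ball θs ε)ᶜ +
        μ t (ball 0 ε)ᶜ * post Θ f μ π₀ y t univ := by
        rw [lintegral_add_right _ measurable_const, lintegral_const_mul _
          (measurable_one.indicator hm), lintegral_indicator_one hm, lintegral_const]
    _ ≤ μ t univ * post Θ f μ π₀ y t (ball θs ε)ᶜ + μ t (ball 0 ε)ᶜ * 1 := by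
        gcongr
        exact post_univ_le_one y t
    _ = _ := by rw [mul_one]

lemma mul_post_le_predict [IsProbabilityMeasure π₀] (t : ℕ) [IsFiniteMeasure (μ t)]
    (y : ℕ → S) {A B : Set (Rd d)} (hA : MeasurableSet A) (hB : MeasurableSet B) {a : ℝ≥0∞}
    (h : ∀ θ ∈ A, a ≤ μ t {u | u + θ ∈ B}) :
    a * post Θ f μ π₀ y t A ≤ predict Θ f μ π₀ t y B := by
  rw [predict_apply t y hB, ← setLIntegral_const]
  exact (setLIntegral_mono' hA h).trans (setLIntegral_le_lintegral _ _)

lemma setOf_add_mem_ball (θ x : Rd d) (r : ℝ) : {u | u + θ ∈ ball x r} = ball (x - θ) r := by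
  ext u
  simp only [mem_ofPred_eq, mem_ball_iff_norm]
  rw [show u + θ - x = u - (x - θ) by abel]

/-! ### Bounds of the weighted path measures -/

lemma measurableSet_exit (r : ℝ) (n : ℕ) :
    MeasurableSet {ξ : ℕ → Rd d | ∃ j < n, r ≤ ‖walk ξ j‖} := by
  have : {ξ : ℕ → Rd d | ∃ j < n, r ≤ ‖walk ξ j‖} =
      ⋃ j ∈ Finset.range n, {ξ | r ≤ ‖walk ξ j‖} := by
    ext ξ; simp
  rw [this]
  exact Finset.measurableSet_biUnion _ fun j _ =>
    measurableSet_le measurable_const (measurable_walk j).norm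

lemma measurableSet_stay {U : Set (Rd d)} (hU : MeasurableSet U) (n : ℕ) :
    MeasurableSet {p : PathSpace d | ∀ j < n, pos p j ∈ U} := by
  have : {p : PathSpace d | ∀ j < n, pos p j ∈ U} =
      ⋂ j ∈ Finset.range n, {p | pos p j ∈ U} := by
    ext ξ; simp
  rw [this]
  exact Finset.measurableSet_biInter _ fun j _ => measurable_pos j hU

/-- Lower bound of the normalising constant: the paths started in a ball contained in `Θ` and close
to the target, with small increments, have a likelihood ratio bounded below. -/
lemma le_weighted_univ [∀ t, IsFiniteMeasure (μ t)] [IsProbabilityMeasure π₀] (g : ℕ → Measure (Rd d))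
    [∀ i, IsProbabilityMeasure (g i)] {y : ℕ → S} (t₀ n : ℕ) {r s : ℝ} {x : Rd d}
    (hball : ball x s ⊆ Θ ∩ ball θs r) {m : S → ℝ}
    (hm : ∀ j < n, ∀ θ ∈ Θ ∩ ball θs r, ENNReal.ofReal (Real.exp (-(r * |m (y (t₀ + j))|))) ≤
      relLik Θ f θs θ (y (t₀ + j)))
    (hQ : Measure.infinitePi g {ξ | ∃ j < n, s / 2 ≤ ‖walk ξ j‖} ≤ 1 / 2) :
    predict Θ f μ π₀ t₀ y (ball x (s / 2)) * ENNReal.ofReal (1 / 2 *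
        Real.exp (-(r * ∑ j ∈ Finset.range n, |m (y (t₀ + j))|))) ≤
      weighted Θ f θs (fun _ => 1) (pathLaw Θ f μ π₀ g t₀ y) y t₀ n univ := by
  set Q := Measure.infinitePi g with hQdef
  set E : Set (ℕ → Rd d) := {ξ | ∃ j < n, s / 2 ≤ ‖walk ξ j‖} with hE
  have hEm : MeasurableSet E := measurableSet_exit _ _
  set D : Set (PathSpace d) := ball x (s / 2) ×ˢ Eᶜ with hD
  have hDm : MeasurableSet D := measurableSet_ball.prod hEm.compl
  have hQE : ENNReal.ofReal (1 / 2) ≤ Q Eᶜ := by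
    rw [prob_compl_eq_one_sub hEm]
    calc ENNReal.ofReal (1 / 2) = 1 - 1 / 2 := by
          rw [one_div, one_div, ENNReal.one_sub_inv_two, ENNReal.ofReal_inv_of_pos two_pos]
          simp
      _ ≤ 1 - Q E := by gcongr
  have hpt : ∀ p ∈ D, ENNReal.ofReal (Real.exp (-(r * ∑ j ∈ Finset.range n, |m (y (t₀ + j))|))) ≤
      ∏ j ∈ Finset.range n, (relLik Θ f θs (pos p j) (y (t₀ + j)) * 1) := by
    rintro p ⟨hp1, hp2⟩
    rw [Finset.mul_sum, ← Finset.sum_neg_distrib, Real.exp_sum,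
      ENNReal.ofReal_prod_of_nonneg fun _ _ => (Real.exp_pos _).le]
    refine Finset.prod_le_prod' fun j hj => ?_
    rw [mul_one]
    refine hm j (Finset.mem_range.1 hj) _ (hball ?_)
    have h1 : ‖walk p.2 j‖ < s / 2 := by
      by_contra hcon
      exact hp2 ⟨j, Finset.mem_range.1 hj, not_lt.1 hcon⟩
    rw [mem_ball_iff_norm] at hp1 ⊢
    calc ‖pos p j - x‖ = ‖(p.1 - x) + walk p.2 j‖ := by rw [pos]; congr 1; abel
      _ ≤ ‖p.1 - x‖ + ‖walk p.2 j‖ := norm_add_le _ _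
      _ < s := by linarith
  calc _ = ENNReal.ofReal (Real.exp (-(r * ∑ j ∈ Finset.range n, |m (y (t₀ + j))|))) *
        (predict Θ f μ π₀ t₀ y (ball x (s / 2)) * ENNReal.ofReal (1 / 2)) := by
        rw [ENNReal.ofReal_mul (by norm_num)]; ring
    _ ≤ ENNReal.ofReal (Real.exp (-(r * ∑ j ∈ Finset.range n, |m (y (t₀ + j))|))) *
        pathLaw Θ f μ π₀ g t₀ y D := by
        rw [pathLaw, hD, Measure.prod_prod]
        gcongr
    _ ≤ weighted Θ f θs (fun _ => 1) (pathLaw Θ f μ π₀ g t₀ y) y t₀ n D := by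
        rw [weighted, withDensity_apply _ hDm, ← setLIntegral_const]
        exact setLIntegral_mono' hDm hpt
    _ ≤ _ := measure_mono (subset_univ _)

variable [MeasurableSpace S]

/-- Upper bound of the unnormalised mass of the paths ending far away from the target: either such
a path moves by a non-negligible amount, or it remains in one of the dominated cells. -/
lemma weighted_far_le (hΘ : MeasurableSet Θ)
    (hf : Measurable fun q : Θ × S => f q.1 q.2) (hs : θs ∈ Θ) {ι : Type} [Fintype ι]
    (U : ι → Set (Rd d)) (G : ι → S → ℝ) (G₁ : S → ℝ) {ε r₀ r : ℝ} (hr₀ : 2 * r ≤ r₀)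
    (hrε : 4 * r ≤ ε)
    (hcov : ∀ T : Set (Rd d), T ⊆ (ball θs (ε / 2))ᶜ → (∀ x ∈ T, ∀ y ∈ T, dist x y < r₀) →
      ∃ i, T ⊆ U i)
    (M : Measure (PathSpace d)) (y : ℕ → S) (t₀ k : ℕ) :
    weighted Θ f θs (fun _ => 1) M y t₀ (k + 1) {p | pos p k ∈ (ball θs ε)ᶜ} ≤
      ∑ i, ENNReal.ofReal (Real.exp (∑ j ∈ Finset.range (k + 1), G i (y (t₀ + j)))) *
          weighted Θ f θs (fun s => ENNReal.ofReal (Real.exp (-G i s))) M y t₀ (k + 1)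
            ({p | p.1 ∈ (ball θs (ε / 2))ᶜ} ∩ {p | ∀ j < k + 1, pos p j ∈ U i}) +
        ENNReal.ofReal (Real.exp (∑ j ∈ Finset.range (k + 1), G₁ (y (t₀ + j)))) *
          weighted Θ f θs (fun s => ENNReal.ofReal (Real.exp (-G₁ s))) M y t₀ (k + 1)
            {p | ∃ j < k + 1, r ≤ ‖walk p.2 j‖} := by
  have hG : ∀ (G : S → ℝ) (D : Set (PathSpace d)),
      ENNReal.ofReal (Real.exp (∑ j ∈ Finset.range (k + 1), G (y (t₀ + j)))) *
        weighted Θ f θs (fun s => ENNReal.ofReal (Real.exp (-G s))) M y t₀ (k + 1) D =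
      weighted Θ f θs (fun _ => 1) M y t₀ (k + 1) D := fun G D => by
    rw [weighted_one_eq hΘ hf hs G, Measure.smul_apply, smul_eq_mul]
  simp_rw [hG]
  set M' := weighted Θ f θs (fun _ => 1) M y t₀ (k + 1)
  have hsub : {p : PathSpace d | pos p k ∈ (ball θs ε)ᶜ} ⊆
      (⋃ i ∈ (Finset.univ : Finset ι),
        ({p | p.1 ∈ (ball θs (ε / 2))ᶜ} ∩ {p | ∀ j < k + 1, pos p j ∈ U i})) ∪
      {p | ∃ j < k + 1, r ≤ ‖walk p.2 j‖} := by
    intro p hp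
    by_cases hexit : ∃ j < k + 1, r ≤ ‖walk p.2 j‖
    · exact Or.inr hexit
    left
    push Not at hexit
    have hp' : ε ≤ ‖pos p k - θs‖ := by
      simpa [mem_ball_iff_norm, dist_eq_norm] using hp
    have hdiff : ∀ i < k + 1, ∀ j < k + 1, ‖pos p i - pos p j‖ < 2 * r := by
      intro i hi j hj
      calc ‖pos p i - pos p j‖ = ‖walk p.2 i - walk p.2 j‖ := by
            rw [pos, pos]; congr 1; abel
        _ ≤ ‖walk p.2 i‖ + ‖walk p.2 j‖ := norm_sub_le _ _
        _ < 2 * r := by linarith [hexit i hi, hexit j hj]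
    have hfar : ∀ j < k + 1, pos p j ∈ (ball θs (ε / 2))ᶜ := by
      intro j hj hmem
      rw [mem_ball_iff_norm] at hmem
      have h1 := hdiff k (by omega) j hj
      have h2 : ‖pos p k - θs‖ ≤ ‖pos p k - pos p j‖ + ‖pos p j - θs‖ := by
        have := norm_add_le (pos p k - pos p j) (pos p j - θs)
        rwa [sub_add_sub_cancel] at this
      linarith
    obtain ⟨i, hi⟩ := hcov ((fun j => pos p j) '' {j | j < k + 1})
      (by rintro _ ⟨j, hj, rfl⟩; exact hfar j hj)
      (by
        rintro _ ⟨i, hi, rfl⟩ _ ⟨j, hj, rfl⟩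
        rw [dist_eq_norm]
        exact (hdiff i hi j hj).trans_le hr₀)
    refine mem_iUnion₂.2 ⟨i, Finset.mem_univ i, ?_, fun j hj => hi ⟨j, hj, rfl⟩⟩
    have := hfar 0 (by omega)
    rwa [pos_zero] at this
  calc M' _ ≤ M' _ := measure_mono hsub
    _ ≤ _ := measure_union_le _ _
    _ ≤ _ := by
        gcongr
        exact measure_biUnion_finset_le _ _

end Bounds

/-! ### Concentration over a block of Gaussian moves -/

section Block

variable {d : ℕ} {S : Type*} [MeasurableSpace S] {Θ : Set (Rd d)} {f : Rd d → S → ℝ≥0}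
  {θs : Rd d} {ρ : Measure S}

/-- Close to the target the likelihood ratio is bounded below by an exponential whose rate is
proportional to the distance. -/
lemma exists_likelihood_floor [IsProbabilityMeasure ρ] (hs : θs ∈ Θ)
    (hA1 : LocallyLipschitz ρ Θ f θs) :
    ∃ δ > (0 : ℝ), ∃ m : S → ℝ, Measurable m ∧ Integrable m ρ ∧ ∀ᵐ s ∂ρ, ∀ r ≤ δ,
      ∀ θ ∈ Θ ∩ ball θs r, ENNReal.ofReal (Real.exp (-(r * |m s|))) ≤ relLik Θ f θs θ s := by
  obtain ⟨δ, hδ, m, hm, hm2, hL⟩ := hA1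
  refine ⟨δ, hδ, m, hm, ?_, ?_⟩
  · exact ((memLp_two_iff_integrable_sq hm.aestronglyMeasurable).2 hm2).integrable one_le_two
  · filter_upwards [hL] with s hs' r hr θ hθ
    obtain ⟨h1, h2, h3⟩ := hs' θ ⟨ball_subset_ball hr hθ.2, hθ.1⟩ θs ⟨mem_ball_self hδ, hs⟩
    have h1' : (0 : ℝ) < f θ s := by exact_mod_cast h1
    have h2' : (0 : ℝ) < f θs s := by exact_mod_cast h2
    have h4 : ‖θ - θs‖ ≤ r := (mem_ball_iff_norm.1 hθ.2).le
    have h5 : m s * ‖θ - θs‖ ≤ r * |m s| := by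
      rw [mul_comm]
      calc ‖θ - θs‖ * m s ≤ ‖θ - θs‖ * |m s| := by gcongr; exact le_abs_self _
        _ ≤ r * |m s| := by gcongr
    have h6 : -(r * |m s|) ≤ Real.log (f θ s / f θs s) := by
      have := neg_abs_le (Real.log (f θ s / f θs s))
      linarith
    have h7 := Real.exp_le_exp.2 h6
    rw [Real.exp_log (by positivity)] at h7
    have h8 := ENNReal.ofReal_le_ofReal h7
    rw [ENNReal.ofReal_div_of_pos h2'] at h8
    rw [relLik, extend_of_mem hθ.1]
    simpa using h8

lemma exists_gap {ι : Type} [Fintype ι] (a : ι → ℝ) (ha : ∀ i, a i < 0) :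
    ∃ δ > (0 : ℝ), ∀ i, a i < -δ := by
  cases isEmpty_or_nonempty ι
  · exact ⟨1, one_pos, fun i => isEmptyElim i⟩
  · obtain ⟨i₀, hi₀⟩ := Finite.exists_max a
    exact ⟨-(a i₀) / 2, by linarith [ha i₀], fun i => by linarith [ha i₀, hi₀ i]⟩

variable {Ω : Type*} [MeasurableSpace Ω] {P : Measure Ω} [IsProbabilityMeasure P]
  {Y : ℕ → Ω → S} {μ : ℕ → Measure (Rd d)} {π₀ : Measure (Rd d)}

/-- Concentration after `k + 1` observations when only small moves occur after the first prediction.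
On the event `H` about `π̃_{t₀}`, the prediction gives mass at most `V` to the far region and at
least `a` to a fixed ball inside `Θ` near the target; `b` bounds the probability of a large move.
The mass of the far region is then of order `(V / a) e^{-7 δ₀ (k + 1) / 8}`, up to the
contribution of the large moves.

Here `N` is the number of dominated cells covering the far region, `δ₀` the rate at which the
likelihood decreases in them, `g₁` a rate of growth of the likelihood valid in the whole space, and
`η` bounds the probability that the averages of the data are far from their means. The levels `M`
and `M'` are those at which Markov's inequality is applied to the weighted mass of the cells and to
that of the large moves. -/
lemma block_estimate [IsProbabilityMeasure ρ] (hYm : ∀ n, Measurable (Y n)) (hYi : iIndepFun Y P)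
    (hYd : ∀ n, P.map (Y n) = ρ) (hΘ : MeasurableSet Θ)
    (hf : Measurable fun q : Θ × S => f q.1 q.2) (ht : IsTarget ρ Θ f θs)
    (hball : InteriorBalls Θ θs) (hA1 : LocallyLipschitz ρ Θ f θs)
    (hA4 : Localizable ρ Θ f θs) (hA5 : UpperControl ρ Θ f θs)
    [∀ t, IsFiniteMeasure (μ t)] [IsProbabilityMeasure π₀] {cμ : ℝ}
    (hcμ : ∀ t, μ t univ ≤ ENNReal.ofReal cμ) {ε : ℝ} (hε : 0 < ε) :
    ∃ (N : ℕ) (δ₀ r g₁ s : ℝ) (x : Rd d), 0 < δ₀ ∧ 0 < r ∧ 0 ≤ g₁ ∧ 0 < s ∧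
      ball x s ⊆ Θ ∩ ball θs 1 ∧ ∀ η : ℝ≥0∞, 0 < η → ∃ k₀ : ℕ, ∀ k ≥ k₀, ∀ (t₀ : ℕ)
        (g : ℕ → Measure (Rd d)) [∀ i, IsProbabilityMeasure (g i)],
        (∀ i < k, μ (t₀ + 1 + i) = g i) →
        Measure.infinitePi g {ξ | ∃ j < k + 1, s / 2 ≤ ‖walk ξ j‖} ≤ 1 / 2 →
        ∀ b : ℝ≥0∞, Measure.infinitePi g {ξ | ∃ j < k + 1, r ≤ ‖walk ξ j‖} ≤ b →
        ∀ H : Set (Measure (Rd d)), MeasurableSet H →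
        ∀ V a M M' : ℝ, 0 < V → 0 < a → 0 < M → 0 < M' →
        (∀ y, post Θ f μ π₀ y t₀ ∈ H →
          predict Θ f μ π₀ t₀ y (ball θs (ε / 2))ᶜ ≤ ENNReal.ofReal V) →
        (∀ y, post Θ f μ π₀ y t₀ ∈ H →
          ENNReal.ofReal a ≤ predict Θ f μ π₀ t₀ y (ball x (s / 2))) →
        P {ω | post Θ f μ π₀ (fun i => Y i ω) t₀ ∈ H ∧
          ENNReal.ofReal ((N * (M * V * Real.exp (-(δ₀ * (k + 1 : ℕ)))) +
            Real.exp (g₁ * (k + 1 : ℕ)) * M') /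
              (a * (1 / 2 * Real.exp (-(δ₀ / 8 * (k + 1 : ℕ)))))) <
            post Θ f μ π₀ (fun i => Y i ω) (t₀ + (k + 1)) (ball θs ε)ᶜ} ≤
          (N + 2) * η + (N * ENNReal.ofReal (1 / M) + ENNReal.ofReal (cμ / M') * b) := by
  have hs := ht.mem
  obtain ⟨hpos, -, -⟩ := target_pos_integrable hf ht
  obtain ⟨ι, _, U, G, hU, hD, hneg, r₀, hr₀, hcov⟩ :=
    exists_dominated_cover hΘ hf ht hA4 (half_pos hε)
  obtain ⟨G₁, hG₁⟩ := exists_dominated_univ hf ht hA5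
  obtain ⟨δ₀, hδ₀, hgap⟩ := exists_gap (fun i => ∫ y, G i y ∂ρ) hneg
  obtain ⟨δ, hδ, m, hm, hmi, hfloor⟩ := exists_likelihood_floor hs hA1
  obtain ⟨κ, hκ, r₁, hr₁, hκball⟩ := hball
  set mbar : ℝ := ∫ y, |m y| ∂ρ + 1 with hmbar
  have hmbar0 : 0 < mbar := by
    have : 0 ≤ ∫ y, |m y| ∂ρ := integral_nonneg fun y => abs_nonneg _
    linarith
  set g₁ : ℝ := |∫ y, G₁ y ∂ρ| + 1 with hg₁
  -- the radius of the ball in which the normalising constant is bounded below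
  set rl : ℝ := min (min δ (r₁ / 2)) (min 1 (δ₀ / 8 / mbar)) with hrl
  have hrl0 : 0 < rl := by positivity
  have hrl1 : rl ≤ 1 := (min_le_right _ _).trans (min_le_left _ _)
  have hrlδ : rl ≤ δ := (min_le_left _ _).trans (min_le_left _ _)
  have hrlr : rl < r₁ := by
    have : rl ≤ r₁ / 2 := (min_le_left _ _).trans (min_le_right _ _)
    linarith
  have hrlm : rl * mbar ≤ δ₀ / 8 := by
    have : rl ≤ δ₀ / 8 / mbar := (min_le_right _ _).trans (min_le_right _ _)
    calc rl * mbar ≤ δ₀ / 8 / mbar * mbar := by gcongr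
      _ = δ₀ / 8 := by field_simp
  obtain ⟨x, hx⟩ := hκball θs ⟨hs, mem_ball_self hr₁⟩ rl hrl0 hrlr
  set r : ℝ := min (r₀ / 2) (ε / 4) with hr
  refine ⟨Fintype.card ι, δ₀, r, g₁, κ * rl, x, hδ₀, by positivity, by positivity, by positivity,
    hx.trans (inter_subset_inter_right _ (ball_subset_ball hrl1)), fun η hη => ?_⟩
  choose kG hkG using fun i => exists_forall_window_sum_le hYm hYi hYd (hD i).measurable
    (hD i).integrable (hgap i) hη
  obtain ⟨k₁, hk₁⟩ := exists_forall_window_sum_le hYm hYi hYd hG₁.measurable hG₁.integrable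
    (a := g₁) (by rw [hg₁]; linarith [le_abs_self (∫ y, G₁ y ∂ρ)]) hη
  obtain ⟨k₂, hk₂⟩ := exists_forall_window_sum_le hYm hYi hYd
    (continuous_abs.measurable.comp hm) hmi.abs (a := mbar)
    (by rw [hmbar]; simp only [Function.comp_apply]; linarith) hη
  refine ⟨max (Finset.univ.sup kG) (max k₁ k₂), fun k hk t₀ g _ hg hQs b hQb H hH V a M M' hV ha hM
    hM' hHV hHa => ?_⟩
  have hkGk : ∀ i, kG i ≤ k + 1 := fun i =>
    ((Finset.le_sup (Finset.mem_univ i)).trans ((le_max_left _ _).trans hk)).trans (by omega)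
  have hk₁k : k₁ ≤ k + 1 := (((le_max_left _ _).trans (le_max_right _ _)).trans hk).trans (by omega)
  have hk₂k : k₂ ≤ k + 1 :=
    (((le_max_right _ _).trans (le_max_right _ _)).trans hk).trans (by omega)
  set n := k + 1 with hn
  set Q := Measure.infinitePi g with hQ
  set y : Ω → ℕ → S := fun ω i => Y i ω with hy
  set v : Measure (Rd d) → ℝ≥0∞ := H.indicator 1 with hv
  have hvm : Measurable v := measurable_one.indicator hH
  set stay : ι → Set (PathSpace d) := fun i =>
    {p | p.1 ∈ (ball θs (ε / 2))ᶜ} ∩ {p | ∀ j < n, pos p j ∈ U i} with hstay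
  set exit : Set (PathSpace d) := {p | ∃ j < n, r ≤ ‖walk p.2 j‖} with hexit
  have hstaym : ∀ i, MeasurableSet (stay i) := fun i =>
    (measurable_fst measurableSet_ball.compl).inter (measurableSet_stay (hU i) n)
  have hexitm : MeasurableSet exit := measurable_snd (measurableSet_exit r n)
  set A : ι → Ω → ℝ≥0∞ := fun i ω =>
    v (post Θ f μ π₀ (y ω) t₀) * weighted Θ f θs (fun s => ENNReal.ofReal (Real.exp (-G i s)))
      (pathLaw Θ f μ π₀ g t₀ (y ω)) (y ω) t₀ n (stay i) with hA
  set A₁ : Ω → ℝ≥0∞ := fun ω =>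
    v (post Θ f μ π₀ (y ω) t₀) * weighted Θ f θs (fun s => ENNReal.ofReal (Real.exp (-G₁ s)))
      (pathLaw Θ f μ π₀ g t₀ (y ω)) (y ω) t₀ n exit with hA₁
  -- `A i` and `A₁` are the masses weighted by `R e^{-G}`: their expectations are at most the
  -- unweighted masses, and they differ from the masses of interest by the factor `e^{∑ G}`
  have hAE : ∀ i, Measurable (A i) ∧ ∫⁻ ω, A i ω ∂P ≤ ENNReal.ofReal V := fun i => by
    obtain ⟨h1, h2⟩ := lintegral_weighted_le (π₀ := π₀) (μ := μ) hYm hYi hYd hΘ hf hs g (hD i)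
      t₀ n (hstaym i) (fun p hp j hj => hp.2 j hj) hvm
    refine ⟨h1, h2.trans ?_⟩
    calc _ ≤ ∫⁻ _, ENNReal.ofReal V ∂P := by
          refine lintegral_mono fun ω => ?_
          by_cases hω : post Θ f μ π₀ (fun i => Y i ω) t₀ ∈ H
          · simp only [hv, indicator_of_mem hω, Pi.one_apply, one_mul]
            have hsub : stay i ⊆ (ball θs (ε / 2))ᶜ ×ˢ univ := fun p hp => ⟨hp.1, mem_univ _⟩
            refine (measure_mono hsub).trans ?_
            rw [pathLaw, Measure.prod_prod, measure_univ, mul_one]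
            exact hHV _ hω
          · simp [hv, hω]
      _ = ENNReal.ofReal V := by simp
  have hA₁E : Measurable A₁ ∧ ∫⁻ ω, A₁ ω ∂P ≤ ENNReal.ofReal cμ * b := by
    obtain ⟨h1, h2⟩ := lintegral_weighted_le (π₀ := π₀) (μ := μ) hYm hYi hYd hΘ hf hs g hG₁
      t₀ n hexitm (fun p hp j hj => mem_univ _) hvm
    refine ⟨h1, h2.trans ?_⟩
    calc _ ≤ ∫⁻ _, ENNReal.ofReal cμ * b ∂P := by
          refine lintegral_mono fun ω => ?_
          have h3 : v (post Θ f μ π₀ (fun i => Y i ω) t₀) ≤ 1 :=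
            indicator_le_self' (fun _ _ => zero_le) _
          have hsub : exit = univ ×ˢ {ξ | ∃ j < n, r ≤ ‖walk ξ j‖} := by
            ext p; simp [hexit]
          calc _ ≤ 1 * pathLaw Θ f μ π₀ g t₀ (fun i => Y i ω) exit := by gcongr
            _ = pathLaw Θ f μ π₀ g t₀ (fun i => Y i ω) exit := one_mul _
            _ ≤ _ := by
                rw [pathLaw, hsub, Measure.prod_prod]
                gcongr
                exact (predict_univ_le t₀ _).trans (hcμ t₀)
      _ = _ := by simp
  -- the exceptional events
  have hP1 : ∀ i, P {ω | -δ₀ * (n : ℕ) < ∑ j ∈ Finset.range n, G i (Y (t₀ + j) ω)} ≤ η :=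
    fun i => hkG i n (hkGk i) t₀
  have hP2 : P {ω | g₁ * (n : ℕ) < ∑ j ∈ Finset.range n, G₁ (Y (t₀ + j) ω)} ≤ η := hk₁ n hk₁k t₀
  have hP3 : P {ω | mbar * (n : ℕ) < ∑ j ∈ Finset.range n, |m (Y (t₀ + j) ω)|} ≤ η :=
    hk₂ n hk₂k t₀
  have hP4 : ∀ i, P {ω | ENNReal.ofReal (M * V) ≤ A i ω} ≤ ENNReal.ofReal (1 / M) := fun i => by
    refine (meas_ge_le_lintegral_div (hAE i).1.aemeasurable (by simp; positivity)
      ENNReal.ofReal_ne_top).trans ?_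
    calc _ ≤ ENNReal.ofReal V / ENNReal.ofReal (M * V) := by gcongr; exact (hAE i).2
      _ = ENNReal.ofReal (1 / M) := by
          rw [← ENNReal.ofReal_div_of_pos (by positivity)]
          congr 1; field_simp
  have hP5 : P {ω | ENNReal.ofReal M' ≤ A₁ ω} ≤ ENNReal.ofReal (cμ / M') * b := by
    refine (meas_ge_le_lintegral_div hA₁E.1.aemeasurable (by simpa using hM')
      ENNReal.ofReal_ne_top).trans ?_
    calc _ ≤ ENNReal.ofReal cμ * b / ENNReal.ofReal M' := by gcongr; exact hA₁E.2
      _ = _ := by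
          rw [ENNReal.ofReal_div_of_pos hM', ENNReal.mul_div_right_comm]
  have hfl : ∀ᵐ ω ∂P, ∀ j, ∀ r ≤ δ, ∀ θ ∈ Θ ∩ ball θs r,
      ENNReal.ofReal (Real.exp (-(r * |m (Y j ω)|))) ≤ relLik Θ f θs θ (Y j ω) :=
    ae_all_iff.2 fun j => ae_of_ae_map (hYm j).aemeasurable (by rw [hYd]; exact hfloor)
  have hps : ∀ᵐ ω ∂P, ∀ j, f θs (Y j ω) ≠ 0 :=
    ae_all_iff.2 fun j => ae_of_ae_map (hYm j).aemeasurable (by rw [hYd]; exact hpos)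
  set null : Set Ω := {ω | ¬ ((∀ j, ∀ r ≤ δ, ∀ θ ∈ Θ ∩ ball θs r,
      ENNReal.ofReal (Real.exp (-(r * |m (Y j ω)|))) ≤ relLik Θ f θs θ (Y j ω)) ∧
      ∀ j, f θs (Y j ω) ≠ 0)} with hnull
  have hnull0 : P null = 0 := ae_iff.1 (hfl.and hps)
  have hsub : {ω | post Θ f μ π₀ (fun i => Y i ω) t₀ ∈ H ∧
          ENNReal.ofReal ((Fintype.card ι * (M * V * Real.exp (-(δ₀ * n))) +
            Real.exp (g₁ * n) * M') / (a * (1 / 2 * Real.exp (-(δ₀ / 8 * n))))) <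
            post Θ f μ π₀ (fun i => Y i ω) (t₀ + n) (ball θs ε)ᶜ} ⊆
      null ∪ ((⋃ i ∈ (Finset.univ : Finset ι),
          {ω | -δ₀ * (n : ℕ) < ∑ j ∈ Finset.range n, G i (Y (t₀ + j) ω)}) ∪
        {ω | g₁ * (n : ℕ) < ∑ j ∈ Finset.range n, G₁ (Y (t₀ + j) ω)} ∪
        {ω | mbar * (n : ℕ) < ∑ j ∈ Finset.range n, |m (Y (t₀ + j) ω)|}) ∪
        ((⋃ i ∈ (Finset.univ : Finset ι), {ω | ENNReal.ofReal (M * V) ≤ A i ω}) ∪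
        {ω | ENNReal.ofReal M' ≤ A₁ ω}) := by
    rintro ω ⟨hωH, hωlt⟩
    by_contra hcon
    simp only [mem_union, mem_iUnion, Finset.mem_univ, mem_ofPred_eq, exists_prop, true_and,
      not_or, not_exists, not_lt, not_le, hnull, not_not] at hcon
    obtain ⟨⟨⟨hflω, hposω⟩, ⟨h1, h2⟩, h3⟩, h4, h5⟩ := hcon
    refine hωlt.not_ge ?_
    have hvω : v (post Θ f μ π₀ (fun i => Y i ω) t₀) = 1 := by
      simp only [hv, indicator_of_mem hωH, Pi.one_apply]
    -- outside the exceptional events, the mass of the far region is the quotient of a numerator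
    -- bounded by `weighted_far_le` and a denominator bounded by `le_weighted_univ`
    have hup := weighted_far_le hΘ hf hs U G G₁ (ε := ε) (r₀ := r₀) (r := r)
      (by have := min_le_left (r₀ / 2) (ε / 4); linarith)
      (by have := min_le_right (r₀ / 2) (ε / 4); linarith) hcov
      (pathLaw Θ f μ π₀ g t₀ (y ω)) (y ω) t₀ k
    have hlow := le_weighted_univ (μ := μ) (π₀ := π₀) g (y := y ω) t₀ n hx (m := m)
      (fun j _ θ hθ => hflω (t₀ + j) rl hrlδ θ hθ) hQs
    have hpm := post_mul_weighted_univ_le (π₀ := π₀) hΘ hf hs g (y := y ω) hposω t₀ k hg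
      (measurableSet_ball (x := θs) (ε := ε)).compl
    have hnum : weighted Θ f θs (fun _ => 1) (pathLaw Θ f μ π₀ g t₀ (y ω)) (y ω) t₀ (k + 1)
        {p | pos p k ∈ (ball θs ε)ᶜ} ≤ ENNReal.ofReal
          (Fintype.card ι * (M * V * Real.exp (-(δ₀ * n))) + Real.exp (g₁ * n) * M') := by
      refine hup.trans ?_
      rw [ENNReal.ofReal_add (by positivity) (by positivity), ENNReal.ofReal_mul (by positivity)
        (p := (Fintype.card ι : ℝ)), ENNReal.ofReal_natCast,
        ENNReal.ofReal_mul (Real.exp_pos _).le]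
      refine add_le_add ?_ ?_
      · calc _ ≤ ∑ _i : ι, ENNReal.ofReal (M * V * Real.exp (-(δ₀ * n))) := by
              refine Finset.sum_le_sum fun i _ => ?_
              rw [ENNReal.ofReal_mul (by positivity), mul_comm]
              refine mul_le_mul' ?_ (ENNReal.ofReal_le_ofReal (Real.exp_le_exp.2 ?_))
              · have := (h4 i).le
                simp only [hA, hy, hvω, one_mul] at this
                exact this
              · have := h1 i
                simp only [hy]
                linarith
          _ = _ := by simp [Finset.sum_const]
      · refine mul_le_mul' (ENNReal.ofReal_le_ofReal (Real.exp_le_exp.2 h2)) ?_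
        have := h5.le
        simp only [hA₁, hy, hvω, one_mul] at this
        exact this
    have hden : ENNReal.ofReal (a * (1 / 2 * Real.exp (-(δ₀ / 8 * n)))) ≤
        weighted Θ f θs (fun _ => 1) (pathLaw Θ f μ π₀ g t₀ (y ω)) (y ω) t₀ n univ := by
      refine le_trans ?_ hlow
      rw [ENNReal.ofReal_mul ha.le]
      refine mul_le_mul' (hHa _ hωH) (ENNReal.ofReal_le_ofReal ?_)
      have hle : rl * ∑ j ∈ Finset.range n, |m (y ω (t₀ + j))| ≤ δ₀ / 8 * n :=
        calc _ ≤ rl * (mbar * n) := mul_le_mul_of_nonneg_left h3 hrl0.le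
          _ = rl * mbar * n := by ring
          _ ≤ δ₀ / 8 * n := by gcongr
      exact mul_le_mul_of_nonneg_left (Real.exp_le_exp.2 (neg_le_neg hle)) (by norm_num)
    rw [ENNReal.ofReal_div_of_pos (by positivity), ENNReal.le_div_iff_mul_le
      (Or.inl (by simp; positivity)) (Or.inl ENNReal.ofReal_ne_top)]
    calc _ ≤ post Θ f μ π₀ (y ω) (t₀ + n) (ball θs ε)ᶜ *
          weighted Θ f θs (fun _ => 1) (pathLaw Θ f μ π₀ g t₀ (y ω)) (y ω) t₀ n univ := by
          gcongr
      _ ≤ _ := hpm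
      _ ≤ _ := hnum
  have hU1 : P (⋃ i ∈ (Finset.univ : Finset ι),
      {ω | -δ₀ * (n : ℕ) < ∑ j ∈ Finset.range n, G i (Y (t₀ + j) ω)}) ≤ Fintype.card ι * η := by
    refine (measure_biUnion_finset_le _ _).trans ((Finset.sum_le_sum fun i _ => hP1 i).trans ?_)
    simp
  have hU2 : P (⋃ i ∈ (Finset.univ : Finset ι), {ω | ENNReal.ofReal (M * V) ≤ A i ω}) ≤
      Fintype.card ι * ENNReal.ofReal (1 / M) := by
    refine (measure_biUnion_finset_le _ _).trans ((Finset.sum_le_sum fun i _ => hP4 i).trans ?_)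
    simp
  calc _ ≤ _ := measure_mono hsub
    _ ≤ (0 + ((Fintype.card ι * η + η) + η)) +
        (Fintype.card ι * ENNReal.ofReal (1 / M) + ENNReal.ofReal (cμ / M') * b) := by
        refine (measure_union_le _ _).trans (add_le_add ((measure_union_le _ _).trans
          (add_le_add hnull0.le ((measure_union_le _ _).trans (add_le_add
            ((measure_union_le _ _).trans (add_le_add hU1 hP2)) hP3)))) ?_)
        exact (measure_union_le _ _).trans (add_le_add hU2 hP5)
    _ = _ := by ring

end Block

/-! ### One step of the sequence -/

section Step

variable {d : ℕ} {S : Type*} [MeasurableSpace S] {Θ : Set (Rd d)} {f : Rd d → S → ℝ≥0}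
  {θs : Rd d} {ρ : Measure S} {μ : ℕ → Measure (Rd d)} {π₀ : Measure (Rd d)}

lemma weighted_single (hΘ : MeasurableSet Θ)
    (hf : Measurable fun q : Θ × S => f q.1 q.2) (hs : θs ∈ Θ)
    [∀ t, IsFiniteMeasure (μ t)] [IsProbabilityMeasure π₀] (g : ℕ → Measure (Rd d))
    [∀ i, IsProbabilityMeasure (g i)] (w : S → ℝ≥0∞) (y : ℕ → S) (t : ℕ) :
    weighted Θ f θs w (pathLaw Θ f μ π₀ g t y) y t 1 univ =
      (∫⁻ θ, relLik Θ f θs θ (y t) ∂(predict Θ f μ π₀ t y)) * w (y t) := by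
  have hm := measurable_relLik_left hΘ hf hs (y t)
  rw [weighted, withDensity_apply _ MeasurableSet.univ, Measure.restrict_univ, pathLaw,
    lintegral_prod _ (by
      refine Measurable.aemeasurable (Finset.measurable_prod _ fun j _ => ?_)
      exact ((measurable_relLik_left hΘ hf hs _).comp (measurable_pos j)).mul measurable_const),
    ← lintegral_mul_const _ hm]
  refine lintegral_congr fun θ => ?_
  simp [pos, walk]

variable {Ω : Type*} [MeasurableSpace Ω] {P : Measure Ω} [IsProbabilityMeasure P]
  {Y : ℕ → Ω → S}

/-- Almost surely all the `π̃_t` are probability measures on `Θ`: the normalising constants are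
finite, since the likelihood ratio has a bounded expectation once divided by the exponential of a
function of the observation. -/
lemma ae_post_univ [IsProbabilityMeasure ρ] (hYm : ∀ n, Measurable (Y n)) (hYi : iIndepFun Y P)
    (hYd : ∀ n, P.map (Y n) = ρ) (hΘ : MeasurableSet Θ)
    (hf : Measurable fun q : Θ × S => f q.1 q.2) (ht : IsTarget ρ Θ f θs)
    (hA5 : UpperControl ρ Θ f θs)
    [∀ t, IsFiniteMeasure (μ t)] [IsProbabilityMeasure π₀] (hπΘ : π₀ Θᶜ = 0)
    (hZ : ∀ t, ∀ᵐ ω ∂P,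
      normConst Θ f ((μ t).conv (post Θ f μ π₀ (fun n => Y n ω) t)) (Y t ω) ≠ 0) :
    ∀ᵐ ω ∂P, ∀ t, post Θ f μ π₀ (fun n => Y n ω) t univ = 1 ∧
      post Θ f μ π₀ (fun n => Y n ω) t Θᶜ = 0 := by
  have hs := ht.mem
  obtain ⟨hpos, -, -⟩ := target_pos_integrable hf ht
  obtain ⟨G₁, hG₁⟩ := exists_dominated_univ hf ht hA5
  have hps : ∀ᵐ ω ∂P, ∀ j, f θs (Y j ω) ≠ 0 :=
    ae_all_iff.2 fun j => ae_of_ae_map (hYm j).aemeasurable (by rw [hYd]; exact hpos)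
  have hfin : ∀ᵐ ω ∂P, ∀ t, weighted Θ f θs (fun s => ENNReal.ofReal (Real.exp (-G₁ s)))
      (pathLaw Θ f μ π₀ (fun _ => Measure.dirac 0) t fun i => Y i ω) (fun i => Y i ω) t 1 univ
        < ⊤ := by
    refine ae_all_iff.2 fun t => ?_
    obtain ⟨h1, h2⟩ := lintegral_weighted_le (π₀ := π₀) (μ := μ) hYm hYi hYd hΘ hf hs
      (fun _ => Measure.dirac 0) hG₁ t 1 MeasurableSet.univ (fun p _ j _ => mem_univ _)
      (measurable_const (a := (1 : ℝ≥0∞)))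
    simp only [one_mul] at h1 h2
    refine ae_lt_top h1 (h2.trans_lt ?_).ne
    calc _ ≤ ∫⁻ _, μ t univ ∂P := by
          refine lintegral_mono fun ω => ?_
          rw [pathLaw, ← univ_prod_univ, Measure.prod_prod,
            measure_univ (μ := Measure.infinitePi _), mul_one]
          exact predict_univ_le t _
      _ = μ t univ := by simp
      _ < ⊤ := measure_lt_top _ _
  filter_upwards [hps, hfin, ae_all_iff.2 hZ] with ω h1 h2 h3 t
  cases t with
  | zero => exact ⟨by simp [post], hπΘ⟩
  | succ t =>
    have hm : Measurable fun θ => extend Θ f θ (Y t ω) :=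
      (measurable_extend hΘ hf).comp measurable_prodMk_right
    have hne : (f θs (Y t ω) : ℝ≥0∞) ≠ 0 := by simpa using h1 t
    have htop : normConst Θ f (predict Θ f μ π₀ t fun n => Y n ω) (Y t ω) ≠ ⊤ := by
      have h4 := h2 t
      rw [weighted_single hΘ hf hs] at h4
      have h5 : ∫⁻ θ, relLik Θ f θs θ (Y t ω) ∂(predict Θ f μ π₀ t fun n => Y n ω) ≠ ⊤ :=
        fun h => by
          rw [h, ENNReal.top_mul (by simp [Real.exp_pos])] at h4
          exact lt_irrefl _ h4
      have h6 : normConst Θ f (predict Θ f μ π₀ t fun n => Y n ω) (Y t ω) = f θs (Y t ω) *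
          ∫⁻ θ, relLik Θ f θs θ (Y t ω) ∂(predict Θ f μ π₀ t fun n => Y n ω) := by
        rw [normConst, ← lintegral_const_mul' _ _ ENNReal.coe_ne_top]
        refine lintegral_congr fun θ => ?_
        rw [relLik, mul_comm, ENNReal.div_mul_cancel hne ENNReal.coe_ne_top]
      rw [h6]
      exact ENNReal.mul_ne_top ENNReal.coe_ne_top h5
    change bayes Θ f (predict Θ f μ π₀ t fun n => Y n ω) (Y t ω) univ = 1 ∧
      bayes Θ f (predict Θ f μ π₀ t fun n => Y n ω) (Y t ω) Θᶜ = 0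
    constructor
    · rw [bayes, Measure.smul_apply, withDensity_apply _ MeasurableSet.univ,
        Measure.restrict_univ, smul_eq_mul]
      exact ENNReal.inv_mul_cancel (h3 t) htop
    · rw [bayes, Measure.smul_apply, withDensity_apply _ hΘ.compl, smul_eq_mul,
        setLIntegral_congr_fun hΘ.compl (g := fun _ => 0) fun θ hθ => extend_of_notMem hθ _]
      simp

omit [IsProbabilityMeasure P] in
/-- The law of the observations being the same at all times, a function of one observation is
bounded in probability. -/
lemma exists_forall_measure_lt_le (hYm : ∀ n, Measurable (Y n)) (hYd : ∀ n, P.map (Y n) = ρ)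
    {G : S → ℝ} (hGm : Measurable G) (hGi : Integrable G ρ) {η : ℝ} (hη : 0 < η) :
    ∃ K : ℝ, ∀ t, P {ω | K < G (Y t ω)} ≤ ENNReal.ofReal η := by
  have hI : 0 ≤ ∫ s, |G s| ∂ρ := integral_nonneg fun s => abs_nonneg _
  refine ⟨((∫ s, |G s| ∂ρ) + 1) / η, fun t => ?_⟩
  have hms : MeasurableSet {s | ((∫ s, |G s| ∂ρ) + 1) / η < G s} :=
    measurableSet_lt measurable_const hGm
  change P ((Y t) ⁻¹' {s | ((∫ s, |G s| ∂ρ) + 1) / η < G s}) ≤ _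
  rw [← Measure.map_apply (hYm t) hms, hYd]
  have hK : 0 < ((∫ s, |G s| ∂ρ) + 1) / η := by positivity
  calc ρ {s | ((∫ s, |G s| ∂ρ) + 1) / η < G s}
      ≤ ρ {s | ENNReal.ofReal (((∫ s, |G s| ∂ρ) + 1) / η) ≤ ENNReal.ofReal |G s|} :=
        measure_mono fun s hs => ENNReal.ofReal_le_ofReal
          ((le_of_lt hs).trans (le_abs_self (G s)))
    _ ≤ (∫⁻ s, ENNReal.ofReal |G s| ∂ρ) / ENNReal.ofReal (((∫ s, |G s| ∂ρ) + 1) / η) :=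
        meas_ge_le_lintegral_div hGm.abs.ennreal_ofReal.aemeasurable (by simpa using hK)
          ENNReal.ofReal_ne_top
    _ = ENNReal.ofReal ((∫ s, |G s| ∂ρ) / (((∫ s, |G s| ∂ρ) + 1) / η)) := by
        rw [← ofReal_integral_eq_lintegral_ofReal hGi.abs (ae_of_all _ fun s => abs_nonneg _),
          ENNReal.ofReal_div_of_pos hK]
    _ ≤ ENNReal.ofReal η := by
        refine ENNReal.ofReal_le_ofReal ?_
        rw [div_le_iff₀ hK, mul_div_cancel₀ _ hη.ne']
        linarith

/-- Concentration is preserved by one step, up to a change of the constants. -/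
lemma exists_step [IsProbabilityMeasure ρ] (hYm : ∀ n, Measurable (Y n)) (hYi : iIndepFun Y P)
    (hYd : ∀ n, P.map (Y n) = ρ) (hΘ : MeasurableSet Θ)
    (hf : Measurable fun q : Θ × S => f q.1 q.2) (ht : IsTarget ρ Θ f θs)
    (hA1 : LocallyLipschitz ρ Θ f θs) (hA5 : UpperControl ρ Θ f θs)
    [∀ t, IsFiniteMeasure (μ t)] [IsProbabilityMeasure π₀]
    (hprob : ∀ᵐ ω ∂P, ∀ t, post Θ f μ π₀ (fun n => Y n ω) t univ = 1 ∧
      post Θ f μ π₀ (fun n => Y n ω) t Θᶜ = 0) {cμ : ℝ} (hcμ0 : 0 < cμ)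
    (hcμ : ∀ t, μ t univ ≤ ENNReal.ofReal cμ)
    (hnoise : ∀ ε > 0, Tendsto (fun t => μ t (ball 0 ε)ᶜ) atTop (𝓝 0))
    (hland : ∃ c > (0 : ℝ), ∃ r₁ > (0 : ℝ), ∀ r, 0 < r → r ≤ r₁ → ∀ᶠ t in atTop,
      ∀ θ ∈ Θ ∩ ball θs r, ENNReal.ofReal c ≤ μ t {u | u + θ ∈ Θ ∩ ball θs (2 * r)})
    {ε η : ℝ} (hε : 0 < ε) (hη : 0 < η) :
    ∃ ε' > 0, ∃ η' > 0, ∀ᶠ t in atTop,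
      P {ω | ENNReal.ofReal η' < post Θ f μ π₀ (fun n => Y n ω) t (ball θs ε')ᶜ} ≤
        ENNReal.ofReal η' →
      P {ω | ENNReal.ofReal η < post Θ f μ π₀ (fun n => Y n ω) (t + 1) (ball θs ε)ᶜ} ≤
        ENNReal.ofReal η := by
  have hs := ht.mem
  obtain ⟨hpos, -, -⟩ := target_pos_integrable hf ht
  obtain ⟨G₁, hG₁⟩ := exists_dominated_univ hf ht hA5
  obtain ⟨δ, hδ, m, hm, hmi, hfloor⟩ := exists_likelihood_floor hs hA1
  obtain ⟨c, hc, r₁, hr₁, hland⟩ := hland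
  set r : ℝ := min (δ / 2) r₁ with hr
  have hr0 : 0 < r := by positivity
  have h2r : 2 * r ≤ δ := by have := min_le_left (δ / 2) r₁; linarith
  obtain ⟨K, hK⟩ := exists_forall_measure_lt_le (P := P) (G := fun s => G₁ s + 2 * r * |m s|)
    hYm hYd (hG₁.measurable.add (hm.abs.const_mul _))
    (hG₁.integrable.add (hmi.abs.const_mul _)) (η := η / 4) (by positivity)
  -- `η'` makes the quotient of the bounds of the numerator and of the denominator at most `η`
  set ε' : ℝ := min (ε / 2) r with hε'
  set B : ℝ := 8 * Real.exp K * (cμ + 1) / (c * η) with hB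
  have hB0 : 0 < B := by positivity
  set η' : ℝ := min (min (1 / 2) (η / 4)) (η / B) with hη'
  have hη'0 : 0 < η' := by positivity
  have hη'1 : η' ≤ 1 / 2 := (min_le_left _ _).trans (min_le_left _ _)
  have hη'2 : η' ≤ η / 4 := (min_le_left _ _).trans (min_le_right _ _)
  have hη'3 : B * η' ≤ η := by
    calc B * η' ≤ B * (η / B) := by gcongr; exact min_le_right _ _
      _ = η := mul_div_cancel₀ _ hB0.ne'
  refine ⟨ε', by positivity, η', hη'0, ?_⟩
  -- the path with a single position: its increments are irrelevant and are taken to vanish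
  filter_upwards [hland r hr0 (min_le_right _ _),
    (ENNReal.tendsto_nhds_zero.1 (hnoise (ε / 2) (by positivity))) (ENNReal.ofReal η')
      (by simpa using hη'0)] with t hlt hnt hPt
  set y : Ω → ℕ → S := fun ω i => Y i ω with hy
  set H : Set (Measure (Rd d)) := {M | M (ball θs ε')ᶜ ≤ ENNReal.ofReal η'} with hH
  have hHm : MeasurableSet H := measurableSet_le
    (Measure.measurable_coe measurableSet_ball.compl) measurable_const
  set v : Measure (Rd d) → ℝ≥0∞ := H.indicator 1 with hv
  have hvm : Measurable v := measurable_one.indicator hHm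
  set g : ℕ → Measure (Rd d) := fun _ => Measure.dirac 0 with hg
  set D : Set (PathSpace d) := {p | p.1 ∈ (ball θs ε)ᶜ} with hD
  have hDm : MeasurableSet D := measurable_fst measurableSet_ball.compl
  set A : Ω → ℝ≥0∞ := fun ω =>
    v (post Θ f μ π₀ (y ω) t) * weighted Θ f θs (fun s => ENNReal.ofReal (Real.exp (-G₁ s)))
      (pathLaw Θ f μ π₀ g t (y ω)) (y ω) t 1 D with hA
  obtain ⟨hAm, hAE⟩ := lintegral_weighted_le (π₀ := π₀) (μ := μ) hYm hYi hYd hΘ hf hs g hG₁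
      t 1 hDm (fun p _ j _ => mem_univ _) hvm
  have hAE' : ∫⁻ ω, A ω ∂P ≤ ENNReal.ofReal ((cμ + 1) * η') := by
    refine hAE.trans ?_
    calc _ ≤ ∫⁻ _, ENNReal.ofReal ((cμ + 1) * η') ∂P := by
          refine lintegral_mono fun ω => ?_
          by_cases hω : post Θ f μ π₀ (fun i => Y i ω) t ∈ H
          · simp only [hv, indicator_of_mem hω, Pi.one_apply, one_mul]
            have hsub : D ⊆ (ball θs (2 * (ε / 2)))ᶜ ×ˢ univ := fun p hp =>
              ⟨by rw [mul_div_cancel₀ _ (two_ne_zero' ℝ)]; exact hp, mem_univ _⟩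
            refine (measure_mono hsub).trans ?_
            rw [pathLaw, Measure.prod_prod, measure_univ, mul_one]
            refine (predict_compl_ball_le t _ _).trans ?_
            rw [add_mul, one_mul, ENNReal.ofReal_add (by positivity) hη'0.le,
              ENNReal.ofReal_mul hcμ0.le]
            gcongr
            · exact hcμ t
            · exact (measure_mono (compl_subset_compl.2
                (ball_subset_ball (min_le_left _ _)))).trans hω
          · simp [hv, hω]
      _ = _ := by simp
  have hP1 : P {ω | ENNReal.ofReal (4 / η * ((cμ + 1) * η')) ≤ A ω} ≤
      ENNReal.ofReal (η / 4) := by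
    refine (meas_ge_le_lintegral_div hAm.aemeasurable (by simp; positivity)
      ENNReal.ofReal_ne_top).trans ?_
    calc _ ≤ ENNReal.ofReal ((cμ + 1) * η') / ENNReal.ofReal (4 / η * ((cμ + 1) * η')) := by
          gcongr
      _ = ENNReal.ofReal (η / 4) := by
          rw [← ENNReal.ofReal_div_of_pos (by positivity)]
          congr 1; field_simp
  have hfl : ∀ᵐ ω ∂P, ∀ j, ∀ r ≤ δ, ∀ θ ∈ Θ ∩ ball θs r,
      ENNReal.ofReal (Real.exp (-(r * |m (Y j ω)|))) ≤ relLik Θ f θs θ (Y j ω) :=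
    ae_all_iff.2 fun j => ae_of_ae_map (hYm j).aemeasurable (by rw [hYd]; exact hfloor)
  have hps : ∀ᵐ ω ∂P, ∀ j, f θs (Y j ω) ≠ 0 :=
    ae_all_iff.2 fun j => ae_of_ae_map (hYm j).aemeasurable (by rw [hYd]; exact hpos)
  have hgood : ∀ᵐ ω ∂P, (ω ∈ {ω | ENNReal.ofReal η <
        post Θ f μ π₀ (fun n => Y n ω) (t + 1) (ball θs ε)ᶜ} →
      ω ∈ {ω | ENNReal.ofReal η' < post Θ f μ π₀ (fun n => Y n ω) t (ball θs ε')ᶜ} ∪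
        ({ω | K < G₁ (Y t ω) + 2 * r * |m (Y t ω)|} ∪
        {ω | ENNReal.ofReal (4 / η * ((cμ + 1) * η')) ≤ A ω})) := by
    filter_upwards [hfl, hps, hprob] with ω hflω hposω hprobω hωlt
    by_contra hcon
    simp only [mem_union, mem_ofPred_eq, not_or, not_lt, not_le] at hcon
    obtain ⟨h1, h2, h3⟩ := hcon
    refine (not_le.2 hωlt) ?_
    have hvω : v (post Θ f μ π₀ (y ω) t) = 1 := by
      have : post Θ f μ π₀ (y ω) t ∈ H := h1
      simp only [hv, indicator_of_mem this, Pi.one_apply]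
    have hnear : ENNReal.ofReal (1 / 2) ≤ post Θ f μ π₀ (y ω) t (Θ ∩ ball θs r) := by
      have h4 : post Θ f μ π₀ (y ω) t (Θ ∩ ball θs r)ᶜ ≤ ENNReal.ofReal (1 / 2) := by
        rw [compl_inter]
        calc _ ≤ post Θ f μ π₀ (y ω) t Θᶜ + post Θ f μ π₀ (y ω) t (ball θs r)ᶜ :=
              measure_union_le _ _
          _ ≤ 0 + post Θ f μ π₀ (y ω) t (ball θs ε')ᶜ := by
              rw [(hprobω t).2]
              gcongr
              exact min_le_right _ _
          _ ≤ ENNReal.ofReal (1 / 2) := by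
              rw [zero_add]
              exact h1.trans (ENNReal.ofReal_le_ofReal hη'1)
      have h5 : (1 : ℝ≥0∞) ≤ post Θ f μ π₀ (y ω) t (Θ ∩ ball θs r) + ENNReal.ofReal (1 / 2) := by
        rw [← (hprobω t).1, ← union_compl_self (Θ ∩ ball θs r)]
        exact (measure_union_le _ _).trans (by gcongr)
      have h6 : (1 : ℝ≥0∞) = ENNReal.ofReal (1 / 2) + ENNReal.ofReal (1 / 2) := by
        rw [← ENNReal.ofReal_add (by norm_num) (by norm_num)]; norm_num
      rw [h6] at h5
      exact (ENNReal.add_le_add_iff_right ENNReal.ofReal_ne_top).1 h5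
    -- the mass near the target in `Θ` remains there in the prediction step
    have hpred : ENNReal.ofReal (c / 2) ≤ predict Θ f μ π₀ t (y ω) (Θ ∩ ball θs (2 * r)) := by
      calc ENNReal.ofReal (c / 2) = ENNReal.ofReal c * ENNReal.ofReal (1 / 2) := by
            rw [← ENNReal.ofReal_mul hc.le]; congr 1; ring
        _ ≤ ENNReal.ofReal c * post Θ f μ π₀ (y ω) t (Θ ∩ ball θs r) := by gcongr
        _ ≤ _ := mul_post_le_predict t (y ω) (hΘ.inter measurableSet_ball)
            (hΘ.inter measurableSet_ball) hlt
    have hden : ENNReal.ofReal (Real.exp (-(2 * r * |m (Y t ω)|)) * (c / 2)) ≤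
        weighted Θ f θs (fun _ => 1) (pathLaw Θ f μ π₀ g t (y ω)) (y ω) t 1 univ := by
      rw [weighted_single hΘ hf hs, mul_one, ENNReal.ofReal_mul (Real.exp_pos _).le]
      calc _ ≤ ENNReal.ofReal (Real.exp (-(2 * r * |m (Y t ω)|))) *
            predict Θ f μ π₀ t (y ω) (Θ ∩ ball θs (2 * r)) := by gcongr
        _ ≤ ∫⁻ θ in Θ ∩ ball θs (2 * r), relLik Θ f θs θ (Y t ω) ∂predict Θ f μ π₀ t (y ω) := by
            rw [← setLIntegral_const]
            exact setLIntegral_mono' (hΘ.inter measurableSet_ball)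
              fun θ hθ => hflω t (2 * r) h2r θ hθ
        _ ≤ _ := setLIntegral_le_lintegral _ _
    have hpm := post_mul_weighted_univ_le (π₀ := π₀) (μ := μ) hΘ hf hs g (y := y ω) hposω t 0
      (fun i hi => absurd hi (Nat.not_lt_zero i)) (measurableSet_ball (x := θs) (ε := ε)).compl
    have hnum : weighted Θ f θs (fun _ => 1) (pathLaw Θ f μ π₀ g t (y ω)) (y ω) t (0 + 1)
        {p | pos p 0 ∈ (ball θs ε)ᶜ} ≤
        ENNReal.ofReal (Real.exp (G₁ (Y t ω)) * (4 / η * ((cμ + 1) * η'))) := by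
      simp only [pos_zero]
      rw [weighted_one_eq hΘ hf hs G₁, Measure.smul_apply, smul_eq_mul,
        ENNReal.ofReal_mul (Real.exp_pos _).le]
      simp only [zero_add, Finset.range_one, Finset.sum_singleton, add_zero]
      have := h3.le
      simp only [hA, hvω, one_mul] at this
      gcongr
    have hratio : Real.exp (G₁ (Y t ω)) * (4 / η * ((cμ + 1) * η')) ≤
        η * (Real.exp (-(2 * r * |m (Y t ω)|)) * (c / 2)) := by
      have e1 : Real.exp (G₁ (Y t ω)) ≤
          Real.exp K * Real.exp (-(2 * r * |m (Y t ω)|)) := by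
        rw [← Real.exp_add]
        exact Real.exp_le_exp.2 (by linarith)
      calc _ ≤ (Real.exp K * Real.exp (-(2 * r * |m (Y t ω)|))) * (4 / η * ((cμ + 1) * η')) := by
            gcongr
        _ = (B * η') * (Real.exp (-(2 * r * |m (Y t ω)|)) * (c / 2)) := by
            rw [hB]; field_simp; ring
        _ ≤ _ := by gcongr
    have hE : 0 < Real.exp (-(2 * r * |m (Y t ω)|)) * (c / 2) := by positivity
    refine (ENNReal.mul_le_mul_iff_left (c := ENNReal.ofReal
      (Real.exp (-(2 * r * |m (Y t ω)|)) * (c / 2))) (by simpa using hE)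
      ENNReal.ofReal_ne_top).1 ?_
    rw [← ENNReal.ofReal_mul hη.le]
    calc _ ≤ post Θ f μ π₀ (y ω) (t + 1) (ball θs ε)ᶜ *
          weighted Θ f θs (fun _ => 1) (pathLaw Θ f μ π₀ g t (y ω)) (y ω) t 1 univ := by gcongr
      _ ≤ _ := hpm
      _ ≤ _ := hnum.trans (ENNReal.ofReal_le_ofReal hratio)
  calc _ ≤ _ := measure_mono_ae hgood
    _ ≤ ENNReal.ofReal η' + (ENNReal.ofReal (η / 4) + ENNReal.ofReal (η / 4)) :=
        (measure_union_le _ _).trans (add_le_add hPt ((measure_union_le _ _).trans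
          (add_le_add (hK t) hP1)))
    _ ≤ ENNReal.ofReal η := by
        rw [← ENNReal.ofReal_add (by positivity) (by positivity),
          ← ENNReal.ofReal_add (by positivity) (by positivity)]
        exact ENNReal.ofReal_le_ofReal (by linarith)

end Step

/-! ### Lengths of the blocks and sizes of the noise -/

section Schedule

variable {h : ℕ → ℝ} {τ : ℕ → ℕ}

lemma cast_block (hτ : StrictMono τ) (p : ℕ) :
    ((τ (p + 1) - τ p : ℕ) : ℝ) = (τ (p + 1) : ℝ) - τ p :=
  Nat.cast_sub (hτ (Nat.lt_succ_self p)).le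

lemma notMem_range_of_mem_block (hτ : StrictMono τ) {p s : ℕ} (h1 : τ p < s)
    (h2 : s < τ (p + 1)) : s ∉ range τ := by
  rintro ⟨q, rfl⟩
  have := hτ.lt_iff_lt.1 h1
  have := hτ.lt_iff_lt.1 h2
  omega

/-- The heavy-tailed moves are not too small: their scale is subexponential in the length of the
block which follows. -/
lemma eventually_exp_le_rpow (hτ : StrictMono τ) (h1 : ∀ p, 0 < h (τ p))
    (h5 : Tendsto (fun p => Real.log (h (τ p)) / ((τ (p + 1) : ℝ) - τ p)) atTop (𝓝 0))
    {K δ : ℝ} (hK : 0 ≤ K) (hδ : 0 < δ) :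
    ∀ᶠ p in atTop, Real.exp (-(δ * (τ (p + 1) - τ p : ℕ))) ≤ h (τ p) ^ K := by
  have hlt : -(δ / (K + 1)) < 0 := by
    have : 0 < δ / (K + 1) := by positivity
    linarith
  filter_upwards [h5.eventually_const_lt hlt] with p hp
  rw [← cast_block hτ] at hp
  have hL : (0 : ℝ) < (τ (p + 1) - τ p : ℕ) := by
    exact_mod_cast Nat.sub_pos_of_lt (hτ (Nat.lt_succ_self p))
  rw [lt_div_iff₀ hL] at hp
  rw [Real.rpow_def_of_pos (h1 p), Real.exp_le_exp]
  have e1 : -(δ / (K + 1)) * ((τ (p + 1) - τ p : ℕ) : ℝ) * K ≤ Real.log (h (τ p)) * K := by gcongr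
  have e2 : δ / (K + 1) * K ≤ δ := by
    rw [div_mul_eq_mul_div, div_le_iff₀ (by positivity)]
    nlinarith
  nlinarith

/-- The same with the block which precedes, the lengths of two successive blocks being
comparable. -/
lemma eventually_exp_le_rpow_succ (hτ : StrictMono τ) (h1 : ∀ p, 0 < h (τ p))
    (h4 : ∃ C : ℝ, ∀ᶠ p in atTop,
      ((τ (p + 2) : ℝ) - τ (p + 1)) / ((τ (p + 1) : ℝ) - τ p) ≤ C)
    (h5 : Tendsto (fun p => Real.log (h (τ p)) / ((τ (p + 1) : ℝ) - τ p)) atTop (𝓝 0))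
    {K δ : ℝ} (hK : 0 ≤ K) (hδ : 0 < δ) :
    ∀ᶠ p in atTop, Real.exp (-(δ * (τ (p + 1) - τ p : ℕ))) ≤ h (τ (p + 1)) ^ K := by
  obtain ⟨C, hC⟩ := h4
  have hc : 0 < |C| + 1 := by positivity
  have hev := (tendsto_add_atTop_nat 1).eventually
    (eventually_exp_le_rpow hτ h1 h5 hK (div_pos hδ hc))
  filter_upwards [hC, hev] with p hp hp'
  refine le_trans (Real.exp_le_exp.2 (neg_le_neg ?_)) hp'
  rw [← cast_block hτ (p + 1), ← cast_block hτ p] at hp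
  have hL : (0 : ℝ) < (τ (p + 1) - τ p : ℕ) := by
    exact_mod_cast Nat.sub_pos_of_lt (hτ (Nat.lt_succ_self p))
  rw [div_le_iff₀ hL] at hp
  rw [div_mul_eq_mul_div, div_le_iff₀ hc, mul_assoc]
  have : C * ((τ (p + 1) - τ p : ℕ) : ℝ) ≤ (|C| + 1) * ((τ (p + 1) - τ p : ℕ) : ℝ) := by
    gcongr
    linarith [le_abs_self C]
  have h3 := hp.trans this
  rw [mul_comm (|C| + 1)] at h3
  exact mul_le_mul_of_nonneg_left h3 hδ.le

/-- The Gaussian increments of the block which follows `τ p`. -/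
noncomputable def blockStep {d : ℕ} (h : ℕ → ℝ) (τ : ℕ → ℕ)
    (Sig : ℕ → Matrix (Fin d) (Fin d) ℝ) (p i : ℕ) : Measure (Rd d) :=
  multivariateGaussian 0 (h (τ p + 1 + i) ^ 2 • Sig (τ p + 1 + i))

instance {d : ℕ} (h : ℕ → ℝ) (τ : ℕ → ℕ) (Sig : ℕ → Matrix (Fin d) (Fin d) ℝ) (p i : ℕ) :
    IsProbabilityMeasure (blockStep h τ Sig p i) := by
  unfold blockStep; infer_instance

lemma noise_eq_blockStep {d : ℕ} {ν : ℝ} {Sig : ℕ → Matrix (Fin d) (Fin d) ℝ}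
    (hτ : StrictMono τ) {p k : ℕ} (hk : k + 1 ≤ τ (p + 1) - τ p) :
    ∀ i < k, noise ν h τ Sig (τ p + 1 + i) = blockStep h τ Sig p i := fun i hi =>
  noise_of_notMem (notMem_range_of_mem_block hτ (p := p) (by omega) (by omega))

/-- A non-negligible move during a block has a probability smaller than any exponential of the
length of the block. -/
lemma eventually_walk_tail {d : ℕ} {Sig : ℕ → Matrix (Fin d) (Fin d) ℝ}
    (hτ : StrictMono τ) (hSig : ∀ t, (Sig t).PosDef) {C : ℝ} (hC : 0 < C)
    (hSigb : ∀ t, ‖Matrix.toEuclideanCLM (𝕜 := ℝ) (Sig t)‖ ≤ C)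
    (h2 : Tendsto (fun p => τ (p + 1) - τ p) atTop atTop)
    (h3 : Tendsto (fun p => ((τ (p + 1) : ℝ) - τ p) *
      ∑ s ∈ Finset.Ioo (τ p) (τ (p + 1)), h s ^ 2) atTop (𝓝 0)) {r : ℝ} (hr : 0 < r) (M : ℝ) :
    ∀ᶠ p in atTop, ∀ k, k + 1 ≤ τ (p + 1) - τ p →
      Measure.infinitePi (blockStep h τ Sig p) {ξ | ∃ j < k + 1, r ≤ ‖walk ξ j‖} ≤
        ENNReal.ofReal (Real.exp (-(M * (τ (p + 1) - τ p : ℕ)))) := by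
  have hL : Tendsto (fun p => ((τ (p + 1) - τ p : ℕ) : ℝ)) atTop atTop :=
    tendsto_natCast_atTop_atTop.comp h2
  set M' : ℝ := |M| + 2 * d + 1 with hM'
  have hM'0 : 0 < M' := by positivity
  set a : ℝ := (r / (d + 1)) ^ 2 / (2 * C) with ha
  have ha0 : 0 < a := by positivity
  -- the total variance, increased so as to be positive
  set V : ℕ → ℝ := fun p => ∑ s ∈ Finset.Ioo (τ p) (τ (p + 1)), h s ^ 2 +
    1 / ((τ (p + 1) - τ p : ℕ) : ℝ) ^ 2 with hV
  have hLV : Tendsto (fun p => ((τ (p + 1) - τ p : ℕ) : ℝ) * V p) atTop (𝓝 0) := by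
    have e := h3.add (tendsto_inv_atTop_zero.comp hL)
    rw [add_zero] at e
    refine e.congr fun p => ?_
    have hL0 : ((τ (p + 1) - τ p : ℕ) : ℝ) ≠ 0 := by
      exact_mod_cast (Nat.sub_pos_of_lt (hτ (Nat.lt_succ_self p))).ne'
    simp only [Function.comp_apply, hV, ← cast_block hτ]
    field_simp
  filter_upwards [hLV.eventually_lt_const (show 0 < a / M' by positivity)] with p hp k hk
  set L : ℕ := τ (p + 1) - τ p with hLdef
  have hL0 : 0 < (L : ℝ) := by exact_mod_cast (by omega : 0 < L)
  have hV0 : 0 < V p := by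
    have : 0 ≤ ∑ s ∈ Finset.Ioo (τ p) (τ (p + 1)), h s ^ 2 :=
      Finset.sum_nonneg fun s _ => sq_nonneg _
    simp only [hV]
    positivity
  have hsum : ∑ i ∈ Finset.range (L - 1), h (τ p + 1 + i) ^ 2 ≤ V p := by
    have e : ∑ i ∈ Finset.range (L - 1), h (τ p + 1 + i) ^ 2 =
        ∑ s ∈ Finset.Ioo (τ p) (τ (p + 1)), h s ^ 2 := by
      have : Finset.Ioo (τ p) (τ (p + 1)) = Finset.Ico (τ p + 1) (τ (p + 1)) := by
        ext; simp
      rw [this, Finset.sum_Ico_eq_sum_range]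
      congr 2
    rw [e]
    simp only [hV]
    have : 0 ≤ 1 / (L : ℝ) ^ 2 := by positivity
    linarith
  have hw := walk_tail hC (fun i => h (τ p + 1 + i)) (fun i => Sig (τ p + 1 + i))
    (fun i => hSig _) (fun i => hSigb _) L hV0 hsum hr
  calc _ ≤ Measure.infinitePi (blockStep h τ Sig p) {ξ | ∃ j < L, r ≤ ‖walk ξ j‖} :=
        by
          refine measure_mono ?_
          rintro ξ ⟨j, hj, hjr⟩
          exact ⟨j, by omega, hjr⟩
    _ ≤ _ := hw
    _ ≤ _ := by
        refine ENNReal.ofReal_le_ofReal ?_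
        have e1 : -(r / (d + 1)) ^ 2 / (2 * (C * V p)) ≤ -(M' * L) := by
          have : -(r / (d + 1)) ^ 2 / (2 * (C * V p)) = -(a / V p) := by
            rw [ha]; field_simp
          rw [this, neg_le_neg_iff, le_div_iff₀ hV0, mul_assoc]
          rw [lt_div_iff₀ hM'0] at hp
          linarith
        have e2 : 2 * d * (L : ℝ) ≤ Real.exp (2 * d * L) := by
          linarith [Real.add_one_le_exp (2 * d * (L : ℝ))]
        calc (L : ℝ) * (d * (2 * Real.exp (-(r / (d + 1)) ^ 2 / (2 * (C * V p)))))
            ≤ (L : ℝ) * (d * (2 * Real.exp (-(M' * L)))) := by gcongr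
          _ = 2 * d * L * Real.exp (-(M' * L)) := by ring
          _ ≤ Real.exp (2 * d * L) * Real.exp (-(M' * L)) := by gcongr
          _ = Real.exp (2 * d * L - M' * L) := by rw [← Real.exp_add]; ring_nf
          _ ≤ Real.exp (-(M * L)) := by
              refine Real.exp_le_exp.2 ?_
              have : -(|M| * L) ≤ -(M * L) := by
                have := mul_le_mul_of_nonneg_right (le_abs_self M) hL0.le
                linarith
              rw [hM']
              nlinarith

lemma eventually_mul_exp_le {L : ℕ → ℕ} (hL : Tendsto L atTop atTop) (A : ℝ) {δ e : ℝ}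
    (hδ : 0 < δ) (he : 0 < e) : ∀ᶠ p in atTop, A * Real.exp (-(δ * L p)) ≤ e := by
  have h1 : Tendsto (fun p => δ * (L p : ℝ)) atTop atTop :=
    (tendsto_natCast_atTop_atTop.comp hL).const_mul_atTop hδ
  have h2 := (Real.tendsto_exp_neg_atTop_nhds_zero.comp h1).const_mul A
  rw [mul_zero] at h2
  exact h2.eventually_le_const he

/-- The mass of the far region at the end of a block, when the Student move at its beginning has
to travel a polynomial distance: the factor `q` is the probability of this move. -/
lemma ratio_block_end_le {N cμ g₁ δ₀ a q n : ℝ} (hδ₀ : 0 ≤ δ₀)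
    (hn : 0 ≤ n) (ha : 0 < a) (hq : Real.exp (-(δ₀ / 8 * n)) ≤ q)
    (hB : 2 * (N * cμ + 1) / a * Real.exp (-(δ₀ / 4 * n)) ≤ 1) :
    (N * (Real.exp (δ₀ / 4 * n) * cμ * Real.exp (-(δ₀ * n))) +
        Real.exp (g₁ * n) * Real.exp (-((g₁ + δ₀) * n))) /
      (a * q * (1 / 2 * Real.exp (-(δ₀ / 8 * n)))) ≤ Real.exp (-(δ₀ / 4 * n)) := by
  set E := Real.exp (-(δ₀ / 8 * n)) with hE
  have hE0 : 0 < E := Real.exp_pos _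
  have hE1 : E ≤ 1 := Real.exp_le_one_iff.2 (by have : 0 ≤ δ₀ / 8 * n := by positivity
                                                linarith)
  have hpow : ∀ k : ℕ, E ^ k = Real.exp (-(k * (δ₀ / 8 * n))) := fun k => by
    rw [hE, ← Real.exp_nat_mul]; ring_nf
  -- all the exponentials are powers of `E`
  have e2 : Real.exp (-(δ₀ / 4 * n)) = E ^ 2 := by rw [hpow]; congr 1; push_cast; ring
  have e6 : Real.exp (δ₀ / 4 * n) * Real.exp (-(δ₀ * n)) = E ^ 6 := by
    rw [hpow, ← Real.exp_add]; congr 1; push_cast; ring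
  have e8 : Real.exp (g₁ * n) * Real.exp (-((g₁ + δ₀) * n)) = E ^ 8 := by
    rw [hpow, ← Real.exp_add]; congr 1; push_cast; ring
  have hq0 : 0 < q := hE0.trans_le hq
  rw [e2] at hB ⊢
  rw [div_mul_eq_mul_div, div_le_one ha] at hB
  rw [mul_right_comm (Real.exp (δ₀ / 4 * n)), e6, e8, div_le_iff₀ (by positivity)]
  have h8 : E ^ 8 ≤ E ^ 6 := pow_le_pow_of_le_one hE0.le hE1 (by norm_num)
  calc N * (E ^ 6 * cμ) + E ^ 8 ≤ N * (E ^ 6 * cμ) + E ^ 6 := by linarith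
    _ = (2 * (N * cμ + 1) * E ^ 2) * (E ^ 4 / 2) := by ring
    _ ≤ a * (E ^ 4 / 2) := by gcongr
    _ = E ^ 2 * (a * E * (1 / 2 * E)) := by ring
    _ ≤ E ^ 2 * (a * q * (1 / 2 * E)) := by gcongr

/-- The mass of the far region inside a block: the probability `q` that the Student move at its
beginning is not small appears in the numerator and in the denominator. -/
lemma ratio_block_le {N M V g₁ δ₀ a q n L η : ℝ}
    (hg₁ : 0 ≤ g₁) (hδ₀ : 0 ≤ δ₀) (hnL : n ≤ L) (ha : 0 < a)
    (hq : Real.exp (-(δ₀ * L)) ≤ q)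
    (hB : 2 * (N * M * V + 1) / a * Real.exp (-(7 / 8 * δ₀ * n)) ≤ η) :
    (N * (M * (V * q) * Real.exp (-(δ₀ * n))) +
        Real.exp (g₁ * n) * Real.exp (-((g₁ + 2 * δ₀) * L))) /
      (a * q * (1 / 2 * Real.exp (-(δ₀ / 8 * n)))) ≤ η := by
  have hq0 : 0 < q := (Real.exp_pos _).trans_le hq
  have e1 : Real.exp (g₁ * n) * Real.exp (-((g₁ + 2 * δ₀) * L)) ≤ Real.exp (-(δ₀ * n)) * q := by
    calc _ ≤ Real.exp (-(δ₀ * n)) * Real.exp (-(δ₀ * L)) := by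
          rw [← Real.exp_add, ← Real.exp_add]
          refine Real.exp_le_exp.2 ?_
          nlinarith
      _ ≤ _ := by gcongr
  have e2 : Real.exp (-(δ₀ * n)) =
      Real.exp (-(7 / 8 * δ₀ * n)) * Real.exp (-(δ₀ / 8 * n)) := by
    rw [← Real.exp_add]; congr 1; ring
  rw [div_mul_eq_mul_div, div_le_iff₀ ha] at hB
  rw [div_le_iff₀ (by positivity)]
  calc _ ≤ N * (M * (V * q) * Real.exp (-(δ₀ * n))) + Real.exp (-(δ₀ * n)) * q := by gcongr
    _ = (2 * (N * M * V + 1) * Real.exp (-(7 / 8 * δ₀ * n))) *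
        (q * (1 / 2 * Real.exp (-(δ₀ / 8 * n)))) := by rw [e2]; ring
    _ ≤ (η * a) * (q * (1 / 2 * Real.exp (-(δ₀ / 8 * n)))) := by gcongr
    _ = _ := by ring

end Schedule

/-! ### From one block to the next -/

section Blocks

lemma exists_ofReal_le {e : ℝ≥0∞} (he : 0 < e) : ∃ x : ℝ, 0 < x ∧ ENNReal.ofReal x ≤ e := by
  obtain ⟨x, hx0, hx⟩ := ENNReal.lt_iff_exists_nnreal_btwn.1 he
  exact ⟨x, by exact_mod_cast hx0, by rw [ENNReal.ofReal_coe_nnreal]; exact hx.le⟩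

variable {d : ℕ} {S : Type*} [MeasurableSpace S] {Θ : Set (Rd d)} {f : Rd d → S → ℝ≥0}
  {θs : Rd d} {ρ : Measure S} {π₀ : Measure (Rd d)}
  {Ω : Type*} [MeasurableSpace Ω] {P : Measure Ω} [IsProbabilityMeasure P] {Y : ℕ → Ω → S}
  {ν : ℝ} {h : ℕ → ℝ} {τ : ℕ → ℕ} {Sig : ℕ → Matrix (Fin d) (Fin d) ℝ} {C : ℝ}

/-- Concentration at the end of the blocks. By tightness a non-negligible part of the mass is
initially within a distance polynomial in `1 / h_{t_p}` of the target. The Student move sends it close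
to the target with a probability polynomial in `h_{t_p}`, hence subexponential in the length of the
block, and the observations made during the block reveal the target at an exponential rate. -/
lemma exists_tendsto_block_end [IsProbabilityMeasure ρ] (hYm : ∀ n, Measurable (Y n))
    (hYi : iIndepFun Y P) (hYd : ∀ n, P.map (Y n) = ρ) (hΘ : MeasurableSet Θ)
    (hf : Measurable fun q : Θ × S => f q.1 q.2) (ht : IsTarget ρ Θ f θs)
    (hball : InteriorBalls Θ θs) (hA1 : LocallyLipschitz ρ Θ f θs)
    (hA4 : Localizable ρ Θ f θs) (hA5 : UpperControl ρ Θ f θs) (hν : 0 < ν)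
    (hh0 : Tendsto h atTop (𝓝 0)) (hτ : StrictMono τ) (hSig : ∀ t, (Sig t).PosDef) (hC : 0 < C)
    (hSigb : ∀ t, ‖Matrix.toEuclideanCLM (𝕜 := ℝ) (Sig t)‖ ≤ C ∧
      ‖Matrix.toEuclideanCLM (𝕜 := ℝ) (Sig t)⁻¹‖ ≤ C)
    [∀ t, IsFiniteMeasure (noise ν h τ Sig t)] [IsProbabilityMeasure π₀] {cμ : ℝ} (hcμ1 : 1 ≤ cμ)
    (hcμ : ∀ t, noise ν h τ Sig t univ ≤ ENNReal.ofReal cμ)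
    (hprob : ∀ᵐ ω ∂P, ∀ t, post Θ f (noise ν h τ Sig) π₀ (fun n => Y n ω) t univ = 1 ∧
      post Θ f (noise ν h τ Sig) π₀ (fun n => Y n ω) t Θᶜ = 0)
    (h1 : ∀ p, 0 < h (τ p)) (h2 : Tendsto (fun p => τ (p + 1) - τ p) atTop atTop)
    (h3 : Tendsto (fun p => ((τ (p + 1) : ℝ) - τ p) *
      ∑ s ∈ Finset.Ioo (τ p) (τ (p + 1)), h s ^ 2) atTop (𝓝 0))
    (h5 : Tendsto (fun p => Real.log (h (τ p)) / ((τ (p + 1) : ℝ) - τ p)) atTop (𝓝 0))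
    (htight : ∃ β c : ℝ, 1 < β ∧ 1 < c ∧
      Tendsto (fun p => P {ω | ENNReal.ofReal β⁻¹ ≤
        post Θ f (noise ν h τ Sig) π₀ (fun n => Y n ω) (τ p) (farSet Θ θs (c / h (τ p) ^ β))})
        atTop (𝓝 0))
    {ε : ℝ} (hε : 0 < ε) :
    ∃ δ > (0 : ℝ), Tendsto (fun p => P {ω | ENNReal.ofReal
        (Real.exp (-(δ * (τ (p + 1) - τ p : ℕ)))) <
          post Θ f (noise ν h τ Sig) π₀ (fun n => Y n ω) (τ (p + 1)) (ball θs ε)ᶜ})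
        atTop (𝓝 0) := by
  obtain ⟨β, c, hβ, hc, htight⟩ := htight
  obtain ⟨N, δ₀, r, g₁, s, x, hδ₀, hr, hg₁, hs, hxs, H⟩ := block_estimate (π₀ := π₀)
    (μ := noise ν h τ Sig) hYm hYi hYd hΘ hf ht hball hA1 hA4 hA5 hcμ hε
  have hcμ0 : 0 < cμ := one_pos.trans_le hcμ1
  have hβ0 : 0 < β := one_pos.trans hβ
  set K : ℝ := ν + β * (ν + d) with hK
  have hK0 : 0 ≤ K := by positivity
  obtain ⟨a₀, ha₀, hland⟩ := le_student_noise_ball_far (h := h) hν τ hSig hC hSigb (β := β)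
    (M := s / 2 + 1 + c) (r := s / 2) hβ0.le (by positivity)
  set a₁ : ℝ := 1 - β⁻¹ with ha₁
  have ha₁0 : 0 < a₁ := by
    have := inv_lt_one_of_one_lt₀ hβ
    simp only [ha₁]; linarith
  refine ⟨δ₀ / 4, by positivity, ENNReal.tendsto_nhds_zero.2 fun e he => ?_⟩
  obtain ⟨e', he'0, he'⟩ := exists_ofReal_le he
  obtain ⟨k₀, hk₀⟩ := H (ENNReal.ofReal (e' / (4 * (N + 2)))) (by simp; positivity)
  filter_upwards [eventually_walk_tail (h := h) hτ hSig hC (fun t => (hSigb t).1) h2 h3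
      (show 0 < s / 2 by positivity) 1,
    eventually_walk_tail (h := h) hτ hSig hC (fun t => (hSigb t).1) h2 h3 hr (g₁ + δ₀ + 1),
    eventually_exp_le_rpow hτ h1 h5 hK0 (show 0 < δ₀ / 8 by positivity),
    hτ.tendsto_atTop.eventually (hh0.eventually_le_const one_pos),
    h2.eventually_ge_atTop (k₀ + 1),
    ENNReal.tendsto_nhds_zero.1 htight (ENNReal.ofReal (e' / 4)) (by simp; positivity),
    eventually_mul_exp_le h2 (N : ℝ) (show 0 < δ₀ / 4 by positivity)
      (show 0 < e' / 4 by positivity),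
    eventually_mul_exp_le h2 cμ one_pos (show 0 < e' / 4 by positivity),
    eventually_mul_exp_le h2 (2 * (N * cμ + 1) / (a₀ * a₁)) (show 0 < δ₀ / 4 by positivity)
      one_pos] with p htail1 htail2 hq hh1 hLk htp hn1 hn2 hn3
  obtain ⟨k, hk⟩ : ∃ k, τ (p + 1) - τ p = k + 1 := ⟨τ (p + 1) - τ p - 1, by omega⟩
  have hτk : τ (p + 1) = τ p + (k + 1) := by omega
  have hle : k + 1 ≤ τ (p + 1) - τ p := hk.ge
  have ht1 := htail1 k hle
  have ht2 := htail2 k hle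
  rw [hk] at hq hn1 hn2 hn3 ht1 ht2 ⊢
  set R : ℝ := c / h (τ p) ^ β with hR
  set Hs : Set (Measure (Rd d)) := {m | ENNReal.ofReal a₁ ≤ m (ball θs R)} with hHs
  have hHm : MeasurableSet Hs :=
    measurableSet_le measurable_const (Measure.measurable_coe measurableSet_ball)
  have hq0 : 0 < h (τ p) ^ K := Real.rpow_pos_of_pos (h1 p) _
  set n : ℝ := ((k + 1 : ℕ) : ℝ) with hn
  have hn1' : 1 ≤ n := by simp [hn]
  have hexp2 : Real.exp (-(1 * n)) ≤ 1 / 2 := by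
    have h6 : (2 : ℝ) ≤ Real.exp n := by linarith [Real.add_one_le_exp n]
    rw [one_mul, Real.exp_neg, one_div]
    exact inv_anti₀ two_pos h6
  have hhalf : ENNReal.ofReal (1 / 2) = 1 / 2 := by
    rw [one_div, one_div, ENNReal.ofReal_inv_of_pos two_pos]; simp
  -- the level `e^{δ₀ n / 4}` makes the exceptional events of the cells negligible at the cost of a
  -- part of the rate `δ₀`; the level `e^{-(g₁ + δ₀) n}` is still far above the expected mass of the
  -- large moves
  have key := hk₀ k (by omega) (τ p) (blockStep h τ Sig p) (noise_eq_blockStep hτ hle)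
    ((ht1.trans (ENNReal.ofReal_le_ofReal hexp2)).trans hhalf.le) _ ht2 Hs hHm cμ
    (a₀ * a₁ * h (τ p) ^ K) (Real.exp (δ₀ / 4 * n)) (Real.exp (-((g₁ + δ₀) * n))) hcμ0
    (by positivity) (Real.exp_pos _) (Real.exp_pos _)
    (fun y _ => (measure_mono (subset_univ _)).trans ((predict_univ_le _ _).trans (hcμ _)))
    (fun y hy => by
      have e1 : ∀ θ ∈ ball θs R, ENNReal.ofReal (a₀ * h (τ p) ^ K) ≤
          noise ν h τ Sig (τ p) {u | u + θ ∈ ball x (s / 2)} := by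
        intro θ hθ
        rw [setOf_add_mem_ball]
        refine hland (τ p) (mem_range_self p) (h1 p) hh1 _ fun z hz => ?_
        rw [mem_ball_iff_norm] at hz hθ
        rw [mem_closedBall_zero_iff]
        have hx1 : ‖x - θs‖ < 1 := mem_ball_iff_norm.1 (hxs (mem_ball_self hs)).2
        have hpw : 1 ≤ h (τ p) ^ (-β) :=
          Real.one_le_rpow_of_pos_of_le_one_of_nonpos (h1 p) hh1 (by linarith)
        have hRe : R = c * h (τ p) ^ (-β) := by
          rw [hR, Real.rpow_neg (h1 p).le, div_eq_mul_inv]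
        calc ‖z‖ = ‖(z - (x - θ)) + (x - θs) - (θ - θs)‖ := by congr 1; abel
          _ ≤ ‖z - (x - θ)‖ + ‖x - θs‖ + ‖θ - θs‖ :=
            (norm_sub_le _ _).trans (by gcongr; exact norm_add_le _ _)
          _ ≤ (s / 2 + 1) * 1 + c * h (τ p) ^ (-β) := by linarith
          _ ≤ (s / 2 + 1) * h (τ p) ^ (-β) + c * h (τ p) ^ (-β) := by gcongr
          _ = _ := by ring
      calc ENNReal.ofReal (a₀ * a₁ * h (τ p) ^ K) =
            ENNReal.ofReal (a₀ * h (τ p) ^ K) * ENNReal.ofReal a₁ := by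
            rw [← ENNReal.ofReal_mul (by positivity)]; congr 1; ring
        _ ≤ ENNReal.ofReal (a₀ * h (τ p) ^ K) *
            post Θ f (noise ν h τ Sig) π₀ y (τ p) (ball θs R) := by gcongr; exact hy
        _ ≤ _ := mul_post_le_predict _ _ measurableSet_ball measurableSet_ball e1)
  have hratio := ratio_block_end_le (N := N) (cμ := cμ) (g₁ := g₁) (δ₀ := δ₀) (a := a₀ * a₁)
    (q := h (τ p) ^ K) (n := n) hδ₀.le (by positivity) (by positivity) hq hn3
  have hsub : ∀ᵐ ω ∂P, ω ∈ {ω | ENNReal.ofReal (Real.exp (-(δ₀ / 4 * n))) <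
        post Θ f (noise ν h τ Sig) π₀ (fun n => Y n ω) (τ (p + 1)) (ball θs ε)ᶜ} →
      ω ∈ {ω | post Θ f (noise ν h τ Sig) π₀ (fun i => Y i ω) (τ p) ∈ Hs ∧
          ENNReal.ofReal ((N * (Real.exp (δ₀ / 4 * n) * cμ * Real.exp (-(δ₀ * n))) +
            Real.exp (g₁ * n) * Real.exp (-((g₁ + δ₀) * n))) /
              (a₀ * a₁ * h (τ p) ^ K * (1 / 2 * Real.exp (-(δ₀ / 8 * n))))) <
            post Θ f (noise ν h τ Sig) π₀ (fun i => Y i ω) (τ p + (k + 1)) (ball θs ε)ᶜ} ∪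
        {ω | ENNReal.ofReal β⁻¹ ≤
          post Θ f (noise ν h τ Sig) π₀ (fun n => Y n ω) (τ p) (farSet Θ θs R)} := by
    filter_upwards [hprob] with ω hω hlt
    by_cases hfar : ENNReal.ofReal β⁻¹ ≤
          post Θ f (noise ν h τ Sig) π₀ (fun n => Y n ω) (τ p) (farSet Θ θs R)
    · exact Or.inr hfar
    refine Or.inl ⟨?_, ?_⟩
    · have e1 : ENNReal.ofReal a₁ + ENNReal.ofReal β⁻¹ ≤
          post Θ f (noise ν h τ Sig) π₀ (fun n => Y n ω) (τ p) (ball θs R) +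
            ENNReal.ofReal β⁻¹ := by
        calc _ = (1 : ℝ≥0∞) := by
              rw [← ENNReal.ofReal_add ha₁0.le (by positivity), ha₁]; simp
          _ = post Θ f (noise ν h τ Sig) π₀ (fun n => Y n ω) (τ p) univ := (hω _).1.symm
          _ ≤ post Θ f (noise ν h τ Sig) π₀ (fun n => Y n ω) (τ p)
              (ball θs R ∪ (farSet Θ θs R ∪ Θᶜ)) := measure_mono fun θ _ => by
                by_cases hb : θ ∈ ball θs R
                · exact Or.inl hb
                by_cases hθ : θ ∈ Θ
                · exact Or.inr (Or.inl ⟨hθ, hb⟩)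
                · exact Or.inr (Or.inr hθ)
          _ ≤ _ := measure_union_le _ _
          _ ≤ _ := by
              gcongr
              refine (measure_union_le _ _).trans ?_
              rw [(hω _).2, add_zero]
              exact (not_le.1 hfar).le
      exact (ENNReal.add_le_add_iff_right ENNReal.ofReal_ne_top).1 e1
    · rw [← hτk]
      exact (ENNReal.ofReal_le_ofReal hratio).trans_lt hlt
  calc _ ≤ _ := measure_mono_ae hsub
    _ ≤ _ := measure_union_le _ _
    _ ≤ _ := add_le_add key htp
    _ ≤ ENNReal.ofReal e' := by
        have q1 : ((N : ℝ≥0∞) + 2) * ENNReal.ofReal (e' / (4 * (N + 2))) =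
            ENNReal.ofReal (e' / 4) := by
          have : ((N : ℝ≥0∞) + 2) = ENNReal.ofReal ((N : ℝ) + 2) := by
            rw [ENNReal.ofReal_add (by positivity) (by positivity)]; simp
          rw [this, ← ENNReal.ofReal_mul (by positivity)]
          congr 1; field_simp
        have q2 : (N : ℝ≥0∞) * ENNReal.ofReal (1 / Real.exp (δ₀ / 4 * n)) ≤
            ENNReal.ofReal (e' / 4) := by
          rw [← ENNReal.ofReal_natCast, ← ENNReal.ofReal_mul (by positivity), one_div,
            ← Real.exp_neg]
          exact ENNReal.ofReal_le_ofReal hn1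
        have q3 : ENNReal.ofReal (cμ / Real.exp (-((g₁ + δ₀) * n))) *
            ENNReal.ofReal (Real.exp (-((g₁ + δ₀ + 1) * n))) ≤ ENNReal.ofReal (e' / 4) := by
          rw [← ENNReal.ofReal_mul (by positivity)]
          refine ENNReal.ofReal_le_ofReal (le_trans (le_of_eq ?_) hn2)
          rw [div_eq_mul_inv, ← Real.exp_neg, mul_assoc, ← Real.exp_add]
          congr 2; ring
        calc _ ≤ ENNReal.ofReal (e' / 4) + (ENNReal.ofReal (e' / 4) + ENNReal.ofReal (e' / 4)) +
              ENNReal.ofReal (e' / 4) := by gcongr; exact q1.le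
          _ = ENNReal.ofReal e' := by
              rw [← ENNReal.ofReal_add (by positivity) (by positivity),
                ← ENNReal.ofReal_add (by positivity) (by positivity),
                ← ENNReal.ofReal_add (by positivity) (by positivity)]
              congr 1; ring
    _ ≤ e := he'

end Blocks

section Inside

variable {d : ℕ} {S : Type*} [MeasurableSpace S] {Θ : Set (Rd d)} {f : Rd d → S → ℝ≥0}
  {θs : Rd d} {ρ : Measure S} {π₀ : Measure (Rd d)}
  {Ω : Type*} [MeasurableSpace Ω] {P : Measure Ω} [IsProbabilityMeasure P] {Y : ℕ → Ω → S}
  {ν : ℝ} {h : ℕ → ℝ} {τ : ℕ → ℕ} {Sig : ℕ → Matrix (Fin d) (Fin d) ℝ} {C : ℝ}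

/-- Concentration inside the blocks, except at a bounded number of times after their beginning.
Once `π̃_{t_p}` is concentrated, the Student move at time `t_p` sends a mass of order `h_{t_p} ^ ν`
to the far region. A comparable mass reaches any given ball inside `Θ` near the target, so that the
posterior mass of the far region is of order one before the observations made since `t_p`, and
decreases exponentially with their number. -/
lemma exists_eventually_block [IsProbabilityMeasure ρ] (hYm : ∀ n, Measurable (Y n))
    (hYi : iIndepFun Y P) (hYd : ∀ n, P.map (Y n) = ρ) (hΘ : MeasurableSet Θ)
    (hf : Measurable fun q : Θ × S => f q.1 q.2) (ht : IsTarget ρ Θ f θs)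
    (hball : InteriorBalls Θ θs) (hA1 : LocallyLipschitz ρ Θ f θs)
    (hA4 : Localizable ρ Θ f θs) (hA5 : UpperControl ρ Θ f θs) (hν : 0 < ν)
    (hh0 : Tendsto h atTop (𝓝 0)) (hτ : StrictMono τ) (hSig : ∀ t, (Sig t).PosDef) (hC : 0 < C)
    (hSigb : ∀ t, ‖Matrix.toEuclideanCLM (𝕜 := ℝ) (Sig t)‖ ≤ C ∧
      ‖Matrix.toEuclideanCLM (𝕜 := ℝ) (Sig t)⁻¹‖ ≤ C)
    [∀ t, IsFiniteMeasure (noise ν h τ Sig t)] [IsProbabilityMeasure π₀] {cμ : ℝ} (hcμ1 : 1 ≤ cμ)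
    (hcμ : ∀ t, noise ν h τ Sig t univ ≤ ENNReal.ofReal cμ)
    (hprob : ∀ᵐ ω ∂P, ∀ t, post Θ f (noise ν h τ Sig) π₀ (fun n => Y n ω) t univ = 1 ∧
      post Θ f (noise ν h τ Sig) π₀ (fun n => Y n ω) t Θᶜ = 0)
    (h1 : ∀ p, 0 < h (τ p)) (h2 : Tendsto (fun p => τ (p + 1) - τ p) atTop atTop)
    (h3 : Tendsto (fun p => ((τ (p + 1) : ℝ) - τ p) *
      ∑ s ∈ Finset.Ioo (τ p) (τ (p + 1)), h s ^ 2) atTop (𝓝 0))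
    (h5 : Tendsto (fun p => Real.log (h (τ p)) / ((τ (p + 1) : ℝ) - τ p)) atTop (𝓝 0))
    (hstart : ∀ ε > 0, Tendsto (fun p => P {ω | ENNReal.ofReal (h (τ p) ^ ν) <
      post Θ f (noise ν h τ Sig) π₀ (fun n => Y n ω) (τ p) (ball θs ε)ᶜ}) atTop (𝓝 0))
    {ε η : ℝ} (hε : 0 < ε) (hη : 0 < η) :
    ∃ k₀ : ℕ, ∀ᶠ p in atTop, ∀ k ≥ k₀, k + 1 ≤ τ (p + 1) - τ p →
      P {ω | ENNReal.ofReal η < post Θ f (noise ν h τ Sig) π₀ (fun n => Y n ω) (τ p + (k + 1))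
        (ball θs ε)ᶜ} ≤ ENNReal.ofReal η := by
  obtain ⟨N, δ₀, r, g₁, s, x, hδ₀, hr, hg₁, hs, hxs, H⟩ := block_estimate (π₀ := π₀)
    (μ := noise ν h τ Sig) hYm hYi hYd hΘ hf ht hball hA1 hA4 hA5 hcμ hε
  have hcμ0 : 0 < cμ := one_pos.trans_le hcμ1
  obtain ⟨a₀, ha₀, hland⟩ := le_student_noise_ball_far (h := h) hν τ hSig hC hSigb (β := 0)
    (M := s / 2 + 2) (r := s / 2) le_rfl (by positivity)
  obtain ⟨c₀, hc₀, htail⟩ := student_noise_compl_ball_le (h := h) hν τ hSig hC hSigb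
    (show 0 < ε / 4 by positivity)
  obtain ⟨k₁, hk₁⟩ := H (ENNReal.ofReal (η / (4 * (N + 2)))) (by simp; positivity)
  set M : ℝ := 4 * (N + 1) / η with hM
  have hM0 : 0 < M := by positivity
  set V : ℝ := cμ + c₀ with hV
  obtain ⟨k₂, hk₂⟩ := eventually_atTop.1 (eventually_mul_exp_le tendsto_id
    (2 * (N * M * V + 1) / (a₀ / 2)) (show 0 < 7 / 8 * δ₀ by positivity) hη)
  set e₁ : ℝ := min (ε / 4) 1 with he₁
  have he₁0 : 0 < e₁ := by positivity
  refine ⟨max k₁ k₂, ?_⟩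
  have hhν : Tendsto (fun p => h (τ p) ^ ν) atTop (𝓝 0) := by
    have := (hh0.comp hτ.tendsto_atTop).rpow_const (p := ν) (Or.inr hν.le)
    rwa [Real.zero_rpow hν.ne'] at this
  filter_upwards [eventually_walk_tail (h := h) hτ hSig hC (fun t => (hSigb t).1) h2 h3
      (show 0 < s / 2 by positivity) 1,
    eventually_walk_tail (h := h) hτ hSig hC (fun t => (hSigb t).1) h2 h3 hr (g₁ + 2 * δ₀ + 1),
    eventually_exp_le_rpow hτ h1 h5 hν.le hδ₀,
    hτ.tendsto_atTop.eventually (hh0.eventually_le_const one_pos),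
    hhν.eventually_le_const (show (0 : ℝ) < 1 / 2 by norm_num),
    ENNReal.tendsto_nhds_zero.1 (hstart e₁ he₁0) (ENNReal.ofReal (η / 4)) (by simp; positivity),
    eventually_mul_exp_le h2 cμ one_pos (show 0 < η / 4 by positivity)]
    with p htail1 htail2 hq hh1 hhalf1 hstartp hn2 k hk hle
  set L : ℝ := ((τ (p + 1) - τ p : ℕ) : ℝ) with hL
  have hL1 : 1 ≤ L := by
    rw [hL]; exact_mod_cast (by omega : 1 ≤ τ (p + 1) - τ p)
  have ht1 := htail1 k hle
  have ht2 := htail2 k hle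
  set q : ℝ := h (τ p) ^ ν with hqdef
  have hq0 : 0 < q := Real.rpow_pos_of_pos (h1 p) _
  set Hs : Set (Measure (Rd d)) :=
    {m | m (ball θs e₁)ᶜ ≤ ENNReal.ofReal q ∧ m univ = 1} with hHs
  have hHm : MeasurableSet Hs :=
    (measurableSet_le (Measure.measurable_coe measurableSet_ball.compl) measurable_const).inter
      (Measure.measurable_coe MeasurableSet.univ (measurableSet_singleton (1 : ℝ≥0∞)))
  set n : ℝ := ((k + 1 : ℕ) : ℝ) with hn
  have hnL : n ≤ L := by rw [hn, hL]; exact_mod_cast hle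
  have hexp2 : Real.exp (-(1 * L)) ≤ 1 / 2 := by
    have h6 : (2 : ℝ) ≤ Real.exp L := by linarith [Real.add_one_le_exp L]
    rw [one_mul, Real.exp_neg, one_div]
    exact inv_anti₀ two_pos h6
  have hhalf : ENNReal.ofReal (1 / 2) = 1 / 2 := by
    rw [one_div, one_div, ENNReal.ofReal_inv_of_pos two_pos]; simp
  -- the mass of the far region and that of the ball near the target are both of order `q`, which
  -- cancels; the level `M` is a constant, so that only a probability `η / 4` is lost
  have key := hk₁ k ((le_max_left _ _).trans hk) (τ p) (blockStep h τ Sig p)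
    (noise_eq_blockStep hτ hle)
    ((ht1.trans (ENNReal.ofReal_le_ofReal hexp2)).trans hhalf.le) _ ht2 Hs hHm (V * q)
    (a₀ / 2 * q) M (Real.exp (-((g₁ + 2 * δ₀) * L))) (by positivity)
    (by positivity) hM0 (Real.exp_pos _)
    (fun y hy => by
      have e1 := predict_compl_ball_le (θs := θs) (Θ := Θ) (f := f) (π₀ := π₀)
        (μ := noise ν h τ Sig) (τ p) y (ε / 4)
      rw [show 2 * (ε / 4) = ε / 2 by ring] at e1
      refine e1.trans ?_
      rw [hV, add_mul, ENNReal.ofReal_add (by positivity) (by positivity),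
        ENNReal.ofReal_mul hcμ0.le]
      refine add_le_add (mul_le_mul' (hcμ _) ?_) (htail (τ p) (mem_range_self p) (h1 p))
      exact (measure_mono (compl_subset_compl.2 (ball_subset_ball (min_le_left _ _)))).trans hy.1)
    (fun y hy => by
      have e1 : ∀ θ ∈ ball θs e₁, ENNReal.ofReal (a₀ * q) ≤
          noise ν h τ Sig (τ p) {u | u + θ ∈ ball x (s / 2)} := by
        intro θ hθ
        have e2 := hland (τ p) (mem_range_self p) (h1 p) hh1 (x - θ)
        rw [zero_mul, add_zero, neg_zero, Real.rpow_zero, mul_one] at e2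
        rw [setOf_add_mem_ball]
        refine e2 fun z hz => ?_
        rw [mem_ball_iff_norm] at hz hθ
        rw [mem_closedBall_zero_iff]
        have hx1 : ‖x - θs‖ < 1 := mem_ball_iff_norm.1 (hxs (mem_ball_self hs)).2
        have hθ1 : ‖θ - θs‖ < 1 := hθ.trans_le (min_le_right _ _)
        calc ‖z‖ = ‖(z - (x - θ)) + (x - θs) - (θ - θs)‖ := by congr 1; abel
          _ ≤ ‖z - (x - θ)‖ + ‖x - θs‖ + ‖θ - θs‖ :=
            (norm_sub_le _ _).trans (by gcongr; exact norm_add_le _ _)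
          _ ≤ s / 2 + 2 := by linarith
      have e3 : ENNReal.ofReal (1 / 2) ≤
          post Θ f (noise ν h τ Sig) π₀ y (τ p) (ball θs e₁) := by
        have e4 : ENNReal.ofReal (1 / 2) + ENNReal.ofReal (1 / 2) ≤
            post Θ f (noise ν h τ Sig) π₀ y (τ p) (ball θs e₁) + ENNReal.ofReal (1 / 2) := by
          calc _ = (1 : ℝ≥0∞) := by
                rw [← ENNReal.ofReal_add (by norm_num) (by norm_num)]; norm_num
            _ = post Θ f (noise ν h τ Sig) π₀ y (τ p) (ball θs e₁ ∪ (ball θs e₁)ᶜ) := by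
                rw [union_compl_self]; exact hy.2.symm
            _ ≤ _ := measure_union_le _ _
            _ ≤ _ := by
                gcongr
                exact hy.1.trans (ENNReal.ofReal_le_ofReal hhalf1)
        exact (ENNReal.add_le_add_iff_right ENNReal.ofReal_ne_top).1 e4
      calc ENNReal.ofReal (a₀ / 2 * q) = ENNReal.ofReal (a₀ * q) * ENNReal.ofReal (1 / 2) := by
            rw [← ENNReal.ofReal_mul (by positivity)]; congr 1; ring
        _ ≤ ENNReal.ofReal (a₀ * q) *
            post Θ f (noise ν h τ Sig) π₀ y (τ p) (ball θs e₁) := by gcongr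
        _ ≤ _ := mul_post_le_predict _ _ measurableSet_ball measurableSet_ball e1)
  have hratio := ratio_block_le (N := N) (M := M) (V := V) (g₁ := g₁) (δ₀ := δ₀) (a := a₀ / 2)
    (q := q) (n := n) (L := L) (η := η) hg₁ hδ₀.le hnL (by positivity) hq
    (hk₂ (k + 1) (((le_max_right _ _).trans hk).trans (Nat.le_succ k)))
  have hsub : ∀ᵐ ω ∂P, ω ∈ {ω | ENNReal.ofReal η <
        post Θ f (noise ν h τ Sig) π₀ (fun n => Y n ω) (τ p + (k + 1)) (ball θs ε)ᶜ} →
      ω ∈ {ω | post Θ f (noise ν h τ Sig) π₀ (fun i => Y i ω) (τ p) ∈ Hs ∧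
          ENNReal.ofReal ((N * (M * (V * q) * Real.exp (-(δ₀ * n))) +
            Real.exp (g₁ * n) * Real.exp (-((g₁ + 2 * δ₀) * L))) /
              (a₀ / 2 * q * (1 / 2 * Real.exp (-(δ₀ / 8 * n))))) <
            post Θ f (noise ν h τ Sig) π₀ (fun i => Y i ω) (τ p + (k + 1)) (ball θs ε)ᶜ} ∪
        {ω | ENNReal.ofReal q <
          post Θ f (noise ν h τ Sig) π₀ (fun n => Y n ω) (τ p) (ball θs e₁)ᶜ} := by
    filter_upwards [hprob] with ω hω hlt
    by_cases hfar : ENNReal.ofReal q <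
          post Θ f (noise ν h τ Sig) π₀ (fun n => Y n ω) (τ p) (ball θs e₁)ᶜ
    · exact Or.inr hfar
    · exact Or.inl ⟨⟨not_lt.1 hfar, (hω _).1⟩,
        (ENNReal.ofReal_le_ofReal hratio).trans_lt hlt⟩
  calc _ ≤ _ := measure_mono_ae hsub
    _ ≤ _ := measure_union_le _ _
    _ ≤ _ := add_le_add key hstartp
    _ ≤ ENNReal.ofReal η := by
        have q1 : ((N : ℝ≥0∞) + 2) * ENNReal.ofReal (η / (4 * (N + 2))) =
            ENNReal.ofReal (η / 4) := by
          have : ((N : ℝ≥0∞) + 2) = ENNReal.ofReal ((N : ℝ) + 2) := by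
            rw [ENNReal.ofReal_add (by positivity) (by positivity)]; simp
          rw [this, ← ENNReal.ofReal_mul (by positivity)]
          congr 1; field_simp
        have q2 : (N : ℝ≥0∞) * ENNReal.ofReal (1 / M) ≤ ENNReal.ofReal (η / 4) := by
          rw [← ENNReal.ofReal_natCast, ← ENNReal.ofReal_mul (by positivity)]
          refine ENNReal.ofReal_le_ofReal ?_
          rw [hM, one_div_div, ← mul_div_assoc, div_le_div_iff₀ (by positivity) (by norm_num)]
          nlinarith
        have q3 : ENNReal.ofReal (cμ / Real.exp (-((g₁ + 2 * δ₀) * L))) *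
            ENNReal.ofReal (Real.exp (-((g₁ + 2 * δ₀ + 1) * L))) ≤ ENNReal.ofReal (η / 4) := by
          rw [← ENNReal.ofReal_mul (by positivity)]
          refine ENNReal.ofReal_le_ofReal (le_trans (le_of_eq ?_) hn2)
          rw [div_eq_mul_inv, ← Real.exp_neg, mul_assoc, ← Real.exp_add]
          congr 2; ring
        calc _ ≤ ENNReal.ofReal (η / 4) + (ENNReal.ofReal (η / 4) + ENNReal.ofReal (η / 4)) +
              ENNReal.ofReal (η / 4) := by gcongr; exact q1.le
          _ = ENNReal.ofReal η := by
              rw [← ENNReal.ofReal_add (by positivity) (by positivity),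
                ← ENNReal.ofReal_add (by positivity) (by positivity),
                ← ENNReal.ofReal_add (by positivity) (by positivity)]
              congr 1; ring

omit [MeasurableSpace S] in
/-- A point of `Θ` near the target remains in `Θ` and near the target with a probability bounded
below after a small move: the interior balls have the scale of the noise. -/
lemma exists_landing (hball : InteriorBalls Θ θs) (hν : 0 < ν) (hh : ∀ t, 0 ≤ h t)
    (hh0 : Tendsto h atTop (𝓝 0)) (hSig : ∀ t, (Sig t).PosDef) (hC : 0 < C)
    (hSigb : ∀ t, ‖Matrix.toEuclideanCLM (𝕜 := ℝ) (Sig t)‖ ≤ C ∧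
      ‖Matrix.toEuclideanCLM (𝕜 := ℝ) (Sig t)⁻¹‖ ≤ C) :
    ∃ c > (0 : ℝ), ∃ r₁ > (0 : ℝ), ∀ r, 0 < r → r ≤ r₁ → ∀ᶠ t in atTop,
      ∀ θ ∈ Θ ∩ ball θs r,
        ENNReal.ofReal c ≤ noise ν h τ Sig t {u | u + θ ∈ Θ ∩ ball θs (2 * r)} := by
  obtain ⟨κ, hκ, r₀, hr₀, hκball⟩ := hball
  obtain ⟨c, hc, H⟩ := le_noise_ball_near (h := h) hν τ hSig hC hSigb hκ
  refine ⟨min c 1, by positivity, r₀, hr₀, fun r hr hrr => ?_⟩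
  filter_upwards [hh0.eventually_lt_const hr] with t hht θ hθ
  rcases (hh t).eq_or_lt with h0 | h0
  · rw [noise_of_eq_zero h0.symm, Measure.dirac_apply_of_mem]
    · exact ENNReal.ofReal_le_one.2 (min_le_right _ _)
    · simp only [mem_ofPred_eq, zero_add]
      exact ⟨hθ.1, ball_subset_ball (by linarith) hθ.2⟩
  · obtain ⟨x, hx⟩ := hκball θ ⟨hθ.1, ball_subset_ball hrr hθ.2⟩ (h t) h0 (hht.trans_le hrr)
    have hx1 : ‖x - θ‖ ≤ h t :=
      (mem_ball_iff_norm.1 (hx (mem_ball_self (by positivity))).2).le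
    calc ENNReal.ofReal (min c 1) ≤ ENNReal.ofReal c :=
          ENNReal.ofReal_le_ofReal (min_le_left _ _)
      _ ≤ noise ν h τ Sig t (ball (x - θ) (κ * h t)) := H t h0 _ hx1
      _ ≤ _ := measure_mono fun u hu => by
          rw [← setOf_add_mem_ball] at hu
          have h1 := hx hu
          refine ⟨h1.1, ?_⟩
          have h2 := mem_ball_iff_norm.1 h1.2
          have h3 := mem_ball_iff_norm.1 hθ.2
          rw [mem_ball_iff_norm]
          calc ‖u + θ - θs‖ = ‖(u + θ - θ) + (θ - θs)‖ := by congr 1; abel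
            _ ≤ ‖u + θ - θ‖ + ‖θ - θs‖ := norm_add_le _ _
            _ < 2 * r := by linarith

end Inside

/-! ### Convergence along the whole sequence -/

section Conclusion

lemma levyProkhorovDist_dirac_le {d : ℕ} {m : Measure (Rd d)} (hm : m univ = 1) {θs : Rd d}
    {ε : ℝ} (hε : 0 ≤ ε) (h : m (ball θs ε)ᶜ ≤ ENNReal.ofReal ε) :
    levyProkhorovDist m (Measure.dirac θs) ≤ ε := by
  have : IsProbabilityMeasure m := ⟨hm⟩
  refine ENNReal.toReal_le_of_le_ofReal hε
    (levyProkhorovEDist_le_of_forall_le _ _ _ fun e B he hetop _ => ?_)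
  have hεe : ε ≤ e.toReal := by
    rw [← ENNReal.ofReal_le_iff_le_toReal hetop.ne]; exact he.le
  by_cases hθ : θs ∈ thickening e.toReal B
  · rw [Measure.dirac_apply_of_mem hθ]
    exact (measure_mono (subset_univ B)).trans (hm.le.trans le_self_add)
  · have hsub : B ⊆ (ball θs ε)ᶜ := fun x hx hxb => hθ <| mem_thickening_iff.2
      ⟨x, hx, by rw [dist_comm]; exact (mem_ball.1 hxb).trans_le hεe⟩
    exact le_add_left ((measure_mono hsub).trans (h.trans he.le))

/-- A property which passes from each time to the next, up to a change of the constants, holds at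
any bounded number of steps after the times `τ p` if it holds at these times. -/
lemma forall_eventually_add {B : ℕ → ℝ → ℝ → Prop} {τ : ℕ → ℕ} (hτ : Tendsto τ atTop atTop)
    (hstart : ∀ ε > 0, ∀ η > 0, ∀ᶠ p in atTop, B (τ p) ε η)
    (hstep : ∀ ε > 0, ∀ η > 0, ∃ ε' > 0, ∃ η' > 0, ∀ᶠ t in atTop, B t ε' η' → B (t + 1) ε η)
    (k : ℕ) : ∀ ε > 0, ∀ η > 0, ∀ᶠ p in atTop, B (τ p + k) ε η := by
  induction k with
  | zero => exact hstart
  | succ k ih =>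
    intro ε hε η hη
    obtain ⟨ε', hε', η', hη', hev⟩ := hstep ε hε η hη
    filter_upwards [ih ε' hε' η' hη',
      (tendsto_atTop_mono (fun p => Nat.le_add_right (τ p) k) hτ).eventually hev] with p hp hp'
    exact hp' hp

lemma eventually_of_blocks {Q : ℕ → Prop} {τ : ℕ → ℕ} (hτ : StrictMono τ)
    (h : ∀ᶠ p in atTop, ∀ k, τ p + k < τ (p + 1) → Q (τ p + k)) : ∀ᶠ t in atTop, Q t := by
  obtain ⟨p₀, hp₀⟩ := eventually_atTop.1 h
  refine eventually_atTop.2 ⟨τ p₀, fun t ht => ?_⟩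
  set p := Nat.findGreatest (fun p => τ p ≤ t) t with hp
  have hp₀t : p₀ ≤ t := (hτ.id_le p₀).trans ht
  have h1 : τ p ≤ t := Nat.findGreatest_spec (P := fun p => τ p ≤ t) hp₀t ht
  have h2 : p₀ ≤ p := Nat.le_findGreatest hp₀t ht
  have h3 : t < τ (p + 1) := by
    by_contra hcon
    have h4 : p + 1 ≤ t := (hτ.id_le (p + 1)).trans (not_lt.1 hcon)
    exact Nat.findGreatest_is_greatest (Nat.lt_succ_self p) h4 (not_lt.1 hcon)
  have h5 := hp₀ p h2 (t - τ p) (by omega)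
  rwa [Nat.add_sub_of_le h1] at h5

end Conclusion

end GPFSO

theorem theorem2 {d : ℕ} {Ω S : Type*} [MeasurableSpace Ω] [MeasurableSpace S]
    (P : Measure Ω) [IsProbabilityMeasure P]
    -- the observations: `Y t` is the observation made at time `t + 1`
    (Y : ℕ → Ω → S) (hYm : ∀ n, Measurable (Y n)) (hYi : iIndepFun Y P)
    (hYd : ∀ n, IdentDistrib (Y n) (Y 0) P P)
    -- the model and its target parameter value
    (Θ : Set (GPFSO.Rd d)) (hΘ : MeasurableSet Θ)
    (f : GPFSO.Rd d → S → ℝ≥0) (hf : Measurable fun q : Θ × S => f q.1 q.2)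
    (θs : GPFSO.Rd d) (hθs : GPFSO.IsTarget (P.map (Y 0)) Θ f θs)
    (hball : GPFSO.InteriorBalls Θ θs)
    (hA1 : GPFSO.LocallyLipschitz (P.map (Y 0)) Θ f θs)
    (hA2 : GPFSO.QuadraticBound (P.map (Y 0)) Θ f θs)
    (hA3 : GPFSO.ConsistentTests (P.map (Y 0)) Θ f θs)
    (hA4 : GPFSO.Localizable (P.map (Y 0)) Θ f θs)
    (hA5 : GPFSO.UpperControl (P.map (Y 0)) Θ f θs)
    -- the ingredients of the sequence of distributions
    (ν : ℝ) (hν : 0 < ν)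
    (h : ℕ → ℝ) (hh : ∀ t, 0 ≤ h t) (hh0 : Tendsto h atTop (𝓝 0))
    (τ : ℕ → ℕ) (hτ : StrictMono τ)
    (Sig : ℕ → Matrix (Fin d) (Fin d) ℝ) (hSig : ∀ t, (Sig t).PosDef)
    (hSigb : ∃ C : ℝ, ∀ t, ‖Matrix.toEuclideanCLM (𝕜 := ℝ) (Sig t)‖ ≤ C ∧
      ‖Matrix.toEuclideanCLM (𝕜 := ℝ) (Sig t)⁻¹‖ ≤ C)
    (π₀ : Measure (GPFSO.Rd d)) [IsProbabilityMeasure π₀] (hπΘ : π₀ Θᶜ = 0) (hπac : π₀ ≪ volume)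
    (π : ℕ → Ω → Measure (GPFSO.Rd d))
    (hπ : π = fun t ω => GPFSO.post Θ f (GPFSO.noise ν h τ Sig) π₀ (fun n => Y n ω) t)
    -- the sequence is well defined
    (hZ : ∀ t, ∀ᵐ ω ∂P,
      GPFSO.normConst Θ f ((GPFSO.noise ν h τ Sig t).conv (π t ω)) (Y t ω) ≠ 0)
    -- the conditions on `h` and `τ`
    (h1 : ∀ p, 0 < h (τ p))
    (h2 : Tendsto (fun p => τ (p + 1) - τ p) atTop atTop)
    (h3 : Tendsto (fun p => ((τ (p + 1) : ℝ) - τ p) *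
      ∑ s ∈ Finset.Ioo (τ p) (τ (p + 1)), h s ^ 2) atTop (𝓝 0))
    (h4 : ∃ C : ℝ, ∀ᶠ p in atTop,
      ((τ (p + 2) : ℝ) - τ (p + 1)) / ((τ (p + 1) : ℝ) - τ p) ≤ C)
    (h5 : Tendsto (fun p => Real.log (h (τ p)) / ((τ (p + 1) : ℝ) - τ p)) atTop (𝓝 0))
    -- the tightness condition
    (htight : ∃ β c : ℝ, 1 < β ∧ 1 < c ∧
      Tendsto (fun p => P {ω | ENNReal.ofReal β⁻¹ ≤
        π (τ p) ω (GPFSO.farSet Θ θs (c / h (τ p) ^ β))}) atTop (𝓝 0)) :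
    TendstoInMeasure P (fun t ω => levyProkhorovDist (π t ω) (Measure.dirac θs)) atTop
      (fun _ => (0 : ℝ)) := by
  subst hπ
  set ρ := P.map (Y 0) with hρ
  have : IsProbabilityMeasure ρ := Measure.isProbabilityMeasure_map (hYm 0).aemeasurable
  have hlaw : ∀ n, P.map (Y n) = ρ := fun n => (hYd n).map_eq
  obtain ⟨C₀, hC₀⟩ := hSigb
  obtain ⟨C, hC, hSigC⟩ : ∃ C : ℝ, 0 < C ∧ ∀ t, ‖Matrix.toEuclideanCLM (𝕜 := ℝ) (Sig t)‖ ≤ C ∧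
      ‖Matrix.toEuclideanCLM (𝕜 := ℝ) (Sig t)⁻¹‖ ≤ C :=
    ⟨max C₀ 1, by positivity, fun t =>
      ⟨(hC₀ t).1.trans (le_max_left _ _), (hC₀ t).2.trans (le_max_left _ _)⟩⟩
  obtain ⟨cμ, hcμ1, hcμ⟩ := GPFSO.noise_univ_le (h := h) hν hh τ hSig hC hSigC
  have : ∀ t, IsFiniteMeasure (GPFSO.noise ν h τ Sig t) :=
    fun t => ⟨(hcμ t).trans_lt ENNReal.ofReal_lt_top⟩
  have hprob := GPFSO.ae_post_univ hYm hYi hlaw hΘ hf hθs hA5 hπΘ hZ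
  set B : ℕ → ℝ → ℝ → Prop := fun t ε η => P {ω | ENNReal.ofReal η <
    GPFSO.post Θ f (GPFSO.noise ν h τ Sig) π₀ (fun n => Y n ω) t (ball θs ε)ᶜ} ≤
      ENNReal.ofReal η with hB
  -- concentration at the times of the Student moves
  have hstart : ∀ ε > 0, Tendsto (fun p => P {ω | ENNReal.ofReal (h (τ p) ^ ν) <
      GPFSO.post Θ f (GPFSO.noise ν h τ Sig) π₀ (fun n => Y n ω) (τ p) (ball θs ε)ᶜ})
      atTop (𝓝 0) := by
    intro ε hε
    obtain ⟨δ, hδ, hlim⟩ := GPFSO.exists_tendsto_block_end hYm hYi hlaw hΘ hf hθs hball hA1 hA4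
      hA5 hν hh0 hτ hSig hC hSigC hcμ1 hcμ hprob h1 h2 h3 h5 htight hε
    rw [← tendsto_add_atTop_iff_nat 1]
    refine tendsto_of_tendsto_of_tendsto_of_le_of_le' tendsto_const_nhds hlim
      (Eventually.of_forall fun _ => zero_le) ?_
    filter_upwards [GPFSO.eventually_exp_le_rpow_succ hτ h1 h4 h5 hν.le hδ] with p hp
    exact measure_mono fun ω hω => (ENNReal.ofReal_le_ofReal hp).trans_lt hω
  have hτB : ∀ ε > 0, ∀ η > 0, ∀ᶠ p in atTop, B (τ p) ε η := by
    intro ε hε η hη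
    have hhν : Tendsto (fun p => h (τ p) ^ ν) atTop (𝓝 0) := by
      have := (hh0.comp hτ.tendsto_atTop).rpow_const (p := ν) (Or.inr hν.le)
      rwa [Real.zero_rpow hν.ne'] at this
    filter_upwards [hhν.eventually_le_const hη, ENNReal.tendsto_nhds_zero.1 (hstart ε hε)
      (ENNReal.ofReal η) (by simpa using hη)] with p hp hp'
    exact (measure_mono fun ω hω => (ENNReal.ofReal_le_ofReal hp).trans_lt hω).trans hp'
  have hstep : ∀ ε > 0, ∀ η > 0, ∃ ε' > 0, ∃ η' > 0, ∀ᶠ t in atTop,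
      B t ε' η' → B (t + 1) ε η := fun ε hε η hη =>
    GPFSO.exists_step hYm hYi hlaw hΘ hf hθs hA1 hA5 hprob (one_pos.trans_le hcμ1) hcμ
      (fun ε hε => GPFSO.tendsto_noise_compl_ball hν hh τ hSig hC hSigC hh0 hε)
      (GPFSO.exists_landing hball hν hh hh0 hSig hC hSigC) hε hη
  -- a block is split into a bounded number of initial times and the subsequent ones
  have hall : ∀ ε > 0, ∀ η > 0, ∀ᶠ t in atTop, B t ε η := by
    intro ε hε η hη
    obtain ⟨k₀, hk₀⟩ := GPFSO.exists_eventually_block hYm hYi hlaw hΘ hf hθs hball hA1 hA4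
      hA5 hν hh0 hτ hSig hC hSigC hcμ1 hcμ hprob h1 h2 h3 h5 hstart hε hη
    have hfirst : ∀ᶠ p in atTop, ∀ k ∈ Finset.range (k₀ + 1), B (τ p + k) ε η :=
      (Finset.eventually_all _).2 fun k _ =>
        GPFSO.forall_eventually_add hτ.tendsto_atTop hτB hstep k ε hε η hη
    refine GPFSO.eventually_of_blocks hτ ?_
    filter_upwards [hk₀, hfirst] with p hp hp' k hk
    by_cases hkk : k < k₀ + 1
    · exact hp' k (Finset.mem_range.2 hkk)
    · obtain ⟨j, rfl⟩ : ∃ j, k = j + 1 := ⟨k - 1, by omega⟩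
      exact hp j (by omega) (by omega)
  -- the Prohorov distance to a Dirac mass is controlled by the mass outside of a ball
  intro e he
  refine ENNReal.tendsto_nhds_zero.2 fun η hη => ?_
  obtain ⟨η₁, hη₁0, hη₁⟩ := GPFSO.exists_ofReal_le hη
  obtain ⟨e₁, he₁0, he₁⟩ := GPFSO.exists_ofReal_le he
  set κ : ℝ := min η₁ (e₁ / 2) with hκ
  have hκ0 : 0 < κ := by positivity
  filter_upwards [hall κ hκ0 κ hκ0] with t ht
  refine (measure_mono_ae ?_).trans
    (ht.trans ((ENNReal.ofReal_le_ofReal (min_le_left _ _)).trans hη₁))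
  filter_upwards [hprob] with ω hω hωe
  by_contra hcon
  have hle := GPFSO.levyProkhorovDist_dirac_le (hω t).1 hκ0.le (not_lt.1 hcon)
  have h6 : ENNReal.ofReal e₁ ≤ ENNReal.ofReal κ := by
    refine he₁.trans (le_trans hωe ?_)
    rw [edist_dist, Real.dist_0_eq_abs, abs_of_nonneg
      (show (0 : ℝ) ≤ levyProkhorovDist _ _ from ENNReal.toReal_nonneg)]
    exact ENNReal.ofReal_le_ofReal hle
  have h7 := (ENNReal.ofReal_le_ofReal_iff hκ0.le).1 h6
  have h8 : κ ≤ e₁ / 2 := min_le_right _ _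
  linarith
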